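/- **Setting.** Let $\mathbb T^2=\mathbb R^2/\mathbb Z^2$ and $\mathbb N=\{1,2,\dots\}$; $L^pL^q$, $C^0L^p$, $C^0_{\mathrm{weak-}*}L^\infty$ denote spaces of functions $[0,50]\to L^q(\mathbb T^2)$, etc. Let $u\in L^1([0,T];L^1(\mathbb T^2;\mathbb R^2))$ be divergence-free in the sense of distributions. * $f\in L^1L^1$ with $uf\in L^1L^1$ is a *weak solution* of the transport equation $\partial_t f+\nabla\cdot(uf)=0$ along $u$ with initial data $f_0\in L^1(\mathbb T^2)$ if $\int_{\mathbb T^2\times[0,T)} f(\partial_t\phi+u\cdot\nabla\phi)\,dx\,dt=-\int_{\mathbb T^2} f_0\,\phi(\cdot,0)\,dx$ for all $\phi\in C_c^\infty(\mathbb T^2\times[0,T))$. It is *renormalised* if for every bounded continuous $\beta:\mathbb R\to\mathbb R$ also $\beta(f)$ is a weak solution along $u$ with initial data $\beta(f_0)$. * A *Lagrangian flow* along $u$ is a family $(y_t)_{t\in[0,T]}$ of Lebesgue-measure preserving bijections of $\mathbb T^2$ such that for a.e. $x$ the curve $t\mapsto y_t(x)$ is absolutely continuous with $\frac{d}{dt}y_t(x)=u(y_t(x),t)$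 for a.e. $t$. A *Lagrangian solution* with initial data $f_0$ is an $f\in L^1L^1$ of the form $f(\cdot,t)=g\circ y_t^{-1}$ with $g\in L^1(\mathbb T^2)$, $(y_t)$ a Lagrangian flow along $u$ and $f_0=g\circ y_0^{-1}$. **Binary swaps.** For $W,H>0$ let $R_{W,H}=\nabla^\perp\psi=(-\partial_2\psi,\partial_1\psi)$ with $\psi(x)=\min\{W,H\}\max\{(x_1/W)^2,(x_2/H)^2\}$ on the centred $W\times H$ rectangle; on a translated rectangle use the translated field. Let $k,L\in\mathbb N$ with $L\ge k+1$, $1\le n\le 2^{\lfloor k/2\rfloor}$, $W=2^{-k}$ and $J_{k,n}=[(n-1)2^{-\lfloor k/2\rfloor},n2^{-\lfloor k/2\rfloor}]$. The field $u^{(1,k,n;L)}:\mathbb T^2\times[0,3\cdot2^{-k}]\to\mathbb R^2$ is zero except on the sets $(2rW+\frac W2,2rW+\frac{3W}2)\times\mathbb T$, $r\in\mathbb Z_{\ge0}$, with $[2rW,2(r+1)W]\subset J_{k,n}$. Cut each such set into the strips $x_2\in(j2^{-L},(j+1)2^{-L})$, $0\le j<2^L$. For $t\in[0,2W)$ the field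 on the $j$-th resulting $W\times2^{-L}$ rectangle is $(-1)^{j+1}R_{W,2^{-L}}$; for $t\in[2W,3W]$ each of these rectangles is halved vertically and the field on each $\frac W2\times2^{-L}$ half is $(-1)^{j+1}R_{W/2,2^{-L}}$. (At time $3W$ this exchanges the $k$-th and $(k+1)$-th binary digits of $x_1$ when $x_1\in J_{k,n}$.) The field $u^{(2,k,n;L)}$ is obtained from $u^{(1,k,n;L)}$ by exchanging the two coordinates. **Mixing fields.** Let $\mathcal N=\{(k,m,i,n)\in\mathbb N^4: m\le k,\ i\in\{1,2\},\ n\le2^{\lfloor k/2\rfloor}\}$, ordered lexicographically ($<_{\mathrm{lex}}$; order isomorphic to $\mathbb N$). Define a second order by $(k_1,m_1,i_1,n_1)<_{\mathrm{time}}(k_2,m_2,i_2,n_2)$ iff $(m_1,k_2,i_2,n_2)<_{\mathrm{lex}}(m_2,k_1,i_1,n_1)$, and let $T_{\mathcal P}=\sum_{(k',m',i',n')<_{\mathrm{time}}\mathcal P}3\cdot2^{-k'}$. The intervals $[T_{\mathcal P},T_{\mathcal P}+3\cdot2^{-k})$, $\mathcal P=(k,m,i,n)\in\mathcal N$, are disjoint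 subsets of $[0,42]$. Given integers $L_{\mathcal P}\ge k+1$, let $u_\infty:\mathbb T^2\times[0,50]\to\mathbb R^2$ be $u^{(i,k,n;L_{\mathcal P})}(x,t-T_{\mathcal P})$ for $t\in[T_{\mathcal P},T_{\mathcal P}+3\cdot2^{-k})$, $\mathcal P=(k,m,i,n)\in\mathcal N$, and $0$ at all other times. For $\mathcal K\in\mathcal N$ let $u_{\mathcal K}$ be defined in the same way using only the $\mathcal P\le_{\mathrm{lex}}\mathcal K$. **Proposition (Mixing).** Let $f_0\in L^\infty(\mathbb T^2)$ and let $\{L_{\mathcal P}\}_{\mathcal P\in\mathcal N}\subset\mathbb N$ satisfy $L_{(k,m,i,n)}\ge k+1$ for all $(k,m,i,n)\in\mathcal N$. Then for each $\mathcal K\in\mathcal N$ there is a unique weak solution $f^{\mathcal K}$ on $[0,50]$ of the transport equation along $u_{\mathcal K}$ with initial data $f_0$. Moreover $f^{\mathcal K}\in(C^0L^1)\cap(L^\infty L^\infty)$, and $f^{\mathcal K}$ is a Lagrangian solution and a renormalised weak solution. As $\mathcal K\to\infty$ with respect to $<_{\mathrm{lex}}$, $f^{\mathcal K}\to f^\infty$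 weak-$*$ in $L^\infty L^\infty$, and strongly in $L^p([0,42];L^p)$ and in $C^0([0,42-\epsilon];L^p)$ for all $p\in[1,\infty)$ and all $\epsilon>0$. The limit $f^\infty\in C^0_{\mathrm{weak-}*}L^\infty$ is a weak solution of the transport equation along $u_\infty$ with initial data $f_0$. Moreover, for all $t\in[42,50]$, $$f^\infty(\cdot,t)\equiv\int_{\mathbb T^2}f_0(y)\,dy .$$ -/

import Mathlib

open MeasureTheory Set Filter Topology
open scoped ContDiff ENNReal

noncomputable section

namespace Mixing

/-- The two-dimensional unit torus, with its Haar probability (Lebesgue) measure `volume`. -/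
abbrev T2 : Type := UnitAddCircle × UnitAddCircle

/-! ### Space-time functions

Functions on `𝕋² × [0,T]` are written with time first: `f t x`. -/

/-- Lebesgue measure on `[a,b] × 𝕋²`. -/
def stMeasure (a b : ℝ) : Measure (ℝ × T2) :=
  ((volume : Measure ℝ).restrict (Icc a b)).prod (volume : Measure T2)

/-- `f ∈ C⁰([a,b]; L^p(𝕋²))`. -/
def MemC0Lp (a b : ℝ) (p : ℝ≥0∞) (f : ℝ → T2 → ℝ) : Prop :=
  (∀ t ∈ Icc a b, MemLp (f t) p volume) ∧
    ∀ s ∈ Icc a b,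
      Tendsto (fun t => eLpNorm (fun x => f t x - f s x) p volume) (𝓝[Icc a b] s) (𝓝 0)

/-- `f ∈ C⁰_{weak-*}([0,T]; L^∞(𝕋²))`. -/
def MemC0WeakStar (T : ℝ) (f : ℝ → T2 → ℝ) : Prop :=
  (∀ t ∈ Icc 0 T, MemLp (f t) ∞ volume) ∧
    ∀ g : T2 → ℝ, Integrable g volume →
      ContinuousOn (fun t => ∫ x, f t x * g x) (Icc 0 T)

/-! ### Weak, renormalised and Lagrangian solutions of the transport equation -/

/-- Time derivative of a function on `ℝ × 𝕋²`. -/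
def dtime (φ : ℝ → T2 → ℝ) (t : ℝ) (x : T2) : ℝ := deriv (fun s => φ s x) t

/-- First spatial partial derivative of a function on `ℝ × 𝕋²`. -/
def dfst (φ : ℝ → T2 → ℝ) (t : ℝ) (x : T2) : ℝ :=
  deriv (fun s : ℝ => φ t (x.1 + (s : UnitAddCircle), x.2)) 0

/-- Second spatial partial derivative of a function on `ℝ × 𝕋²`. -/
def dsnd (φ : ℝ → T2 → ℝ) (t : ℝ) (x : T2) : ℝ :=
  deriv (fun s : ℝ => φ t (x.1, x.2 + (s : UnitAddCircle))) 0

/-- Test functions in `C_c^∞(𝕋² × [0,T))`: smooth (the periodic lift to `ℝ × ℝ²` is smooth) and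
vanishing for times near and beyond `T`. No condition is imposed at `t = 0`; the values at
negative times are only a smooth extension and play no role. -/
def IsTest (T : ℝ) (φ : ℝ → T2 → ℝ) : Prop :=
  ContDiff ℝ ∞ (fun z : ℝ × ℝ × ℝ => φ z.1 ((z.2.1 : UnitAddCircle), (z.2.2 : UnitAddCircle))) ∧
    ∃ T' < T, ∀ t, T' ≤ t → ∀ x, φ t x = 0

/-- `u ∈ L¹([0,T]; L¹)` with `∇ · u = 0` in the sense of distributions on `𝕋² × (0,T)`. -/
structure IsDivFree (T : ℝ) (u : ℝ → T2 → ℝ × ℝ) : Prop where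
  integrable : Integrable (Function.uncurry u) (stMeasure 0 T)
  div_zero : ∀ φ : ℝ → T2 → ℝ, IsTest T φ → (∃ δ > 0, ∀ t ≤ δ, ∀ x, φ t x = 0) →
    ∫ z, ((u z.1 z.2).1 * dfst φ z.1 z.2 + (u z.1 z.2).2 * dsnd φ z.1 z.2) ∂(stMeasure 0 T) = 0

/-- `f` is a weak solution on `[0,T]` of `∂ₜ f + ∇ · (u f) = 0` along the divergence-free field
`u`, with initial data `f₀`. -/
structure IsWeakSolution (T : ℝ) (u : ℝ → T2 → ℝ × ℝ) (f₀ : T2 → ℝ) (f : ℝ → T2 → ℝ) :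
    Prop where
  field : IsDivFree T u
  data : Integrable f₀ volume
  integrable : Integrable (Function.uncurry f) (stMeasure 0 T)
  flux : Integrable (fun z : ℝ × T2 => f z.1 z.2 • u z.1 z.2) (stMeasure 0 T)
  weak : ∀ φ : ℝ → T2 → ℝ, IsTest T φ →
    ∫ z, f z.1 z.2 * (dtime φ z.1 z.2 +
        ((u z.1 z.2).1 * dfst φ z.1 z.2 + (u z.1 z.2).2 * dsnd φ z.1 z.2)) ∂(stMeasure 0 T)
      = - ∫ x, f₀ x * φ 0 x

/-- Renormalised weak solution: `β(f)` is a weak solution with data `β(f₀)` for every bounded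
continuous `β`. -/
def IsRenormalised (T : ℝ) (u : ℝ → T2 → ℝ × ℝ) (f₀ : T2 → ℝ) (f : ℝ → T2 → ℝ) : Prop :=
  IsWeakSolution T u f₀ f ∧
    ∀ β : ℝ → ℝ, Continuous β → (∃ C, ∀ r, |β r| ≤ C) →
      IsWeakSolution T u (fun x => β (f₀ x)) (fun t x => β (f t x))

/-- Lagrangian flow along `u`: Lebesgue-measure preserving bijections `y t` of the torus such that
for a.e. `x` the curve `t ↦ y t x` is absolutely continuous on `[0,T]` with derivative
`u t (y t x)` for a.e. `t`. Absolute continuity and the derivative of the curve are those of a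
lift `γ` of it to `ℝ²`. -/
structure IsLagrangianFlow (T : ℝ) (u : ℝ → T2 → ℝ × ℝ) (y : ℝ → T2 ≃ᵐ T2) : Prop where
  preserving : ∀ t ∈ Icc 0 T, MeasurePreserving (y t) volume volume
  curve : ∀ᵐ x : T2, ∃ γ : ℝ → ℝ × ℝ,
    AbsolutelyContinuousOnInterval γ 0 T ∧
    (∀ t ∈ Icc 0 T, (((γ t).1 : UnitAddCircle), ((γ t).2 : UnitAddCircle)) = y t x) ∧
    ∀ᵐ t ∂((volume : Measure ℝ).restrict (Icc 0 T)), HasDerivAt γ (u t (y t x)) t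

/-- Lagrangian solution along `u` with initial data `f₀`: `f t = g ∘ (y t)⁻¹` for a Lagrangian
flow `y` along `u` and an integrable `g` with `f₀ = g ∘ (y 0)⁻¹`. -/
def IsLagrangianSolution (T : ℝ) (u : ℝ → T2 → ℝ × ℝ) (f₀ : T2 → ℝ) (f : ℝ → T2 → ℝ) : Prop :=
  Integrable (Function.uncurry f) (stMeasure 0 T) ∧
    ∃ (y : ℝ → T2 ≃ᵐ T2) (g : T2 → ℝ), IsLagrangianFlow T u y ∧ Integrable g volume ∧
      (f₀ =ᵐ[volume] fun x => g ((y 0).symm x)) ∧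
      ∀ t ∈ Icc 0 T, f t =ᵐ[volume] fun x => g ((y t).symm x)

/-! ### Binary swaps -/

/-- The stream function `min(W,H) max((x₁/W)², (x₂/H)²)` on the centred `W × H` rectangle. -/
def stream (W H : ℝ) (z : ℝ × ℝ) : ℝ := min W H * max ((z.1 / W) ^ 2) ((z.2 / H) ^ 2)

/-- The rotating field `∇^⊥ψ = (-∂₂ψ, ∂₁ψ)` of the stream function `ψ = stream W H`. (It is
undefined only on the two diagonals, which form a null set.) -/
def rotField (W H : ℝ) (z : ℝ × ℝ) : ℝ × ℝ :=
  (-deriv (fun s => stream W H (z.1, s)) z.2, deriv (fun s => stream W H (s, z.2)) z.1)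

/-- The field on `(0,W) × ℝ`, for times in `[0,3W]`, that exchanges the left and right halves.
The rectangle is cut into horizontal strips of height `2^{-L}`, on which the rotation is
alternately clockwise (even strips) and counterclockwise (odd strips). For `t < 2W` each
`W × 2^{-L}` rectangle is rotated about its centre; then each `W/2 × 2^{-L}` rectangle is. -/
def flipField (W : ℝ) (L : ℕ) (t : ℝ) (z : ℝ × ℝ) : ℝ × ℝ :=
  let h : ℝ := 1 / 2 ^ L
  let j : ℤ := ⌊z.2 / h⌋
  let σ : ℝ := if Even j then -1 else 1
  let b : ℝ := z.2 - (j + 1 / 2) * h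
  if t < 2 * W then σ • rotField W h (z.1 - W / 2, b)
  else if z.1 < W / 2 then σ • rotField (W / 2) h (z.1 - W / 4, b)
  else σ • rotField (W / 2) h (z.1 - 3 * W / 4, b)

/-- The representative in `[0,1)` of a point of the circle. -/
def rep (x : UnitAddCircle) : ℝ := (AddCircle.equivIco 1 0 x : ℝ)

/-- The interval `J_{k,n} = [(n-1) 2^{-⌊k/2⌋}, n 2^{-⌊k/2⌋}]`. -/
def slab (k n : ℕ) : Set ℝ := Icc (((n : ℝ) - 1) / 2 ^ (k / 2)) ((n : ℝ) / 2 ^ (k / 2))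

/-- The `(1,k,n;L)`-binary swap field. With `W = 2^{-k}`, each interval
`[2Wr, 2W(r+1)]` contained in `J_{k,n}` carries on its middle half
`(2Wr + W/2, 2Wr + 3W/2)` (times the circle) a copy of `flipField`; elsewhere the field is zero. -/
def swapFst (k n L : ℕ) (t : ℝ) (x : T2) : ℝ × ℝ :=
  let W : ℝ := 1 / 2 ^ k
  let a : ℝ := rep x.1
  let z : ℝ := a - 2 * W * ⌊a / (2 * W)⌋ - W / 2
  open Classical in
  if a ∈ slab k n ∧ z ∈ Ioo 0 W then flipField W L t (z, rep x.2) else 0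

/-- The `(i,k,n;L)`-binary swap field; `i = 2` is the coordinate reflection of `i = 1`. -/
def swapField (i k n L : ℕ) (t : ℝ) (x : T2) : ℝ × ℝ :=
  if i = 1 then swapFst k n L t x else (swapFst k n L t x.swap).swap

/-! ### The index set and its two orders -/

/-- The index set `𝒩` of quadruples `(k,m,i,n)` of positive integers with `m ≤ k`, `i ∈ {1,2}`
and `n ≤ 2^{⌊k/2⌋}`. -/
@[ext]
structure Idx where
  k : ℕ
  m : ℕ
  i : ℕ
  n : ℕ
  one_le_m : 1 ≤ m
  m_le_k : m ≤ k
  i_mem : i = 1 ∨ i = 2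
  one_le_n : 1 ≤ n
  n_le : n ≤ 2 ^ (k / 2)

/-- A quadruple in `ℕ⁴` with the lexicographic order. -/
def lex4 (a b c d : ℕ) : ℕ ×ₗ ℕ ×ₗ ℕ ×ₗ ℕ := toLex (a, toLex (b, toLex (c, d)))

theorem Idx.lex4_injective :
    Function.Injective (fun P : Idx => lex4 P.k P.m P.i P.n) := by
  intro P Q h
  have h1 := congrArg ofLex h
  simp only [lex4, ofLex_toLex, Prod.mk.injEq, toLex_inj] at h1
  exact Idx.ext h1.1 h1.2.1 h1.2.2.1 h1.2.2.2

/-- The lexicographic order on `𝒩`; the limit `𝒦 → ∞` is along `atTop` for this order. -/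
instance : LinearOrder Idx := LinearOrder.lift' _ Idx.lex4_injective

/-- The order `<_time`. -/
def Idx.TimeLT (P Q : Idx) : Prop := lex4 P.m Q.k Q.i Q.n < lex4 Q.m P.k P.i P.n

/-- The duration `3 · 2^{-k}` of the swap with index `P = (k,m,i,n)`. -/
def Idx.dur (P : Idx) : ℝ := 3 / 2 ^ P.k

/-- The starting time `T_P`: the total duration of all swaps before `P` in the time order. -/
def Idx.start (P : Idx) : ℝ := ∑' Q : {Q : Idx // Q.TimeLT P}, Q.1.dur

/-- The time interval `[T_P, T_P + 3 · 2^{-k})`. -/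
def Idx.window (P : Idx) : Set ℝ := Ico P.start (P.start + P.dur)

/-! ### The mixing fields -/

/-- The field that performs, during its window, each swap with index in `S`, and vanishes at all
other times. The windows are pairwise disjoint, so the chosen index is unique. -/
def mixField (S : Set Idx) (L : Idx → ℕ) (t : ℝ) (x : T2) : ℝ × ℝ :=
  open Classical in
  if h : ∃ P ∈ S, t ∈ P.window then
    swapField h.choose.i h.choose.k h.choose.n (L h.choose) (t - h.choose.start) x
  else 0

/-- The finite gradual perfect mixing field `u_𝒦`, using the indices `P ≤_lex 𝒦`. -/
def mixFin (K : Idx) (L : Idx → ℕ) : ℝ → T2 → ℝ × ℝ := mixField (Iic K) L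

/-- The gradual perfect mixing field `u_∞`, using all indices. -/
def mixInf (L : Idx → ℕ) : ℝ → T2 → ℝ × ℝ := mixField univ L

end Mixing

end

open MeasureTheory Set Filter Topology
open scoped ContDiff ENNReal NNReal

noncomputable section

namespace Mixing

/-! ### Rotation of the plane along sup-norm circles -/

/-! After rescaling a `w × h` rectangle to a square, its field is the rotation with constant angular
speed along the spheres of the sup norm. The unit sphere has length 8 and the angular speed is `2 /
max w h`, so each phase of a binary swap lasts exactly a half turn, and a half turn in either
direction is the reflection in the centre. Reflecting in the centre of a rectangle and then in the
centre of one of its halves gives a translation by `±2^{-(k+1)}` in one coordinate and the identity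
in the other. Off a null set this exchanges the binary digits `k` and `k+1` (`Idx.reflect_reflect`,
`Idx.rep2_swapMap`).

For finitely many swaps the flow is an explicit composition of area-preserving maps with Lipschitz
orbits. Transporting bounded data by it gives weak, renormalised and Lagrangian solutions, because a
test function integrates along each orbit to its increment (`RegularFlow.integral_material`).
Uniqueness is a duality argument, one phase and one rectangle at a time. The rectangle is invariant
under a Lipschitz flow, so the adjoint problem is solved by Lipschitz test functions supported in
it, and the difference of two solutions vanishes there (`eq_zero_on_invariant`). Outside the
rectangles the field is zero (`Cells.eq_zero`, `eq_zero_of_fld`).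

In the time order, the block with entry `m` runs through decreasing `k`. Truncated at `k ≤ N`, it
carries digit `N+1` down to position `m` and shifts the digits in between up by one. After `M`
truncated blocks the first `M` digits are the digits `N+1, N, …, N+2-M` of the initial point
(`ae_dig_blocks`). A function of the first `M` digits, pulled back by this map, therefore has the
small period `2^{-(N+1-M)}`, and its integral against fixed data is nearly the product of the means
(`tendsto_integral_push_top`). Later blocks only involve `k > M` and leave the first `M` digits
alone, at all times (`lev_flow_sched`). This gives weak convergence to the mean near and after time
42 (`exists_mixed`).

Before time 42 the convergence is strong. Enlarging the truncation inserts, at the start of each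
block, swaps of small total duration. As the speed is at most one, they move points little, and an
area-preserving map close to the identity hardly changes a fixed function in `L¹`. Induction over
the blocks gives a Cauchy estimate uniform in time (`exists_distL1_push_low_le`), and every time
before 42 lies in finitely many blocks (`Idx.exists_cut_gt`). The limit is assembled in
`exists_isPushLimit`. Bounds and interpolation pass from `L¹` to `L^p`, and the equation passes to
the limit because the finite fields are eventually equal to the infinite one at each time. -/

/-- The `8`-periodic clipped triangle wave, equal to `1` on `[-1,1]` and to `-1` on `[3,5]`. -/
def triWave (θ : ℝ) : ℝ := max (-1) (min 1 (2 - ‖(θ : AddCircle (8 : ℝ))‖))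

/-- Unit speed, `8`-periodic parametrisation of the unit sphere of the sup norm. -/
def sqCurve (θ : ℝ) : ℝ × ℝ := (triWave θ, triWave (θ - 2))

theorem triWave_add_eight (θ : ℝ) : triWave (θ + 8) = triWave θ := by
  simp [triWave]

theorem triWave_sub_eight (θ : ℝ) : triWave (θ - 8) = triWave θ := by
  rw [← triWave_add_eight (θ - 8), sub_add_cancel]

theorem triWave_of_abs_le {θ : ℝ} (h : |θ| ≤ 4) : triWave θ = max (-1) (min 1 (2 - |θ|)) := by
  have : ‖(θ : AddCircle (8 : ℝ))‖ = |θ| := by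
    rw [AddCircle.norm_coe_eq_abs_iff _ (by norm_num)]
    rw [abs_of_pos (by norm_num : (0 : ℝ) < 8)]; linarith
  rw [triWave, this]

theorem lipschitz_triWave : LipschitzWith 1 triWave := by
  have h0 : LipschitzWith 1 (fun θ : ℝ => ‖(θ : AddCircle (8 : ℝ))‖) := by
    refine LipschitzWith.of_dist_le_mul fun x y => ?_
    simp only [NNReal.coe_one, one_mul, Real.dist_eq]
    refine (abs_norm_sub_norm_le _ _).trans ?_
    rw [← AddCircle.coe_sub, ← Real.norm_eq_abs]
    exact QuotientAddGroup.norm_mk_le_norm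
  have h1 : LipschitzWith 1 (fun θ : ℝ => 2 - ‖(θ : AddCircle (8 : ℝ))‖) := by
    refine LipschitzWith.of_dist_le_mul fun x y => ?_
    have := h0.dist_le_mul x y
    rw [Real.dist_eq] at this ⊢
    rwa [sub_sub_sub_cancel_left, abs_sub_comm]
  exact (h1.const_min 1).const_max (-1)

theorem lipschitz_sqCurve : LipschitzWith 1 sqCurve := by
  have h2 : LipschitzWith 1 (fun θ : ℝ => triWave (θ - 2)) := by
    refine LipschitzWith.of_dist_le_mul fun x y => ?_
    simpa using lipschitz_triWave.dist_le_mul (x - 2) (y - 2)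
  have := lipschitz_triWave.prodMk h2
  rw [max_self] at this
  exact this

theorem exists_eq_add_mul_int (p : ℝ) (hp : 0 < p) (a θ : ℝ) :
    ∃ τ ∈ Ico a (a + p), ∃ n : ℤ, θ = τ + p * n := by
  refine ⟨θ - p * ⌊(θ - a) / p⌋, ⟨?_, ?_⟩, ⌊(θ - a) / p⌋, by ring⟩
  · have := Int.floor_le ((θ - a) / p)
    rw [le_div_iff₀ hp] at this; linarith
  · have := Int.lt_floor_add_one ((θ - a) / p)
    rw [div_lt_iff₀ hp] at this; linarith

theorem triWave_add_eight_mul (θ : ℝ) (n : ℤ) : triWave (θ + 8 * n) = triWave θ := by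
  have : Function.Periodic triWave 8 := triWave_add_eight
  simpa [mul_comm] using this.int_mul n θ

theorem sqCurve_add_eight_mul (θ : ℝ) (n : ℤ) : sqCurve (θ + 8 * n) = sqCurve θ := by
  simp only [sqCurve, triWave_add_eight_mul, Prod.mk.injEq, true_and]
  rw [show θ + 8 * (n : ℝ) - 2 = θ - 2 + 8 * n by ring, triWave_add_eight_mul]

theorem triWave_add_four (θ : ℝ) : triWave (θ + 4) = - triWave θ := by
  obtain ⟨τ, hτ, n, rfl⟩ := exists_eq_add_mul_int 8 (by norm_num) (-4) θ
  rw [show τ + 8 * (n : ℝ) + 4 = (τ + 4) + 8 * n by ring, triWave_add_eight_mul,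
    triWave_add_eight_mul]
  have h1 := hτ.1
  have h2 := hτ.2
  rw [triWave_of_abs_le (θ := τ) (abs_le.2 ⟨h1, by linarith⟩)]
  rcases le_or_gt τ 0 with h | h
  · rw [triWave_of_abs_le (θ := τ + 4) (abs_le.2 ⟨by linarith, by linarith⟩),
      abs_of_nonpos h, abs_of_nonneg (by linarith : (0 : ℝ) ≤ τ + 4)]
    rcases max_cases (-1) (min 1 (2 - (τ + 4))) <;> rcases max_cases (-1) (min 1 (2 - -τ)) <;>
    rcases min_cases 1 (2 - (τ + 4)) <;> rcases min_cases 1 (2 - -τ) <;> linarith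
  · rw [← triWave_sub_eight, triWave_of_abs_le (θ := τ + 4 - 8) (abs_le.2 ⟨by linarith, by linarith⟩),
      abs_of_pos h, abs_of_nonpos (by linarith : τ + 4 - 8 ≤ 0)]
    rcases max_cases (-1) (min 1 (2 - -(τ + 4 - 8))) <;> rcases max_cases (-1) (min 1 (2 - τ)) <;>
    rcases min_cases 1 (2 - -(τ + 4 - 8)) <;> rcases min_cases 1 (2 - τ) <;> linarith

/-- Rotation of the plane by a right angle. -/
def quarter (p : ℝ × ℝ) : ℝ × ℝ := (-p.2, p.1)

/-- This symmetry reduces statements about the whole curve to the single side over `[-1,1]`, where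
`sqCurve_of_abs_le` makes it explicit; `angle_induction` organises the reduction. -/
theorem sqCurve_add_two (θ : ℝ) : sqCurve (θ + 2) = quarter (sqCurve θ) := by
  simp only [sqCurve, quarter, add_sub_cancel_right, Prod.mk.injEq, and_true]
  rw [← triWave_add_four]; congr 1; ring

theorem sqCurve_add_four (θ : ℝ) : sqCurve (θ + 4) = - sqCurve θ := by
  simp only [sqCurve, Prod.neg_mk, Prod.mk.injEq, triWave_add_four, true_and]
  rw [← triWave_add_four]; congr 1; ring

theorem sqCurve_of_abs_le {θ : ℝ} (h : |θ| ≤ 1) : sqCurve θ = (1, θ) := by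
  obtain ⟨h1, h2⟩ := abs_le.1 h
  rw [sqCurve, triWave_of_abs_le (by linarith),
    triWave_of_abs_le (abs_le.2 ⟨by linarith, by linarith⟩), min_eq_left (by linarith),
    abs_of_nonpos (by linarith : θ - 2 ≤ 0), min_eq_right (by linarith),
    max_eq_right (by norm_num), max_eq_right (by linarith)]
  ring_nf

theorem norm_quarter (p : ℝ × ℝ) : ‖quarter p‖ = ‖p‖ := by
  simp [quarter, Prod.norm_def, max_comm]

theorem quarter_sub (p q : ℝ × ℝ) : quarter p - quarter q = quarter (p - q) := by
  simp [quarter]; ring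

theorem quarter_smul (r : ℝ) (p : ℝ × ℝ) : quarter (r • p) = r • quarter p := by
  simp [quarter]

theorem quarter_quarter (p : ℝ × ℝ) : quarter (quarter p) = -p := by
  simp [quarter, Prod.ext_iff]

/-- Induction over angles along quarter turns. -/
theorem angle_induction {P : ℝ → Prop} (h0 : ∀ τ ∈ Ico (-1 : ℝ) 1, P τ)
    (h2 : ∀ θ, P θ → P (θ + 2)) (h2' : ∀ θ, P θ → P (θ - 2)) (θ : ℝ) : P θ := by
  obtain ⟨τ, hτ, n, rfl⟩ := exists_eq_add_mul_int 2 (by norm_num) (-1) θ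
  have h0' : P τ := h0 τ (by convert hτ using 2; norm_num)
  induction n using Int.induction_on with
  | zero => simpa using h0'
  | succ k ih => convert h2 _ ih using 1; push_cast; ring
  | pred k ih => convert h2' _ ih using 1; push_cast; ring

/-- Induction over angles for properties that are invariant under quarter turns. -/
theorem angle_induction_iff {P : ℝ → Prop} (h0 : ∀ τ ∈ Ico (-1 : ℝ) 1, P τ)
    (h2 : ∀ θ, P (θ + 2) ↔ P θ) (θ : ℝ) : P θ :=
  angle_induction h0 (fun θ => (h2 θ).2)
    (fun θ h => (h2 (θ - 2)).1 (by rwa [sub_add_cancel])) θ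

theorem norm_sqCurve (θ : ℝ) : ‖sqCurve θ‖ = 1 := by
  refine angle_induction_iff (P := fun θ => ‖sqCurve θ‖ = 1) (fun τ hτ => ?_) (fun θ => ?_) θ
  · have : |τ| ≤ 1 := abs_le.2 ⟨hτ.1, hτ.2.le⟩
    simp [sqCurve_of_abs_le this, Prod.norm_def, this]
  · rw [sqCurve_add_two, norm_quarter]

/-- Some coordinate of `p` is `±1`, so at most three quarter turns bring `p` to the side where the
first coordinate is 1. Adding 6 to an angle undoes one quarter turn. -/
theorem exists_sqCurve_eq {p : ℝ × ℝ} (hp : ‖p‖ = 1) : ∃ θ, sqCurve θ = p := by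
  have key : ∀ q : ℝ × ℝ, ‖q‖ = 1 → q.1 = 1 → ∃ θ, sqCurve θ = q := fun q hq h1 =>
    ⟨q.2, by
      rw [sqCurve_of_abs_le]
      · exact Prod.ext h1.symm rfl
      · rw [← Real.norm_eq_abs, ← hq]; exact norm_snd_le q⟩
  have step : ∀ q : ℝ × ℝ, (∃ θ, sqCurve θ = quarter q) → ∃ θ, sqCurve θ = q := by
    rintro q ⟨θ, hθ⟩
    refine ⟨θ + 6, ?_⟩
    rw [show θ + 6 = θ + 2 + 4 by ring, sqCurve_add_four, sqCurve_add_two, hθ, quarter_quarter,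
      neg_neg]
  have h : |p.1| = 1 ∨ |p.2| = 1 := by
    rw [Prod.norm_def] at hp
    rcases max_choice ‖p.1‖ ‖p.2‖ with h | h
    · left; rw [← Real.norm_eq_abs]; linarith
    · right; rw [← Real.norm_eq_abs]; linarith
  have hn : ‖quarter p‖ = 1 := by rw [norm_quarter, hp]
  have hn2 : ‖quarter (quarter p)‖ = 1 := by rw [norm_quarter, hn]
  have hn3 : ‖quarter (quarter (quarter p))‖ = 1 := by rw [norm_quarter, hn2]
  rcases h with h | h <;> rcases abs_eq (zero_le_one' ℝ) |>.1 h with h | h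
  · exact key p hp h
  · exact step _ (step _ (key _ hn2 (by simp [quarter, h])))
  · exact step _ (step _ (step _ (key _ hn3 (by simp [quarter, h]))))
  · exact step _ (key _ hn (by simp [quarter, h]))

/-- Arc length on the unit sphere of the sup norm is at most four times the chord length. -/
theorem sqCurve_chord (α β : ℝ) : ∃ n : ℤ, |α - β - 8 * n| ≤ 4 * ‖sqCurve α - sqCurve β‖ := by
  revert β
  refine angle_induction_iff
    (P := fun α => ∀ β, ∃ n : ℤ, |α - β - 8 * n| ≤ 4 * ‖sqCurve α - sqCurve β‖)
    (fun τ hτ => ?_) (fun θ => ?_) α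
  · intro β
    -- The window `[-3,5)` is cut at `-1`, `1`, `3` into the sides of the square. On the same side
    -- arc and chord agree, on an adjacent side the arc is at most two chords, and on the opposite
    -- side the arc is at most 6 while the chord is at least 2. So the constant 4 is enough.
    obtain ⟨β, hβ, n, rfl⟩ := exists_eq_add_mul_int 8 (by norm_num) (-3) β
    refine ⟨-n, ?_⟩
    rw [sqCurve_add_eight_mul]
    have h1 : |τ| ≤ 1 := abs_le.2 ⟨hτ.1, hτ.2.le⟩
    rw [sqCurve_of_abs_le h1]
    push_cast
    rw [show τ - (β + 8 * n) - 8 * -(n : ℝ) = τ - β by ring]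
    obtain ⟨h3, h5⟩ := hβ
    obtain ⟨hτ1, hτ2⟩ := hτ
    norm_num at h5
    rcases lt_or_ge β (-1) with hb | hb
    · have e : sqCurve β = (β + 2, -1) := by
        have := sqCurve_add_two β
        rw [sqCurve_of_abs_le (abs_le.2 ⟨by linarith, by linarith⟩)] at this
        simp only [quarter, Prod.mk.injEq] at this
        exact Prod.ext (by simp [this.2]) (by simp; linarith [this.1])
      rw [e]
      have a1 : |1 - (β + 2)| ≤ ‖((1, τ) - (β + 2, -1) : ℝ × ℝ)‖ :=
        norm_fst_le ((1, τ) - (β + 2, -1) : ℝ × ℝ)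
      have a2 : |τ - -1| ≤ ‖((1, τ) - (β + 2, -1) : ℝ × ℝ)‖ :=
        norm_snd_le ((1, τ) - (β + 2, -1) : ℝ × ℝ)
      rw [abs_of_nonneg (by linarith)] at a1 a2 ⊢
      linarith
    rcases le_or_gt β 1 with hb1 | hb1
    · rw [sqCurve_of_abs_le (abs_le.2 ⟨hb, hb1⟩)]
      have a2 : |τ - β| ≤ ‖((1, τ) - (1, β) : ℝ × ℝ)‖ := norm_snd_le ((1, τ) - (1, β) : ℝ × ℝ)
      linarith [abs_nonneg (τ - β)]
    rcases le_or_gt β 3 with hb3 | hb3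
    · have e : sqCurve β = (2 - β, 1) := by
        have := sqCurve_add_two (β - 2)
        rw [sub_add_cancel, sqCurve_of_abs_le (θ := β - 2) (abs_le.2 ⟨by linarith, by linarith⟩)]
          at this
        rw [this]; simp [quarter]
      rw [e]
      have a1 : |1 - (2 - β)| ≤ ‖((1, τ) - (2 - β, 1) : ℝ × ℝ)‖ :=
        norm_fst_le ((1, τ) - (2 - β, 1) : ℝ × ℝ)
      have a2 : |τ - 1| ≤ ‖((1, τ) - (2 - β, 1) : ℝ × ℝ)‖ :=
        norm_snd_le ((1, τ) - (2 - β, 1) : ℝ × ℝ)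
      rw [abs_of_nonneg (by linarith)] at a1
      rw [abs_of_nonpos (by linarith)] at a2 ⊢
      linarith
    · have e : sqCurve β = (-1, 4 - β) := by
        have := sqCurve_add_four (β - 4)
        rw [sub_add_cancel, sqCurve_of_abs_le (θ := β - 4) (abs_le.2 ⟨by linarith, by linarith⟩)]
          at this
        rw [this]; simp
      rw [e]
      have a1 : |1 - (-1)| ≤ ‖((1, τ) - (-1, 4 - β) : ℝ × ℝ)‖ :=
        norm_fst_le ((1, τ) - (-1, 4 - β) : ℝ × ℝ)
      rw [abs_of_nonneg (by norm_num)] at a1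
      rw [abs_of_nonpos (by linarith)]
      linarith
  · constructor
    · intro h β
      obtain ⟨n, hn⟩ := h (β + 2)
      refine ⟨n, ?_⟩
      rwa [sqCurve_add_two, sqCurve_add_two, quarter_sub, norm_quarter, add_sub_add_right_eq_sub]
        at hn
    · intro h β
      obtain ⟨n, hn⟩ := h (β - 2)
      refine ⟨n, ?_⟩
      rw [← norm_quarter, ← quarter_sub, ← sqCurve_add_two, ← sqCurve_add_two, sub_add_cancel] at hn
      convert hn using 2; ring

/-- The field generating the rotation along sup-norm circles. -/
def sqField (p : ℝ × ℝ) : ℝ × ℝ := if |p.2| < |p.1| then (0, p.1) else (-p.2, 0)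

/-- On the diagonals the branch chosen in `sqField` breaks the symmetry, which is why they have to
be excluded. -/
theorem sqField_quarter {p : ℝ × ℝ} (hp : |p.1| ≠ |p.2|) :
    sqField (quarter p) = quarter (sqField p) := by
  unfold sqField
  rcases lt_or_gt_of_ne hp with h | h
  · rw [if_pos (by simpa [quarter] using h), if_neg (by simpa using h.le)]; simp [quarter]
  · rw [if_neg (by simpa [quarter] using h.le), if_pos h]; simp [quarter]

/-- On the side over `(-1,1)` the curve has velocity `(0,1)`, and off the diagonals the field
commutes with quarter turns. The excluded corners occur only at odd integer angles, by
`exists_int_of_abs_eq`. -/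
theorem hasDerivAt_sqCurve {θ : ℝ} (h : |(sqCurve θ).1| ≠ |(sqCurve θ).2|) :
    HasDerivAt sqCurve (sqField (sqCurve θ)) θ := by
  revert h
  have hq : ∀ p : ℝ × ℝ, |(quarter p).1| ≠ |(quarter p).2| ↔ |p.1| ≠ |p.2| := fun p => by
    simp [quarter, eq_comm]
  have hlin : ∀ {f : ℝ → ℝ × ℝ} {f' : ℝ × ℝ} {x : ℝ}, HasDerivAt f f' x →
      HasDerivAt (fun y => quarter (f y)) (quarter f') x := fun {f f' x} hf => by
    have h1 : HasDerivAt (fun y => (f y).1) f'.1 x := hf.fst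
    have h2 : HasDerivAt (fun y => (f y).2) f'.2 x := hf.snd
    exact h2.neg.prodMk h1
  refine angle_induction (P := fun θ => |(sqCurve θ).1| ≠ |(sqCurve θ).2| →
    HasDerivAt sqCurve (sqField (sqCurve θ)) θ) (fun τ hτ h => ?_) (fun θ ih h => ?_)
    (fun θ ih h => ?_) θ
  · have h1 : |τ| ≤ 1 := abs_le.2 ⟨hτ.1, hτ.2.le⟩
    rw [sqCurve_of_abs_le h1] at h ⊢
    have h2 : |τ| < 1 := lt_of_le_of_ne h1 (by simpa [eq_comm] using h)
    have : sqField (1, τ) = (0, 1) := by simp [sqField, h2]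
    rw [this]
    have hd : HasDerivAt (fun y : ℝ => ((1 : ℝ), y)) (0, 1) τ :=
      (hasDerivAt_const _ _).prodMk (hasDerivAt_id _)
    refine hd.congr_of_eventuallyEq ?_
    have : ∀ᶠ y in 𝓝 τ, |y| < 1 := continuous_abs.continuousAt.eventually (Iio_mem_nhds h2)
    filter_upwards [this] with y hy using sqCurve_of_abs_le hy.le
  · rw [sqCurve_add_two] at h ⊢
    rw [hq] at h
    rw [sqField_quarter h]
    refine (HasDerivAt.congr_of_eventuallyEq (f := fun y => quarter (sqCurve (y - 2))) ?_ ?_)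
    · have h3 : HasDerivAt (fun y => quarter (sqCurve y)) (quarter (sqField (sqCurve θ)))
        (θ + 2 - 2) := by rw [add_sub_cancel_right]; exact hlin (ih h)
      exact h3.comp_sub_const _ _
    · exact Eventually.of_forall fun y => by
        simp only [← sqCurve_add_two, sub_add_cancel]
  · have e' : ∀ θ, sqCurve θ = quarter (quarter (quarter (sqCurve (θ + 2)))) := fun θ => by
      rw [← sqCurve_add_two, ← sqCurve_add_two, ← sqCurve_add_two, ← sqCurve_add_eight_mul θ 1]
      congr 1; push_cast; ring
    have e2 : sqCurve (θ - 2) = quarter (quarter (quarter (sqCurve θ))) := by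
      rw [e' (θ - 2), sub_add_cancel]
    rw [e2] at h ⊢
    have hh : |(sqCurve θ).1| ≠ |(sqCurve θ).2| := by
      rwa [hq, hq, hq] at h
    rw [sqField_quarter (by rwa [hq, hq]), sqField_quarter (by rwa [hq]), sqField_quarter hh]
    have h3 : HasDerivAt (fun y => quarter (quarter (quarter (sqCurve y))))
      (quarter (quarter (quarter (sqField (sqCurve θ))))) (θ - 2 + 2) := by
      rw [sub_add_cancel]; exact hlin (hlin (hlin (ih hh)))
    exact (h3.comp_add_const _ _).congr_of_eventuallyEq (Eventually.of_forall e')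

theorem exists_int_of_abs_eq {θ : ℝ} (h : |(sqCurve θ).1| = |(sqCurve θ).2|) :
    ∃ n : ℤ, θ = 2 * n + 1 := by
  revert h
  refine angle_induction_iff (P := fun θ => |(sqCurve θ).1| = |(sqCurve θ).2| →
    ∃ n : ℤ, θ = 2 * n + 1) (fun τ hτ h => ?_) (fun θ => ?_) θ
  · have h1 : |τ| ≤ 1 := abs_le.2 ⟨hτ.1, hτ.2.le⟩
    rw [sqCurve_of_abs_le h1] at h
    rcases abs_eq (zero_le_one' ℝ) |>.1 (by simpa using h.symm) with h | h
    · exact absurd h hτ.2.ne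
    · exact ⟨-1, by rw [h]; norm_num⟩
  · rw [sqCurve_add_two]
    simp only [quarter, abs_neg]
    rw [eq_comm]
    refine imp_congr_right fun _ => ⟨?_, ?_⟩
    · rintro ⟨n, hn⟩; exact ⟨n - 1, by push_cast; linarith⟩
    · rintro ⟨n, hn⟩; exact ⟨n + 1, by push_cast; linarith⟩

theorem exists_angle (p : ℝ × ℝ) : ∃ θ, p = ‖p‖ • sqCurve θ := by
  rcases eq_or_ne p 0 with rfl | hp
  · exact ⟨0, by simp⟩
  · have hn : ‖p‖ ≠ 0 := norm_ne_zero_iff.2 hp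
    obtain ⟨θ, hθ⟩ := exists_sqCurve_eq (p := ‖p‖⁻¹ • p) (by
      rw [norm_smul, norm_inv, norm_norm, inv_mul_cancel₀ hn])
    exact ⟨θ, by rw [hθ, smul_smul, mul_inv_cancel₀ hn, one_smul]⟩

/-- An angle of a point with respect to `sqCurve`. -/
def angle (p : ℝ × ℝ) : ℝ := (exists_angle p).choose

theorem norm_smul_sqCurve_angle (p : ℝ × ℝ) : ‖p‖ • sqCurve (angle p) = p :=
  (exists_angle p).choose_spec.symm

/-- Rotation of the plane by the angle `θ` along sup-norm circles. -/
def sqRot (θ : ℝ) (p : ℝ × ℝ) : ℝ × ℝ := ‖p‖ • sqCurve (angle p + θ)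

theorem norm_sqRot (θ : ℝ) (p : ℝ × ℝ) : ‖sqRot θ p‖ = ‖p‖ := by
  simp [sqRot, norm_smul, norm_sqCurve]

/-- The radial part is at most the distance before rotation. For the tangential part, arc length is
unchanged by rotation and at most four chords, and `r` times the chord is at most twice the
distance. Altogether `9 = 4 · 2 + 1`. -/
theorem dist_polar_le {r s : ℝ} (hr : 0 ≤ r) (hs : 0 ≤ s) (α β θ : ℝ) :
    ‖r • sqCurve (α + θ) - s • sqCurve (β + θ)‖ ≤ 9 * ‖r • sqCurve α - s • sqCurve β‖ := by
  have hrs : |r - s| ≤ ‖r • sqCurve α - s • sqCurve β‖ := by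
    have := abs_norm_sub_norm_le (r • sqCurve α) (s • sqCurve β)
    simpa [norm_smul, norm_sqCurve, abs_of_nonneg hr, abs_of_nonneg hs] using this
  obtain ⟨n, hn⟩ := sqCurve_chord α β
  have h1 : ‖sqCurve (α + θ) - sqCurve (β + θ)‖ ≤ |α - β - 8 * n| := by
    rw [← sqCurve_add_eight_mul (β + θ) n]
    have := lipschitz_sqCurve.dist_le_mul (α + θ) (β + θ + 8 * n)
    rw [dist_eq_norm, dist_eq_norm] at this
    refine this.trans (le_of_eq ?_)
    rw [NNReal.coe_one, one_mul, Real.norm_eq_abs]; congr 1; ring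
  have h2 : r * ‖sqCurve α - sqCurve β‖ ≤ 2 * ‖r • sqCurve α - s • sqCurve β‖ := by
    have e : r • (sqCurve α - sqCurve β) =
      (r • sqCurve α - s • sqCurve β) - (r - s) • sqCurve β := by
      rw [smul_sub, sub_smul]; abel
    have := norm_sub_le (r • sqCurve α - s • sqCurve β) ((r - s) • sqCurve β)
    rw [← e, norm_smul, norm_smul, norm_sqCurve, Real.norm_of_nonneg hr, Real.norm_eq_abs,
      mul_one] at this
    linarith
  have e : r • sqCurve (α + θ) - s • sqCurve (β + θ) =
      r • (sqCurve (α + θ) - sqCurve (β + θ)) + (r - s) • sqCurve (β + θ) := by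
    rw [smul_sub, sub_smul]; abel
  rw [e]
  refine (norm_add_le _ _).trans ?_
  rw [norm_smul, norm_smul, norm_sqCurve, Real.norm_of_nonneg hr, Real.norm_eq_abs, mul_one]
  have := mul_le_mul_of_nonneg_left (h1.trans hn) hr
  linarith

/-- `angle` is an arbitrary choice. The rotation does not depend on it: this is the case of
coinciding points in `dist_polar_le`. -/
theorem sqRot_smul_sqCurve {r : ℝ} (hr : 0 ≤ r) (α θ : ℝ) :
    sqRot θ (r • sqCurve α) = r • sqCurve (α + θ) := by
  have h := dist_polar_le (norm_nonneg (r • sqCurve α)) hr (angle (r • sqCurve α)) α θ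
  rw [norm_smul_sqCurve_angle, sub_self, norm_zero, mul_zero] at h
  exact sub_eq_zero.1 (norm_le_zero_iff.1 h)

theorem norm_sqRot_sub_le (θ : ℝ) (p q : ℝ × ℝ) :
    ‖sqRot θ p - sqRot θ q‖ ≤ 9 * ‖p - q‖ := by
  have h := dist_polar_le (norm_nonneg p) (norm_nonneg q) (angle p) (angle q) θ
  rwa [norm_smul_sqCurve_angle, norm_smul_sqCurve_angle] at h

theorem norm_sqRot_sub_angle_le (θ θ' : ℝ) (p : ℝ × ℝ) :
    ‖sqRot θ p - sqRot θ' p‖ ≤ ‖p‖ * |θ - θ'| := by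
  rw [sqRot, sqRot, ← smul_sub, norm_smul, norm_norm]
  refine mul_le_mul_of_nonneg_left ?_ (norm_nonneg _)
  have := lipschitz_sqCurve.dist_le_mul (angle p + θ) (angle p + θ')
  rw [dist_eq_norm, dist_eq_norm, NNReal.coe_one, one_mul, Real.norm_eq_abs] at this
  simpa using this

theorem sqRot_sqRot (θ φ : ℝ) (p : ℝ × ℝ) : sqRot θ (sqRot φ p) = sqRot (φ + θ) p := by
  rw [sqRot.eq_1 φ, sqRot_smul_sqCurve (norm_nonneg p), sqRot, add_assoc]

theorem sqRot_zero (p : ℝ × ℝ) : sqRot 0 p = p := by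
  rw [sqRot, add_zero, norm_smul_sqCurve_angle]

theorem sqRot_four (p : ℝ × ℝ) : sqRot 4 p = -p := by
  rw [sqRot, sqCurve_add_four, smul_neg, norm_smul_sqCurve_angle]

/-- Both orientations reach the same point reflection after a half turn, so the alternating signs of
the strips leave no trace at the end of a phase. -/
theorem sqRot_neg_four (p : ℝ × ℝ) : sqRot (-4) p = -p := by
  have h := sqRot_sqRot (-4) 4 (-p)
  rwa [sqRot_four, neg_neg, add_neg_cancel, sqRot_zero] at h

theorem continuous_sqRot : Continuous fun z : ℝ × ℝ × ℝ => sqRot z.1 z.2 := by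
  rw [continuous_iff_continuousAt]
  rintro ⟨θ, p⟩
  rw [ContinuousAt, tendsto_iff_norm_sub_tendsto_zero]
  have hb : Tendsto (fun z : ℝ × ℝ × ℝ => 9 * ‖z.2 - p‖ + ‖p‖ * |z.1 - θ|) (𝓝 (θ, p)) (𝓝 0) := by
    have : Continuous (fun z : ℝ × ℝ × ℝ => 9 * ‖z.2 - p‖ + ‖p‖ * |z.1 - θ|) := by fun_prop
    simpa using this.tendsto (θ, p)
  refine squeeze_zero (fun _ => norm_nonneg _) (fun z => ?_) hb
  calc ‖sqRot z.1 z.2 - sqRot θ p‖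
      = ‖(sqRot z.1 z.2 - sqRot z.1 p) + (sqRot z.1 p - sqRot θ p)‖ := by rw [sub_add_sub_cancel]
    _ ≤ _ := norm_add_le _ _
    _ ≤ _ := add_le_add (norm_sqRot_sub_le _ _ _) (norm_sqRot_sub_angle_le _ _ _)

theorem sqField_smul (r : ℝ) (p : ℝ × ℝ) : sqField (r • p) = r • sqField p := by
  rcases eq_or_ne r 0 with rfl | hr
  · simp [sqField]
  · have h : |(r • p).2| < |(r • p).1| ↔ |p.2| < |p.1| := by
      simp only [Prod.smul_fst, Prod.smul_snd, smul_eq_mul, abs_mul]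
      exact mul_lt_mul_iff_right₀ (abs_pos.2 hr)
    simp only [sqField, h]
    split_ifs <;> simp

/-- Away from the diagonals, and at the origin, the rotation solves its differential equation. -/
theorem hasDerivAt_sqRot (p : ℝ × ℝ) (θ : ℝ)
    (h : p = 0 ∨ |(sqRot θ p).1| ≠ |(sqRot θ p).2|) :
    HasDerivAt (fun θ => sqRot θ p) (sqField (sqRot θ p)) θ := by
  rcases h with rfl | h
  · simpa [sqRot, sqField, ← Prod.zero_eq_mk] using hasDerivAt_const θ (0 : ℝ × ℝ)
  · have h' : |(sqCurve (angle p + θ)).1| ≠ |(sqCurve (angle p + θ)).2| := fun h' => h (by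
      simp [sqRot, abs_mul, h'])
    have := ((hasDerivAt_sqCurve h').comp_const_add (angle p) θ).const_smul ‖p‖
    rw [← sqField_smul] at this
    exact this

/-- An orbit other than the centre thus meets the diagonals, where the derivative may fail to exist,
only at a null set of times. -/
theorem countable_diagonal_angles {p : ℝ × ℝ} (hp : p ≠ 0) :
    {θ : ℝ | |(sqRot θ p).1| = |(sqRot θ p).2|}.Countable := by
  refine (Set.countable_range (fun n : ℤ => 2 * (n : ℝ) + 1 - angle p)).mono ?_
  intro θ hθ
  have h' : |(sqCurve (angle p + θ)).1| = |(sqCurve (angle p + θ)).2| := by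
    have : ‖p‖ ≠ 0 := norm_ne_zero_iff.2 hp
    simpa [sqRot, abs_mul, hp] using hθ
  obtain ⟨n, hn⟩ := exists_int_of_abs_eq h'
  exact ⟨n, by simp only; linarith⟩

/-! #### Polar coordinates for the sup norm -/

theorem measurePreserving_quarter : MeasurePreserving quarter (volume : Measure (ℝ × ℝ)) volume := by
  have h1 : MeasurePreserving (Prod.map (Neg.neg : ℝ → ℝ) (id : ℝ → ℝ))
      (volume : Measure (ℝ × ℝ)) volume :=
    (Measure.measurePreserving_neg (volume : Measure ℝ)).prod (MeasurePreserving.id _)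
  exact h1.comp (Measure.measurePreserving_swap (μ := (volume : Measure ℝ)) (ν := volume))

/-- In this sector the sup norm is the first coordinate `r`, and the substitution `r * τ` for the
second coordinate contributes the Jacobian `r`. -/
theorem lintegral_sector {F : ℝ × ℝ → ℝ≥0∞} (hF : Measurable F) :
    ∫⁻ p in {p : ℝ × ℝ | |p.2| < p.1}, F p =
      ∫⁻ r in Ioi (0 : ℝ), ENNReal.ofReal r * ∫⁻ τ in Ioo (-1 : ℝ) 1, F (r, r * τ) := by
  have hS : MeasurableSet {p : ℝ × ℝ | |p.2| < p.1} :=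
    measurableSet_lt (by fun_prop) (by fun_prop)
  rw [← lintegral_indicator hS, Measure.volume_eq_prod,
    lintegral_prod _ ((hF.indicator hS).aemeasurable), ← lintegral_indicator measurableSet_Ioi]
  refine lintegral_congr fun r => ?_
  by_cases hr : r ∈ Ioi (0 : ℝ)
  · rw [indicator_of_mem hr]
    have hr0 : (0 : ℝ) < r := hr
    have hm : Measurable fun b => ({p : ℝ × ℝ | |p.2| < p.1}.indicator F) (r, b) :=
      (hF.indicator hS).comp measurable_prodMk_left
    have key : ∀ G : ℝ → ℝ≥0∞, Measurable G →
        ∫⁻ b, G b = ENNReal.ofReal r * ∫⁻ τ, G (r * τ) := fun G hG => by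
      have h1 : ∫⁻ τ, G (r * τ) = ∫⁻ b, G b ∂(Measure.map (r * ·) volume) :=
        (lintegral_map hG (measurable_const_mul r)).symm
      rw [h1, Real.map_volume_mul_left hr0.ne', lintegral_smul_measure, smul_eq_mul, ← mul_assoc,
        ← ENNReal.ofReal_mul hr0.le, abs_of_pos (inv_pos.2 hr0), mul_inv_cancel₀ hr0.ne',
        ENNReal.ofReal_one, one_mul]
    rw [key _ hm, ← lintegral_indicator measurableSet_Ioo]
    congr 1
    refine lintegral_congr fun τ => ?_
    have : (r, r * τ) ∈ {p : ℝ × ℝ | |p.2| < p.1} ↔ τ ∈ Ioo (-1 : ℝ) 1 := by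
      simp only [mem_ofPred_eq, abs_mul, abs_of_pos hr0, mem_Ioo]
      rw [← abs_lt]
      constructor
      · intro h; nlinarith
      · intro h; nlinarith
    by_cases h : τ ∈ Ioo (-1 : ℝ) 1
    · rw [indicator_of_mem h, indicator_of_mem (this.2 h)]
    · rw [indicator_of_notMem h, indicator_of_notMem (mt this.1 h)]
  · rw [indicator_of_notMem hr]
    have : ∀ b, ({p : ℝ × ℝ | |p.2| < p.1}.indicator F) (r, b) = 0 := fun b => by
      refine indicator_of_notMem (fun h => hr ?_) _
      exact (abs_nonneg b).trans_lt h
    simp [this]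

theorem volume_diagonal (s : ℝ) : volume {p : ℝ × ℝ | p.2 = s * p.1} = 0 := by
  have hm : MeasurableSet {p : ℝ × ℝ | p.2 = s * p.1} :=
    measurableSet_eq_fun (by fun_prop) (by fun_prop)
  rw [Measure.volume_eq_prod, Measure.measure_prod_null hm]
  refine Eventually.of_forall fun a => ?_
  have : Prod.mk a ⁻¹' {p : ℝ × ℝ | p.2 = s * p.1} = {s * a} := by ext; simp
  simp [this]

/-- Integration in polar coordinates for the sup norm. -/
theorem lintegral_polar {F : ℝ × ℝ → ℝ≥0∞} (hF : Measurable F) :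
    ∫⁻ p, F p = ∫⁻ r in Ioi (0 : ℝ), ENNReal.ofReal r *
      ∫⁻ θ in Ioc (-1 : ℝ) (-1 + 8), F (r • sqCurve θ) := by
  set S : Set (ℝ × ℝ) := {p | |p.2| < p.1} with hSdef
  have hS : MeasurableSet S := measurableSet_lt (by fun_prop) (by fun_prop)
  have hJ := measurePreserving_quarter
  have hJm := hJ.measurable
  have hc : Measurable sqCurve := lipschitz_sqCurve.continuous.measurable
  -- the four sectors
  have h4 : ∫⁻ p, F p = (∫⁻ p in S, F p) + (∫⁻ p in S, F (quarter p)) +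
      (∫⁻ p in S, F (quarter (quarter p))) + ∫⁻ p in S, F (quarter (quarter (quarter p))) := by
    have pre : ∀ A : Set (ℝ × ℝ), MeasurableSet A → ∀ G : ℝ × ℝ → ℝ≥0∞, Measurable G →
        ∫⁻ p in A, G p = ∫⁻ p in quarter ⁻¹' A, G (quarter p) :=
      fun A hA G hG => (hJ.setLIntegral_comp_preimage hA hG).symm
    have hS4 : quarter ⁻¹' (quarter ⁻¹' (quarter ⁻¹' (quarter ⁻¹' S))) = S := by
      ext p; simp only [mem_preimage, quarter_quarter, neg_neg]
    have e1 : ∫⁻ p in S, F (quarter (quarter (quarter p))) =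
        ∫⁻ p, (quarter ⁻¹' S).indicator F p := by
      rw [lintegral_indicator (hJm hS), pre _ (hJm hS) _ hF,
        pre _ (hJm (hJm hS)) (fun p => F (quarter p)) (hF.comp hJm),
        pre _ (hJm (hJm (hJm hS))) (fun p => F (quarter (quarter p))) (hF.comp (hJm.comp hJm)), hS4]
    have e2 : ∫⁻ p in S, F (quarter (quarter p)) =
        ∫⁻ p, (quarter ⁻¹' (quarter ⁻¹' S)).indicator F p := by
      rw [lintegral_indicator (hJm (hJm hS)), pre _ (hJm (hJm hS)) _ hF,
        pre _ (hJm (hJm (hJm hS))) (fun p => F (quarter p)) (hF.comp hJm), hS4]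
    have e3 : ∫⁻ p in S, F (quarter p) =
        ∫⁻ p, (quarter ⁻¹' (quarter ⁻¹' (quarter ⁻¹' S))).indicator F p := by
      rw [lintegral_indicator (hJm (hJm (hJm hS))), pre _ (hJm (hJm (hJm hS))) _ hF, hS4]
    rw [e1, e2, e3, ← lintegral_indicator hS, ← lintegral_add_left (hF.indicator hS),
      ← lintegral_add_right _ (hF.indicator (hJm (hJm hS))),
      ← lintegral_add_right _ (hF.indicator (hJm hS))]
    refine lintegral_congr_ae ?_
    have hd1 := measure_eq_zero_iff_ae_notMem.1 (volume_diagonal 1)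
    have hd2 := measure_eq_zero_iff_ae_notMem.1 (volume_diagonal (-1))
    filter_upwards [hd1, hd2] with p h1 h2
    simp only [one_mul, neg_mul] at h1 h2
    have m0 : p ∈ S ↔ |p.2| < p.1 := Iff.rfl
    have m1 : p ∈ quarter ⁻¹' S ↔ |p.1| < -p.2 := by simp [hSdef, quarter]
    have m2 : p ∈ quarter ⁻¹' (quarter ⁻¹' S) ↔ |p.2| < -p.1 := by simp [hSdef, quarter]
    have m3 : p ∈ quarter ⁻¹' (quarter ⁻¹' (quarter ⁻¹' S)) ↔ |p.1| < p.2 := by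
      simp [hSdef, quarter]
    rcases lt_or_gt_of_ne h1 with a | a <;> rcases lt_or_gt_of_ne h2 with b | b
    · have n0 : p ∉ S := by rw [m0, abs_lt]; rintro ⟨c, d⟩; linarith
      have n1 : p ∈ quarter ⁻¹' S := by rw [m1, abs_lt]; constructor <;> linarith
      have n2 : p ∉ quarter ⁻¹' (quarter ⁻¹' S) := by rw [m2, abs_lt]; rintro ⟨c, d⟩; linarith
      have n3 : p ∉ quarter ⁻¹' (quarter ⁻¹' (quarter ⁻¹' S)) := by
        rw [m3, abs_lt]; rintro ⟨c, d⟩; linarith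
      simp only [indicator_of_mem n1, indicator_of_notMem n0, indicator_of_notMem n2,
        indicator_of_notMem n3, zero_add]
    · have n0 : p ∈ S := by rw [m0, abs_lt]; constructor <;> linarith
      have n1 : p ∉ quarter ⁻¹' S := by rw [m1, abs_lt]; rintro ⟨c, d⟩; linarith
      have n2 : p ∉ quarter ⁻¹' (quarter ⁻¹' S) := by rw [m2, abs_lt]; rintro ⟨c, d⟩; linarith
      have n3 : p ∉ quarter ⁻¹' (quarter ⁻¹' (quarter ⁻¹' S)) := by
        rw [m3, abs_lt]; rintro ⟨c, d⟩; linarith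
      simp only [indicator_of_mem n0, indicator_of_notMem n1, indicator_of_notMem n2,
        indicator_of_notMem n3, add_zero]
    · have n0 : p ∉ S := by rw [m0, abs_lt]; rintro ⟨c, d⟩; linarith
      have n1 : p ∉ quarter ⁻¹' S := by rw [m1, abs_lt]; rintro ⟨c, d⟩; linarith
      have n2 : p ∈ quarter ⁻¹' (quarter ⁻¹' S) := by rw [m2, abs_lt]; constructor <;> linarith
      have n3 : p ∉ quarter ⁻¹' (quarter ⁻¹' (quarter ⁻¹' S)) := by
        rw [m3, abs_lt]; rintro ⟨c, d⟩; linarith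
      simp only [indicator_of_mem n2, indicator_of_notMem n0, indicator_of_notMem n1,
        indicator_of_notMem n3, zero_add, add_zero]
    · have n0 : p ∉ S := by rw [m0, abs_lt]; rintro ⟨c, d⟩; linarith
      have n1 : p ∉ quarter ⁻¹' S := by rw [m1, abs_lt]; rintro ⟨c, d⟩; linarith
      have n2 : p ∉ quarter ⁻¹' (quarter ⁻¹' S) := by rw [m2, abs_lt]; rintro ⟨c, d⟩; linarith
      have n3 : p ∈ quarter ⁻¹' (quarter ⁻¹' (quarter ⁻¹' S)) := by
        rw [m3, abs_lt]; constructor <;> linarith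
      simp only [indicator_of_mem n3, indicator_of_notMem n0, indicator_of_notMem n1,
        indicator_of_notMem n2, zero_add, add_zero]
  have hpoly : Measurable fun z : ℝ × ℝ => F (z.1 • sqCurve z.2) :=
    hF.comp (measurable_fst.smul (hc.comp measurable_snd))
  have hshift : ∀ (r : ℝ) (a : ℝ), ∫⁻ τ in Ioo (-1 : ℝ) 1, F (r • sqCurve (τ + a)) =
      ∫⁻ θ in Ioc (-1 + a) (1 + a), F (r • sqCurve θ) := fun r a => by
    rw [restrict_Ioo_eq_restrict_Ioc]
    have := (measurePreserving_add_right (volume : Measure ℝ) a).setLIntegral_comp_preimage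
      (s := Ioc (-1 + a) (1 + a)) measurableSet_Ioc (hpoly.comp (measurable_prodMk_left (x := r)))
    have hset : (fun x : ℝ => x + a) ⁻¹' Ioc (-1 + a) (1 + a) = Ioc (-1) 1 := by ext; simp
    rw [hset] at this
    exact this
  have h0 : ∀ r : ℝ, ∀ τ ∈ Ioo (-1 : ℝ) 1, (r, r * τ) = r • sqCurve τ := fun r τ hτ => by
    rw [sqCurve_of_abs_le (abs_le.2 ⟨hτ.1.le, hτ.2.le⟩)]; simp
  have hsec : ∀ (G : ℝ × ℝ → ℝ≥0∞) (a : ℝ), Measurable G →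
      (∀ r τ : ℝ, G (r • sqCurve τ) = F (r • sqCurve (τ + a))) →
      ∫⁻ p in S, G p = ∫⁻ r in Ioi (0 : ℝ), ENNReal.ofReal r *
        ∫⁻ θ in Ioc (-1 + a) (1 + a), F (r • sqCurve θ) := fun G a hG h => by
    rw [lintegral_sector hG]
    refine lintegral_congr fun r => ?_
    rw [← hshift]
    congr 1
    refine setLIntegral_congr_fun measurableSet_Ioo fun τ hτ => ?_
    simp only [h0 r τ hτ, h]
  have mI : ∀ a b : ℝ, Measurable fun r : ℝ => ENNReal.ofReal r *
      ∫⁻ θ in Ioc a b, F (r • sqCurve θ) := fun a b =>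
    ENNReal.measurable_ofReal.mul (Measurable.lintegral_prod_right' (f := fun z : ℝ × ℝ =>
      F (z.1 • sqCurve z.2)) hpoly)
  rw [h4, hsec F 0 hF (by simp), hsec (fun p => F (quarter p)) 2 (hF.comp hJm)
      (fun r τ => by rw [sqCurve_add_two, quarter_smul]),
    hsec (fun p => F (quarter (quarter p))) 4 (hF.comp (hJm.comp hJm))
      (fun r τ => by rw [sqCurve_add_four, quarter_quarter, smul_neg]),
    hsec (fun p => F (quarter (quarter (quarter p)))) 6 (hF.comp (hJm.comp (hJm.comp hJm)))
      (fun r τ => by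
        rw [show τ + 6 = τ + 2 + 4 by ring, sqCurve_add_four, sqCurve_add_two, quarter_quarter,
          quarter_smul, smul_neg]),
    ← lintegral_add_right _ (mI _ _), ← lintegral_add_right _ (mI _ _),
    ← lintegral_add_right _ (mI _ _)]
  refine lintegral_congr fun r => ?_
  simp only [← mul_add]
  congr 1
  have hu : ∀ a b c : ℝ, a ≤ b → b ≤ c → (∫⁻ θ in Ioc a b, F (r • sqCurve θ)) +
      ∫⁻ θ in Ioc b c, F (r • sqCurve θ) = ∫⁻ θ in Ioc a c, F (r • sqCurve θ) :=
    fun a b c hab hbc => by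
      rw [← Ioc_union_Ioc_eq_Ioc hab hbc, lintegral_union measurableSet_Ioc]
      exact Ioc_disjoint_Ioc_of_le le_rfl
  norm_num
  rw [hu _ _ _ (by norm_num) (by norm_num), hu _ _ _ (by norm_num) (by norm_num),
    hu _ _ _ (by norm_num) (by norm_num)]

/-- In the polar coordinates of `lintegral_polar` the rotation is a translation of the angle, and
the integral of an 8-periodic function over a period does not depend on where the period starts. -/
theorem measurePreserving_sqRot (φ : ℝ) :
    MeasurePreserving (sqRot φ) (volume : Measure (ℝ × ℝ)) volume := by
  have hm : Measurable (sqRot φ) :=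
    (continuous_sqRot.comp (Continuous.prodMk_right φ)).measurable
  refine ⟨hm, ?_⟩
  ext A hA
  rw [Measure.map_apply hm hA, ← lintegral_indicator_one (hm hA), ← lintegral_indicator_one hA]
  have hF : Measurable (A.indicator (1 : ℝ × ℝ → ℝ≥0∞)) := measurable_one.indicator hA
  rw [lintegral_polar hF, lintegral_polar (measurable_one.indicator (hm hA))]
  refine setLIntegral_congr_fun measurableSet_Ioi fun r hr => ?_
  congr 1
  have hr0 : (0 : ℝ) ≤ r := (mem_Ioi.1 hr).le
  set G : ℝ → ℝ≥0∞ := fun θ => A.indicator 1 (r • sqCurve θ) with hG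
  have e1 : ∀ θ, (sqRot φ ⁻¹' A).indicator (1 : ℝ × ℝ → ℝ≥0∞) (r • sqCurve θ) = G (θ + φ) :=
    fun θ => by
      have : r • sqCurve θ ∈ sqRot φ ⁻¹' A ↔ r • sqCurve (θ + φ) ∈ A := by
        rw [mem_preimage, sqRot_smul_sqCurve hr0]
      by_cases h : r • sqCurve (θ + φ) ∈ A
      · rw [indicator_of_mem (this.2 h), hG]; simp only [indicator_of_mem h]; rfl
      · rw [indicator_of_notMem (mt this.1 h), hG]; simp only [indicator_of_notMem h]
  simp only [e1]
  have hGm : Measurable G := hF.comp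
    ((measurable_const (a := r)).smul lipschitz_sqCurve.continuous.measurable)
  have hpre := (measurePreserving_add_right (volume : Measure ℝ) φ).setLIntegral_comp_preimage
      (s := Ioc (-1 + φ) (-1 + φ + 8)) measurableSet_Ioc hGm
  have hset : (fun x : ℝ => x + φ) ⁻¹' Ioc (-1 + φ) (-1 + φ + 8) = Ioc (-1) (-1 + 8) := by
    ext x; simp only [mem_preimage, mem_Ioc]; constructor <;> rintro ⟨a, b⟩ <;>
      constructor <;> linarith
  rw [hset] at hpre
  rw [hpre]
  have : Fact ((0 : ℝ) < 8) := ⟨by norm_num⟩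
  refine (isAddFundamentalDomain_Ioc (T := 8) (by norm_num) (-1 + φ)).setLIntegral_eq
    (isAddFundamentalDomain_Ioc (T := 8) (by norm_num) (-1)) G ?_
  rintro ⟨g, hg⟩ x
  obtain ⟨n, rfl⟩ := AddSubgroup.mem_zmultiples_iff.1 hg
  simp only [hG, AddSubgroup.mk_vadd, vadd_eq_add, zsmul_eq_mul]
  rw [add_comm, mul_comm, sqCurve_add_eight_mul]

/-! ### The torus and its fundamental domain -/

/-- The projection of the plane to the torus. -/
def mk2 (q : ℝ × ℝ) : T2 := ((q.1 : UnitAddCircle), (q.2 : UnitAddCircle))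

/-- The representative of a point of the torus in the half-open unit square. -/
def rep2 (x : T2) : ℝ × ℝ := (rep x.1, rep x.2)

/-- The half-open unit square. -/
def unitSq : Set (ℝ × ℝ) := Ico 0 1 ×ˢ Ico 0 1

theorem rep_mem (x : UnitAddCircle) : rep x ∈ Ico (0 : ℝ) 1 := by
  have := (AddCircle.equivIco 1 0 x).2
  exact ⟨this.1, this.2.trans_eq (zero_add 1)⟩

theorem coe_rep (x : UnitAddCircle) : ((rep x : ℝ) : UnitAddCircle) = x :=
  AddCircle.coe_equivIco

theorem rep_coe (a : ℝ) : rep (a : UnitAddCircle) = Int.fract a := by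
  rw [rep, AddCircle.coe_equivIco_mk_apply]; simp

theorem rep_coe_of_mem {a : ℝ} (ha : a ∈ Ico (0 : ℝ) 1) : rep (a : UnitAddCircle) = a := by
  rw [rep_coe, Int.fract_eq_self]; exact ha

theorem mk2_rep2 (x : T2) : mk2 (rep2 x) = x := Prod.ext (coe_rep _) (coe_rep _)

theorem rep2_mem (x : T2) : rep2 x ∈ unitSq := ⟨rep_mem _, rep_mem _⟩

theorem rep2_mk2 {q : ℝ × ℝ} (hq : q ∈ unitSq) : rep2 (mk2 q) = q :=
  Prod.ext (rep_coe_of_mem hq.1) (rep_coe_of_mem hq.2)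

theorem continuous_mk2 : Continuous mk2 :=
  ((AddCircle.continuous_mk' 1).comp continuous_fst).prodMk
    ((AddCircle.continuous_mk' 1).comp continuous_snd)

theorem measurable_mk2 : Measurable mk2 := continuous_mk2.measurable

theorem measurable_rep : Measurable rep :=
  measurable_subtype_coe.comp (AddCircle.measurableEquivIco 1 0).measurable

theorem measurable_rep2 : Measurable rep2 :=
  (measurable_rep.comp measurable_fst).prodMk (measurable_rep.comp measurable_snd)

theorem measurableSet_unitSq : MeasurableSet unitSq := measurableSet_Ico.prod measurableSet_Ico

theorem measurePreserving_rep :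
    MeasurePreserving rep volume ((volume : Measure ℝ).restrict (Ico 0 1)) := by
  refine ⟨measurable_rep, ?_⟩
  have h := UnitAddCircle.measurePreserving_mk 0
  rw [zero_add, ← restrict_Ico_eq_restrict_Ioc] at h
  rw [← h.map_eq, Measure.map_map measurable_rep AddCircle.measurable_mk']
  have : (rep ∘ fun a : ℝ => (a : UnitAddCircle)) =ᵐ[volume.restrict (Ico (0 : ℝ) 1)] id := by
    filter_upwards [ae_restrict_mem measurableSet_Ico] with a ha using rep_coe_of_mem ha
  rw [Measure.map_congr this, Measure.map_id]

theorem measurePreserving_rep2 :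
    MeasurePreserving rep2 volume ((volume : Measure (ℝ × ℝ)).restrict unitSq) := by
  have h := measurePreserving_rep.prod measurePreserving_rep
  rw [Measure.prod_restrict] at h
  exact h

theorem measurePreserving_mk2 :
    MeasurePreserving mk2 ((volume : Measure (ℝ × ℝ)).restrict unitSq) volume := by
  refine ⟨measurable_mk2, ?_⟩
  rw [← measurePreserving_rep2.map_eq, Measure.map_map measurable_mk2 measurable_rep2]
  have : mk2 ∘ rep2 = id := funext mk2_rep2
  rw [this, Measure.map_id]

theorem volume_inter_preimage_rep2 {A : Set T2} (hA : MeasurableSet A) {B : Set (ℝ × ℝ)}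
    (hB : MeasurableSet B) (hsub : B ⊆ unitSq) :
    volume (A ∩ rep2 ⁻¹' B) = volume (mk2 ⁻¹' A ∩ B) := by
  have h := measurePreserving_rep2.measure_preimage
    ((measurable_mk2 hA).inter hB).nullMeasurableSet
  rw [Measure.restrict_apply ((measurable_mk2 hA).inter hB), inter_assoc,
    inter_eq_left.2 hsub] at h
  rw [← h]
  congr 1
  ext x
  simp [mk2_rep2]

theorem mk2_add (p q : ℝ × ℝ) : mk2 (p + q) = mk2 p + mk2 q := rfl

theorem mk2_sub (p q : ℝ × ℝ) : mk2 (p - q) = mk2 p - mk2 q := rfl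

theorem dist_mk2_le (p q : ℝ × ℝ) : dist (mk2 p) (mk2 q) ≤ ‖p - q‖ := by
  rw [Prod.dist_eq, dist_eq_norm, dist_eq_norm]
  refine max_le (le_trans ?_ (norm_fst_le _)) (le_trans ?_ (norm_snd_le _))
  · exact QuotientAddGroup.norm_mk_le_norm
  · exact QuotientAddGroup.norm_mk_le_norm

/-! ### Rotation of a rectangle -/

/-- Anisotropic scaling of the plane. -/
def scale (w h : ℝ) (p : ℝ × ℝ) : ℝ × ℝ := (w * p.1, h * p.2)

theorem scale_scale_inv {w h : ℝ} (hw : w ≠ 0) (hh : h ≠ 0) (p : ℝ × ℝ) :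
    scale w h (scale w⁻¹ h⁻¹ p) = p := by
  simp [scale, hw, hh]

theorem scale_inv_scale {w h : ℝ} (hw : w ≠ 0) (hh : h ≠ 0) (p : ℝ × ℝ) :
    scale w⁻¹ h⁻¹ (scale w h p) = p := by
  simp [scale, hw, hh]

theorem continuous_scale (w h : ℝ) : Continuous (scale w h) := by unfold scale; fun_prop

theorem scale_sub (w h : ℝ) (p q : ℝ × ℝ) : scale w h (p - q) = scale w h p - scale w h q := by
  simp [scale, mul_sub]

theorem scale_smul (w h r : ℝ) (p : ℝ × ℝ) : scale w h (r • p) = r • scale w h p := by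
  simp [scale, mul_left_comm]

theorem norm_scale_le {w h : ℝ} (hw : 0 < w) (hh : 0 < h) (p : ℝ × ℝ) :
    ‖scale w h p‖ ≤ max w h * ‖p‖ := by
  rw [Prod.norm_def]
  refine max_le ?_ ?_
  · simp only [scale, norm_mul, Real.norm_of_nonneg hw.le]
    exact mul_le_mul (le_max_left _ _) (norm_fst_le p) (norm_nonneg _) (hw.le.trans (le_max_left _ _))
  · simp only [scale, norm_mul, Real.norm_of_nonneg hh.le]
    exact mul_le_mul (le_max_right _ _) (norm_snd_le p) (norm_nonneg _)
      (hw.le.trans (le_max_left _ _))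

/-- The rotation by `θ` of the plane along rectangles of aspect `w : h` centred at `c`. -/
def boxRot (w h : ℝ) (c : ℝ × ℝ) (θ : ℝ) (q : ℝ × ℝ) : ℝ × ℝ :=
  c + scale w h (sqRot θ (scale w⁻¹ h⁻¹ (q - c)))

/-- The open `w × h` rectangle centred at `c`. -/
def box (w h : ℝ) (c : ℝ × ℝ) : Set (ℝ × ℝ) := {q | ‖scale w⁻¹ h⁻¹ (q - c)‖ < 1 / 2}

theorem mem_box {w h : ℝ} (hw : 0 < w) (hh : 0 < h) {c q : ℝ × ℝ} :
    q ∈ box w h c ↔ |q.1 - c.1| < w / 2 ∧ |q.2 - c.2| < h / 2 := by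
  change ‖scale w⁻¹ h⁻¹ (q - c)‖ < 1 / 2 ↔ _
  rw [Prod.norm_def, max_lt_iff]
  simp only [scale, Prod.fst_sub, Prod.snd_sub, Real.norm_eq_abs, abs_mul, abs_inv, abs_of_pos hw,
    abs_of_pos hh]
  rw [inv_mul_lt_iff₀ hw, inv_mul_lt_iff₀ hh]
  ring_nf

theorem isOpen_box (w h : ℝ) (c : ℝ × ℝ) : IsOpen (box w h c) :=
  isOpen_lt (((continuous_scale _ _).comp (continuous_id.sub continuous_const)).norm)
    continuous_const

theorem scale_boxRot_sub {w h : ℝ} (hw : 0 < w) (hh : 0 < h) (c : ℝ × ℝ) (θ : ℝ) (q : ℝ × ℝ) :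
    scale w⁻¹ h⁻¹ (boxRot w h c θ q - c) = sqRot θ (scale w⁻¹ h⁻¹ (q - c)) := by
  rw [boxRot, add_sub_cancel_left, scale_inv_scale hw.ne' hh.ne']

theorem boxRot_mem_box {w h : ℝ} (hw : 0 < w) (hh : 0 < h) {c : ℝ × ℝ} {θ : ℝ} {q : ℝ × ℝ} :
    boxRot w h c θ q ∈ box w h c ↔ q ∈ box w h c := by
  change ‖scale w⁻¹ h⁻¹ (boxRot w h c θ q - c)‖ < 1 / 2 ↔ ‖scale w⁻¹ h⁻¹ (q - c)‖ < 1 / 2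
  rw [scale_boxRot_sub hw hh, norm_sqRot]

theorem boxRot_boxRot {w h : ℝ} (hw : 0 < w) (hh : 0 < h) (c : ℝ × ℝ) (θ φ : ℝ) (q : ℝ × ℝ) :
    boxRot w h c θ (boxRot w h c φ q) = boxRot w h c (φ + θ) q := by
  rw [boxRot, scale_boxRot_sub hw hh, sqRot_sqRot, boxRot]

theorem boxRot_zero {w h : ℝ} (hw : 0 < w) (hh : 0 < h) (c : ℝ × ℝ) (q : ℝ × ℝ) : boxRot w h c 0 q = q := by
  rw [boxRot, sqRot_zero, scale_scale_inv hw.ne' hh.ne', add_sub_cancel]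

theorem boxRot_four {w h : ℝ} (hw : 0 < w) (hh : 0 < h) (c : ℝ × ℝ) (q : ℝ × ℝ) :
    boxRot w h c 4 q = c + c - q := by
  rw [boxRot, sqRot_four, ← neg_one_smul ℝ, scale_smul, scale_scale_inv hw.ne' hh.ne',
    neg_one_smul]
  abel

theorem boxRot_neg_four {w h : ℝ} (hw : 0 < w) (hh : 0 < h) (c : ℝ × ℝ) (q : ℝ × ℝ) :
    boxRot w h c (-4) q = c + c - q := by
  rw [boxRot, sqRot_neg_four, ← neg_one_smul ℝ, scale_smul, scale_scale_inv hw.ne' hh.ne',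
    neg_one_smul]
  abel

theorem norm_boxRot_sub_angle_le {w h : ℝ} (hw : 0 < w) (hh : 0 < h) (c : ℝ × ℝ) (θ θ' : ℝ)
    {q : ℝ × ℝ} (hq : q ∈ box w h c) :
    ‖boxRot w h c θ q - boxRot w h c θ' q‖ ≤ max w h / 2 * |θ - θ'| := by
  rw [boxRot, boxRot, add_sub_add_left_eq_sub, ← scale_sub]
  refine (norm_scale_le hw hh _).trans ?_
  have hq' : ‖scale w⁻¹ h⁻¹ (q - c)‖ < 1 / 2 := hq
  have h1 := norm_sqRot_sub_angle_le θ θ' (scale w⁻¹ h⁻¹ (q - c))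
  have h2 : ‖scale w⁻¹ h⁻¹ (q - c)‖ * |θ - θ'| ≤ 1 / 2 * |θ - θ'| :=
    mul_le_mul_of_nonneg_right hq'.le (abs_nonneg _)
  have h3 := mul_le_mul_of_nonneg_left (h1.trans h2) (hw.le.trans (le_max_left w h))
  linarith

theorem norm_boxRot_sub_le {w h : ℝ} (hw : 0 < w) (hh : 0 < h) (c : ℝ × ℝ) (θ : ℝ) (p q : ℝ × ℝ) :
    ‖boxRot w h c θ p - boxRot w h c θ q‖ ≤
      max w h * (9 * (max w⁻¹ h⁻¹ * ‖p - q‖)) := by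
  rw [boxRot, boxRot, add_sub_add_left_eq_sub, ← scale_sub]
  refine (norm_scale_le hw hh _).trans ?_
  refine mul_le_mul_of_nonneg_left ?_ (hw.le.trans (le_max_left w h))
  refine (norm_sqRot_sub_le _ _ _).trans ?_
  refine mul_le_mul_of_nonneg_left ?_ (by norm_num)
  rw [← scale_sub, sub_sub_sub_cancel_right]
  exact norm_scale_le (inv_pos.2 hw) (inv_pos.2 hh) _

/-- The two scalings in the conjugation change area by reciprocal constants, and the rotation
between them preserves area. -/
theorem measurePreserving_boxRot {w h : ℝ} (hw : 0 < w) (hh : 0 < h) (c : ℝ × ℝ) (θ : ℝ) :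
    MeasurePreserving (boxRot w h c θ) volume volume := by
  have hms : Measurable (scale w h) := (continuous_scale w h).measurable
  have hmi : Measurable (scale w⁻¹ h⁻¹) := (continuous_scale _ _).measurable
  set κ : ℝ≥0∞ := ENNReal.ofReal |w⁻¹| * ENNReal.ofReal |h⁻¹| with hκ
  have hκ0 : κ ≠ 0 := by simp [hκ, hw.ne', hh.ne']
  have hκt : κ ≠ ⊤ := ENNReal.mul_ne_top ENNReal.ofReal_ne_top ENNReal.ofReal_ne_top
  have h1 : MeasurePreserving (scale w h) volume (κ • volume) := by
    refine ⟨hms, ?_⟩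
    have e : scale w h = Prod.map (w * ·) (h * ·) := rfl
    rw [e, Measure.volume_eq_prod, ← Measure.map_prod_map _ _ (measurable_const_mul w)
      (measurable_const_mul h), Real.map_volume_mul_left hw.ne', Real.map_volume_mul_left hh.ne',
      Measure.prod_smul_left, Measure.prod_smul_right, smul_smul]
  have h2 : MeasurePreserving (scale w⁻¹ h⁻¹) (κ • volume) volume := by
    refine ⟨hmi, ?_⟩
    rw [← h1.map_eq, Measure.map_map hmi hms]
    have : scale w⁻¹ h⁻¹ ∘ scale w h = id := funext (scale_inv_scale hw.ne' hh.ne')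
    rw [this, Measure.map_id]
  have h3 := h1.comp ((measurePreserving_sqRot θ).comp h2)
  have h4 : MeasurePreserving (scale w h ∘ sqRot θ ∘ scale w⁻¹ h⁻¹)
      (volume : Measure (ℝ × ℝ)) volume := by
    refine ⟨h3.measurable, ?_⟩
    have := h3.map_eq
    rw [Measure.map_smul] at this
    have h5 := congrArg (fun μ => κ⁻¹ • μ) this
    simpa only [smul_smul, ENNReal.inv_mul_cancel hκ0 hκt, one_smul] using h5
  exact (measurePreserving_add_left volume c).comp (h4.comp (measurePreserving_sub_right volume c))

theorem continuous_boxRot (w h : ℝ) :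
    Continuous fun z : (ℝ × ℝ) × ℝ × (ℝ × ℝ) => boxRot w h z.1 z.2.1 z.2.2 := by
  unfold boxRot
  refine continuous_fst.add ((continuous_scale w h).comp ?_)
  exact continuous_sqRot.comp (continuous_snd.fst.prodMk
    ((continuous_scale _ _).comp (continuous_snd.snd.sub continuous_fst)))

/-- The angular speed of the rotating field on a `w × h` rectangle. -/
def angSpeed (w h : ℝ) : ℝ := 2 / max w h

/-- The rotating field on a `w × h` rectangle, with values fixed on the diagonals. -/
def boxField (w h : ℝ) (z : ℝ × ℝ) : ℝ × ℝ :=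
  angSpeed w h • scale w h (sqField (scale w⁻¹ h⁻¹ z))

theorem norm_sqField_le (p : ℝ × ℝ) : ‖sqField p‖ ≤ ‖p‖ := by
  unfold sqField
  split_ifs
  · simp [Prod.norm_def]
  · simp [Prod.norm_def]

theorem norm_boxField_le {w h : ℝ} (hw : 0 < w) (hh : 0 < h) {c q : ℝ × ℝ} (hq : q ∈ box w h c) :
    ‖boxField w h (q - c)‖ ≤ 1 := by
  have hm : 0 < max w h := lt_max_of_lt_left hw
  have h1 : ‖sqField (scale w⁻¹ h⁻¹ (q - c))‖ ≤ 1 / 2 :=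
    (norm_sqField_le _).trans (le_of_lt hq)
  rw [boxField, norm_smul, angSpeed, Real.norm_of_nonneg (by positivity)]
  have h2 := (norm_scale_le hw hh (sqField (scale w⁻¹ h⁻¹ (q - c)))).trans
    (mul_le_mul_of_nonneg_left h1 hm.le)
  calc 2 / max w h * _ ≤ 2 / max w h * (max w h * (1 / 2)) :=
        mul_le_mul_of_nonneg_left h2 (by positivity)
    _ = 1 := by field_simp

theorem measurable_sqField : Measurable sqField := by
  unfold sqField
  refine Measurable.ite (measurableSet_lt ?_ ?_) ?_ ?_ <;> fun_prop

theorem measurable_boxField (w h : ℝ) : Measurable (boxField w h) :=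
  ((continuous_scale w h).measurable.comp
    (measurable_sqField.comp (continuous_scale w⁻¹ h⁻¹).measurable)).const_smul (angSpeed w h)

/-- The rotating field agrees with `boxField` off the diagonals. -/
theorem rotField_eq_boxField {w h : ℝ} (hw : 0 < w) (hh : 0 < h) {z : ℝ × ℝ}
    (hz : |z.1 / w| ≠ |z.2 / h|) : rotField w h z = boxField w h z := by
  -- Differentiating the stream function produces coefficients such as `2 * min w h / w ^ 2`; this
  -- identity turns them into the angular speed `2 / max w h`.
  have hmm : min w h * max w h = w * h := min_mul_max w h
  have hm : 0 < max w h := lt_max_of_lt_left hw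
  have e1 : w⁻¹ * z.1 = z.1 / w := by rw [mul_comm]; rfl
  have e2 : h⁻¹ * z.2 = z.2 / h := by rw [mul_comm]; rfl
  rcases lt_or_gt_of_ne hz with hlt | hlt
  · have d1 : deriv (fun s => stream w h (s, z.2)) z.1 = 0 := by
      have : (fun s => stream w h (s, z.2)) =ᶠ[𝓝 z.1] fun _ => min w h * (z.2 / h) ^ 2 := by
        have : ∀ᶠ s in 𝓝 z.1, |s / w| < |z.2 / h| :=
          (continuous_abs.comp (continuous_id.div_const w)).continuousAt.eventually
            (Iio_mem_nhds hlt)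
        filter_upwards [this] with s hs
        rw [stream, max_eq_right (sq_le_sq.2 hs.le)]
      rw [this.deriv_eq, deriv_const]
    have d2 : deriv (fun s => stream w h (z.1, s)) z.2 = min w h * (2 * z.2 / h ^ 2) := by
      have : (fun s => stream w h (z.1, s)) =ᶠ[𝓝 z.2] fun s => min w h * (s / h) ^ 2 := by
        have : ∀ᶠ s in 𝓝 z.2, |z.1 / w| < |s / h| :=
          (continuous_abs.comp (continuous_id.div_const h)).continuousAt.eventually
            (Ioi_mem_nhds hlt)
        filter_upwards [this] with s hs
        rw [stream, max_eq_right (sq_le_sq.2 hs.le)]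
      rw [this.deriv_eq]
      have hd : HasDerivAt (fun s : ℝ => min w h * (s / h) ^ 2)
          (min w h * (2 * (z.2 / h) ^ 1 * (1 / h))) z.2 :=
        (((hasDerivAt_id z.2).div_const h).pow 2).const_mul _
      rw [hd.deriv]; field_simp
    rw [rotField, d1, d2, boxField, sqField, if_neg]
    · simp only [scale, angSpeed, e2, Prod.smul_mk, smul_eq_mul, mul_zero]
      congr 1
      field_simp
      linear_combination (-1 : ℝ) * z.2 * hmm
    · simp only [scale, e1, e2]; exact not_lt.2 hlt.le
  · have d2 : deriv (fun s => stream w h (z.1, s)) z.2 = 0 := by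
      have : (fun s => stream w h (z.1, s)) =ᶠ[𝓝 z.2] fun _ => min w h * (z.1 / w) ^ 2 := by
        have : ∀ᶠ s in 𝓝 z.2, |s / h| < |z.1 / w| :=
          (continuous_abs.comp (continuous_id.div_const h)).continuousAt.eventually
            (Iio_mem_nhds hlt)
        filter_upwards [this] with s hs
        rw [stream, max_eq_left (sq_le_sq.2 hs.le)]
      rw [this.deriv_eq, deriv_const]
    have d1 : deriv (fun s => stream w h (s, z.2)) z.1 = min w h * (2 * z.1 / w ^ 2) := by
      have : (fun s => stream w h (s, z.2)) =ᶠ[𝓝 z.1] fun s => min w h * (s / w) ^ 2 := by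
        have : ∀ᶠ s in 𝓝 z.1, |z.2 / h| < |s / w| :=
          (continuous_abs.comp (continuous_id.div_const w)).continuousAt.eventually
            (Ioi_mem_nhds hlt)
        filter_upwards [this] with s hs
        rw [stream, max_eq_left (sq_le_sq.2 hs.le)]
      rw [this.deriv_eq]
      have hd : HasDerivAt (fun s : ℝ => min w h * (s / w) ^ 2)
          (min w h * (2 * (z.1 / w) ^ 1 * (1 / w))) z.1 :=
        (((hasDerivAt_id z.1).div_const w).pow 2).const_mul _
      rw [hd.deriv]; field_simp
    rw [rotField, d1, d2, boxField, sqField, if_pos]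
    · simp only [scale, angSpeed, e1, Prod.smul_mk, smul_eq_mul, mul_zero, neg_zero]
      congr 1
      field_simp
      linear_combination z.1 * hmm
    · simp only [scale, e1, e2]; exact hlt

theorem hasDerivAt_boxRot {w h : ℝ} (hw : 0 < w) (hh : 0 < h) (c q : ℝ × ℝ) (k : ℝ) (τ : ℝ)
    (hq : scale w⁻¹ h⁻¹ (q - c) = 0 ∨
      |(sqRot (k * angSpeed w h * τ) (scale w⁻¹ h⁻¹ (q - c))).1| ≠
      |(sqRot (k * angSpeed w h * τ) (scale w⁻¹ h⁻¹ (q - c))).2|) :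
    HasDerivAt (fun τ => boxRot w h c (k * angSpeed w h * τ) q)
      (k • boxField w h (boxRot w h c (k * angSpeed w h * τ) q - c)) τ := by
  set p := scale w⁻¹ h⁻¹ (q - c) with hp
  have h1 := hasDerivAt_sqRot p (k * angSpeed w h * τ) hq
  have h2 : HasDerivAt (fun τ => sqRot (k * angSpeed w h * τ) p)
      ((k * angSpeed w h) • sqField (sqRot (k * angSpeed w h * τ) p)) τ :=
    h1.scomp τ (by simpa using (hasDerivAt_id τ).const_mul (k * angSpeed w h))
  have hf : HasDerivAt (fun τ => (sqRot (k * angSpeed w h * τ) p).1) _ τ := h2.fst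
  have hs : HasDerivAt (fun τ => (sqRot (k * angSpeed w h * τ) p).2) _ τ := h2.snd
  have h3 : HasDerivAt (fun τ => boxRot w h c (k * angSpeed w h * τ) q)
      (scale w h ((k * angSpeed w h) • sqField (sqRot (k * angSpeed w h * τ) p))) τ :=
    ((hf.const_mul w).prodMk (hs.const_mul h)).const_add c
  convert h3 using 1
  rw [boxField, scale_boxRot_sub hw hh, scale_smul, smul_smul]

/-! ### Families of rotating rectangles on the torus -/

/-- A family of disjoint open `w × h` rectangles in the torus: every point of `carrier` lies in the
rectangle with centre `cen x`, on which `carrier`, `cen` and the orientation `sgn` are constant. -/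
structure Cells where
  w : ℝ
  h : ℝ
  w_pos : 0 < w
  h_pos : 0 < h
  carrier : Set T2
  cen : T2 → ℝ × ℝ
  sgn : T2 → ℝ
  measurableSet_carrier : MeasurableSet carrier
  measurable_cen : Measurable cen
  measurable_sgn : Measurable sgn
  abs_sgn : ∀ x, |sgn x| = 1
  rep2_mem_box : ∀ x ∈ carrier, rep2 x ∈ box w h (cen x)
  box_subset : ∀ x ∈ carrier, box w h (cen x) ⊆ unitSq
  mem_of_mem_box : ∀ x ∈ carrier, ∀ q ∈ box w h (cen x), mk2 q ∈ carrier
  cen_of_mem_box : ∀ x ∈ carrier, ∀ q ∈ box w h (cen x), cen (mk2 q) = cen x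
  sgn_of_mem_box : ∀ x ∈ carrier, ∀ q ∈ box w h (cen x), sgn (mk2 q) = sgn x
  countable_cen : (cen '' carrier).Countable

namespace Cells

variable (C : Cells)

open Classical in
/-- The velocity field of a family of rotating rectangles. -/
def vel (x : T2) : ℝ × ℝ :=
  if x ∈ C.carrier then C.sgn x • boxField C.w C.h (rep2 x - C.cen x) else 0

/-- The angle of rotation after time `τ`. -/
def ang (x : T2) (τ : ℝ) : ℝ := C.sgn x * angSpeed C.w C.h * τ

open Classical in
/-- The underlying map of the flow of a family of rotating rectangles. -/
def mapFun (τ : ℝ) (x : T2) : T2 :=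
  if x ∈ C.carrier then mk2 (boxRot C.w C.h (C.cen x) (C.ang x τ) (rep2 x)) else x

theorem measurable_vel : Measurable C.vel := by
  classical
  exact Measurable.ite C.measurableSet_carrier (C.measurable_sgn.smul
    ((measurable_boxField _ _).comp (measurable_rep2.sub C.measurable_cen))) measurable_const

theorem norm_vel_le (x : T2) : ‖C.vel x‖ ≤ 1 := by
  unfold vel
  split_ifs with hx
  · rw [norm_smul, Real.norm_eq_abs, C.abs_sgn, one_mul]
    exact norm_boxField_le C.w_pos C.h_pos (C.rep2_mem_box x hx)
  · simp

variable {C}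

theorem vel_of_mem {x : T2} (hx : x ∈ C.carrier) :
    C.vel x = C.sgn x • boxField C.w C.h (rep2 x - C.cen x) := if_pos hx

theorem vel_of_notMem {x : T2} (hx : x ∉ C.carrier) : C.vel x = 0 := if_neg hx

theorem boxRot_mem {x : T2} (hx : x ∈ C.carrier) (θ : ℝ) :
    boxRot C.w C.h (C.cen x) θ (rep2 x) ∈ box C.w C.h (C.cen x) :=
  (boxRot_mem_box C.w_pos C.h_pos).2 (C.rep2_mem_box x hx)

theorem mapFun_of_mem {x : T2} (hx : x ∈ C.carrier) (τ : ℝ) :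
    C.mapFun τ x = mk2 (boxRot C.w C.h (C.cen x) (C.ang x τ) (rep2 x)) := if_pos hx

theorem mapFun_of_notMem {x : T2} (hx : x ∉ C.carrier) (τ : ℝ) : C.mapFun τ x = x := if_neg hx

theorem rep2_mapFun {x : T2} (hx : x ∈ C.carrier) (τ : ℝ) :
    rep2 (C.mapFun τ x) = boxRot C.w C.h (C.cen x) (C.ang x τ) (rep2 x) := by
  rw [mapFun_of_mem hx, rep2_mk2 (C.box_subset x hx (boxRot_mem hx _))]

theorem mapFun_mem {x : T2} (hx : x ∈ C.carrier) (τ : ℝ) : C.mapFun τ x ∈ C.carrier := by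
  rw [mapFun_of_mem hx]; exact C.mem_of_mem_box x hx _ (boxRot_mem hx _)

theorem cen_mapFun (x : T2) (τ : ℝ) : C.cen (C.mapFun τ x) = C.cen x := by
  by_cases hx : x ∈ C.carrier
  · rw [mapFun_of_mem hx]; exact C.cen_of_mem_box x hx _ (boxRot_mem hx _)
  · rw [mapFun_of_notMem hx]

theorem sgn_mapFun (x : T2) (τ : ℝ) : C.sgn (C.mapFun τ x) = C.sgn x := by
  by_cases hx : x ∈ C.carrier
  · rw [mapFun_of_mem hx]; exact C.sgn_of_mem_box x hx _ (boxRot_mem hx _)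
  · rw [mapFun_of_notMem hx]

variable (C)

theorem mapFun_mapFun (σ τ : ℝ) (x : T2) : C.mapFun σ (C.mapFun τ x) = C.mapFun (τ + σ) x := by
  by_cases hx : x ∈ C.carrier
  · rw [mapFun_of_mem (mapFun_mem hx τ), mapFun_of_mem hx (τ + σ), cen_mapFun, rep2_mapFun hx,
      boxRot_boxRot C.w_pos C.h_pos]
    congr 2
    simp only [ang, sgn_mapFun]; ring
  · rw [mapFun_of_notMem hx, mapFun_of_notMem hx, mapFun_of_notMem hx]

theorem mapFun_zero (x : T2) : C.mapFun 0 x = x := by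
  by_cases hx : x ∈ C.carrier
  · rw [mapFun_of_mem hx, ang, mul_zero, boxRot_zero C.w_pos C.h_pos, mk2_rep2]
  · rw [mapFun_of_notMem hx]

theorem measurable_mapFun_uncurry : Measurable fun z : ℝ × T2 => C.mapFun z.1 z.2 := by
  classical
  refine Measurable.ite (measurable_snd C.measurableSet_carrier) ?_ measurable_snd
  refine measurable_mk2.comp ((continuous_boxRot C.w C.h).measurable.comp
    ((C.measurable_cen.comp measurable_snd).prodMk (Measurable.prodMk ?_
      (measurable_rep2.comp measurable_snd))))
  exact ((C.measurable_sgn.comp measurable_snd).mul_const _).mul measurable_fst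

theorem measurable_mapFun (τ : ℝ) : Measurable (C.mapFun τ) :=
  C.measurable_mapFun_uncurry.comp measurable_prodMk_left

/-- The flow of a family of rotating rectangles. -/
def map (τ : ℝ) : T2 ≃ᵐ T2 where
  toFun := C.mapFun τ
  invFun := C.mapFun (-τ)
  left_inv x := by rw [mapFun_mapFun, add_neg_cancel, mapFun_zero]
  right_inv x := by rw [mapFun_mapFun, neg_add_cancel, mapFun_zero]
  measurable_toFun := C.measurable_mapFun τ
  measurable_invFun := C.measurable_mapFun (-τ)

theorem map_apply (τ : ℝ) (x : T2) : C.map τ x = C.mapFun τ x := rfl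

theorem map_zero : C.map 0 = MeasurableEquiv.refl T2 := by
  ext x : 2
  exact C.mapFun_zero x

variable {C}

theorem preimage_rep2_box {x : T2} (hx : x ∈ C.carrier) :
    rep2 ⁻¹' box C.w C.h (C.cen x) = C.carrier ∩ {y | C.cen y = C.cen x} := by
  ext y
  constructor
  · intro hy
    have h1 := C.mem_of_mem_box x hx _ hy
    have h2 := C.cen_of_mem_box x hx _ hy
    rw [mk2_rep2] at h1 h2
    exact ⟨h1, h2⟩
  · rintro ⟨hy, hc⟩
    have := C.rep2_mem_box y hy
    rw [hc] at this
    exact this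

variable (C)

/-- The complement of the carrier is fixed pointwise, and each of the countably many rectangles is
mapped to itself by an area-preserving rotation, so measures can be compared piece by piece. -/
theorem measurePreserving_map (τ : ℝ) : MeasurePreserving (C.map τ) volume volume := by
  have hm := C.measurable_mapFun τ
  refine ⟨hm, ?_⟩
  ext A hA
  rw [Measure.map_apply (C.map τ).measurable hA]
  change volume (C.mapFun τ ⁻¹' A) = volume A
  set I := C.cen '' C.carrier with hI
  have hfib : ∀ c, MeasurableSet (C.carrier ∩ {y | C.cen y = c}) := fun c =>
    C.measurableSet_carrier.inter (C.measurable_cen (measurableSet_singleton c))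
  have split : ∀ B : Set T2, MeasurableSet B → volume B = volume (B \ C.carrier) +
      ∑' c : I, volume (B ∩ (C.carrier ∩ {y | C.cen y = c})) := by
    intro B hB
    rw [← measure_inter_add_sdiff B C.measurableSet_carrier, add_comm]
    congr 1
    have hu : B ∩ C.carrier = ⋃ c ∈ I, B ∩ (C.carrier ∩ {y | C.cen y = c}) := by
      ext y
      simp only [mem_inter_iff, mem_iUnion, exists_prop]
      constructor
      · rintro ⟨hB, hc⟩; exact ⟨C.cen y, ⟨y, hc, rfl⟩, hB, hc, rfl⟩
      · rintro ⟨c, -, hB, hc, -⟩; exact ⟨hB, hc⟩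
    rw [hu]
    refine measure_biUnion C.countable_cen ?_ fun c _ => hB.inter (hfib c)
    intro c _ d _ hcd
    refine Set.disjoint_left.2 ?_
    rintro y ⟨-, -, h1⟩ ⟨-, -, h2⟩
    exact hcd (h1.symm.trans h2)
  rw [split _ (hm hA), split _ hA]
  congr 1
  · congr 1
    ext y
    simp only [Set.mem_sdiff, mem_preimage]
    refine and_congr_left fun hy => ?_
    rw [mapFun_of_notMem hy]
  · refine tsum_congr ?_
    rintro ⟨c, x, hx, rfl⟩
    simp only
    have hbm := (isOpen_box C.w C.h (C.cen x)).measurableSet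
    have hsub := C.box_subset x hx
    rw [← preimage_rep2_box hx, volume_inter_preimage_rep2 (hm hA) hbm hsub,
      volume_inter_preimage_rep2 hA hbm hsub,
      ← (measurePreserving_boxRot C.w_pos C.h_pos (C.cen x) (C.ang x τ)).measure_preimage
        ((measurable_mk2 hA).inter hbm).nullMeasurableSet]
    congr 1
    ext q
    simp only [mem_inter_iff, mem_preimage, boxRot_mem_box C.w_pos C.h_pos]
    refine and_congr_left fun hq => ?_
    rw [mapFun_of_mem (C.mem_of_mem_box x hx q hq), C.cen_of_mem_box x hx q hq,
      rep2_mk2 (hsub hq), ang, ang, C.sgn_of_mem_box x hx q hq]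

theorem sgn_mul_angSpeed_ne_zero (x : T2) : C.sgn x * angSpeed C.w C.h ≠ 0 := by
  have hm : 0 < max C.w C.h := lt_max_of_lt_left C.w_pos
  refine mul_ne_zero (fun h => ?_) (by rw [angSpeed]; positivity)
  have := C.abs_sgn x
  rw [h, abs_zero] at this
  exact zero_ne_one this

/-- Every orbit lifts to a `1`-Lipschitz curve that solves the differential equation. -/
theorem exists_curve (x : T2) : ∃ γ : ℝ → ℝ × ℝ, LipschitzWith 1 γ ∧ (∀ τ, mk2 (γ τ) = C.map τ x) ∧
    ∀ᵐ τ, HasDerivAt γ (C.vel (C.map τ x)) τ := by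
  by_cases hx : x ∈ C.carrier
  · refine ⟨fun τ => boxRot C.w C.h (C.cen x) (C.ang x τ) (rep2 x), ?_, fun τ => ?_, ?_⟩
    · refine LipschitzWith.of_dist_le_mul fun σ τ => ?_
      rw [dist_eq_norm, NNReal.coe_one, one_mul, Real.dist_eq]
      refine (norm_boxRot_sub_angle_le C.w_pos C.h_pos _ _ _ (C.rep2_mem_box x hx)).trans ?_
      have hm : 0 < max C.w C.h := lt_max_of_lt_left C.w_pos
      rw [ang, ang, ← mul_sub, abs_mul, abs_mul, C.abs_sgn, one_mul, angSpeed,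
        abs_of_pos (by positivity)]
      apply le_of_eq
      field_simp
    · rw [map_apply, mapFun_of_mem hx]
    · set p := scale C.w⁻¹ C.h⁻¹ (rep2 x - C.cen x) with hp
      have key : ∀ τ : ℝ, (p = 0 ∨ |(sqRot (C.ang x τ) p).1| ≠ |(sqRot (C.ang x τ) p).2|) →
          HasDerivAt (fun τ => boxRot C.w C.h (C.cen x) (C.ang x τ) (rep2 x))
            (C.vel (C.map τ x)) τ := by
        intro τ hτ
        have := hasDerivAt_boxRot C.w_pos C.h_pos (C.cen x) (rep2 x) (C.sgn x) τ hτ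
        have e : C.vel (C.map τ x) = C.sgn x • boxField C.w C.h
            (boxRot C.w C.h (C.cen x) (C.ang x τ) (rep2 x) - C.cen x) := by
          rw [map_apply, vel_of_mem (mapFun_mem hx τ), sgn_mapFun, cen_mapFun, rep2_mapFun hx]
        rw [e]
        exact this
      rcases eq_or_ne p 0 with h0 | h0
      · exact Eventually.of_forall fun τ => key τ (Or.inl h0)
      · have hk := C.sgn_mul_angSpeed_ne_zero x
        have hcount : {τ : ℝ | |(sqRot (C.ang x τ) p).1| = |(sqRot (C.ang x τ) p).2|}.Countable :=
          (countable_diagonal_angles h0).preimage (mul_right_injective₀ hk)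
        filter_upwards [hcount.ae_notMem volume] with τ hτ using key τ (Or.inr hτ)
  · refine ⟨fun _ => rep2 x, LipschitzWith.const' _, fun τ => ?_, Eventually.of_forall fun τ => ?_⟩
    · rw [map_apply, mapFun_of_notMem hx, mk2_rep2]
    · rw [map_apply, mapFun_of_notMem hx, vel_of_notMem hx]
      exact hasDerivAt_const _ _

end Cells

/-! ### Lipschitz test functions -/

section Mollify

variable {E : Type*} [NormedAddCommGroup E] [NormedSpace ℝ E] [FiniteDimensional ℝ E]
  [MeasurableSpace E]

/-- A standard sequence of mollifiers. -/
def bump (E : Type*) [NormedAddCommGroup E] (n : ℕ) : ContDiffBump (0 : E) where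
  rIn := 1 / (2 * ((n : ℝ) + 1))
  rOut := 1 / ((n : ℝ) + 1)
  rIn_pos := by positivity
  rIn_lt_rOut := by
    apply one_div_lt_one_div_of_lt <;> linarith [(Nat.cast_nonneg n : (0 : ℝ) ≤ n)]

/-- Mollification of a function. -/
def mollify (μ : Measure E) (n : ℕ) (f : E → ℝ) (x : E) : ℝ :=
  ∫ y, ((bump E n).normed μ y) * f (x - y) ∂μ

theorem mollify_eq_convolution (μ : Measure E) (n : ℕ) (f : E → ℝ) :
    mollify μ n f = convolution ((bump E n).normed μ) f (ContinuousLinearMap.lsmul ℝ ℝ) μ := rfl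

variable [BorelSpace E] {μ : Measure E} [μ.IsAddHaarMeasure] {f : E → ℝ} {K : ℝ≥0}

theorem contDiff_mollify (hf : Continuous f) (n : ℕ) : ContDiff ℝ ∞ (mollify μ n f) := by
  rw [mollify_eq_convolution]
  exact HasCompactSupport.contDiff_convolution_left _ (bump E n).hasCompactSupport_normed
    (bump E n).contDiff_normed hf.locallyIntegrable

theorem integrable_bump_mul (hf : Continuous f) (n : ℕ) (x : E) :
    Integrable (fun y => ((bump E n).normed μ y) * f (x - y)) μ := by
  refine Continuous.integrable_of_hasCompactSupport ?_ ?_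
  · exact (bump E n).continuous_normed.mul (hf.comp (continuous_const.sub continuous_id))
  · exact (bump E n).hasCompactSupport_normed.mul_right

theorem lipschitzWith_mollify (hf : LipschitzWith K f) (n : ℕ) :
    LipschitzWith K (mollify μ n f) := by
  refine LipschitzWith.of_dist_le_mul fun x x' => ?_
  rw [Real.dist_eq, mollify, mollify, ← integral_sub (integrable_bump_mul hf.continuous n x)
    (integrable_bump_mul hf.continuous n x')]
  have hint : Integrable ((bump E n).normed μ) μ := (bump E n).integrable_normed
  rw [← Real.norm_eq_abs]
  calc ‖∫ y, ((bump E n).normed μ y * f (x - y) - (bump E n).normed μ y * f (x' - y)) ∂μ‖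
      ≤ ∫ y, (bump E n).normed μ y * (K * dist x x') ∂μ := by
        refine norm_integral_le_of_norm_le (hint.mul_const _) (Eventually.of_forall fun y => ?_)
        rw [← mul_sub, norm_mul, Real.norm_of_nonneg ((bump E n).nonneg_normed y)]
        refine mul_le_mul_of_nonneg_left ?_ ((bump E n).nonneg_normed y)
        have := hf.dist_le_mul (x - y) (x' - y)
        rwa [dist_sub_right, dist_eq_norm] at this
    _ = K * dist x x' := by rw [integral_mul_const, (bump E n).integral_normed, one_mul]

/-- The derivative falls on `f` rather than on the bump: the difference quotients of `f` in
direction `v` are bounded by `K * ‖v‖`, and their limit exists almost everywhere by Rademacher's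
theorem. -/
theorem fderiv_mollify (hf : LipschitzWith K f) (n : ℕ) (x v : E) :
    fderiv ℝ (mollify μ n f) x v = mollify μ n (fun z => lineDeriv ℝ f z v) x := by
  have hd : DifferentiableAt ℝ (mollify μ n f) x :=
    (contDiff_mollify hf.continuous n).differentiable (by simp) x
  rw [← hd.lineDeriv_eq_fderiv]
  have hbi : Integrable ((bump E n).normed μ) μ := (bump E n).integrable_normed
  have key := hasDerivAt_integral_of_dominated_loc_of_lip (μ := μ) (𝕜 := ℝ)
    (F := fun s y => (bump E n).normed μ y * f (x + s • v - y))
    (F' := fun y => (bump E n).normed μ y * lineDeriv ℝ f (x - y) v)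
    (bound := fun y => (bump E n).normed μ y * (K * ‖v‖)) (x₀ := 0) (s := univ) univ_mem
    (Eventually.of_forall fun s => (integrable_bump_mul hf.continuous n (x + s • v)).1)
    (integrable_bump_mul hf.continuous n _) ?_ ?_ (hbi.mul_const _) ?_
  · exact key.2.deriv
  · exact (hbi.1).mul
      ((measurable_lineDeriv hf.continuous (v := v)).comp (measurable_const.sub measurable_id)).aestronglyMeasurable
  · refine Eventually.of_forall fun y => LipschitzOnWith.of_dist_le_mul fun s _ s' _ => ?_
    rw [Real.dist_eq, ← mul_sub, abs_mul, abs_of_nonneg ((bump E n).nonneg_normed y)]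
    have h1 := hf.dist_le_mul (x + s • v - y) (x + s' • v - y)
    rw [dist_sub_right, dist_add_left, dist_eq_norm (s • v), ← sub_smul, norm_smul, Real.dist_eq,
      Real.norm_eq_abs] at h1
    have h2 : (0 : ℝ) ≤ (bump E n).normed μ y * (K * ‖v‖) :=
      mul_nonneg ((bump E n).nonneg_normed y) (by positivity)
    rw [Real.coe_nnabs, abs_of_nonneg h2, Real.dist_eq]
    calc _ ≤ (bump E n).normed μ y * (K * (|s - s'| * ‖v‖)) :=
          mul_le_mul_of_nonneg_left h1 ((bump E n).nonneg_normed y)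
      _ = _ := by ring
  · have h := hf.ae_lineDifferentiableAt (μ := μ) v
    have hq : Measure.QuasiMeasurePreserving (fun y => x - y) μ μ :=
      (Measure.measurePreserving_sub_left μ x).quasiMeasurePreserving
    filter_upwards [hq.ae h] with y hy
    have h1 : HasDerivAt (fun s : ℝ => f (x - y + s • v)) (lineDeriv ℝ f (x - y) v) 0 :=
      hy.hasLineDerivAt
    have h2 := h1.const_mul ((bump E n).normed μ y)
    refine h2.congr_of_eventuallyEq (Eventually.of_forall fun s => ?_)
    simp only
    congr 2; abel

/-- By `fderiv_mollify` the left side is a mollification of the locally integrable directional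
derivative, and mollifications converge almost everywhere. The ratio 2 of the two radii in `bump` is
the uniform bound which that requires. -/
theorem ae_tendsto_fderiv_mollify (hf : LipschitzWith K f) (v : E) :
    ∀ᵐ x ∂μ, Tendsto (fun n => fderiv ℝ (mollify μ n f) x v) atTop (𝓝 (fderiv ℝ f x v)) := by
  have h1 := ContDiffBump.ae_convolution_tendsto_right_of_locallyIntegrable (μ := μ)
    (φ := fun n : ℕ => bump E n) (l := atTop) (K := 2)
    tendsto_one_div_add_atTop_nhds_zero_nat
    (Eventually.of_forall fun n => le_of_eq (by simp only [bump]; field_simp))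
    (hf.locallyIntegrable_lineDeriv (μ := μ) v)
  filter_upwards [h1, hf.ae_differentiableAt (μ := μ)] with x hx hd
  rw [← hd.lineDeriv_eq_fderiv]
  refine hx.congr fun n => ?_
  rw [fderiv_mollify hf, mollify_eq_convolution]

theorem mollify_eq_zero {x : E} {n : ℕ} (h : ∀ y ∈ Metric.ball x (1 / ((n : ℝ) + 1)), f y = 0) :
    mollify μ n f x = 0 := by
  rw [mollify, ← integral_zero E ℝ (μ := μ)]
  refine integral_congr_ae (Eventually.of_forall fun y => ?_)
  by_cases hy : y ∈ Metric.ball (0 : E) (1 / ((n : ℝ) + 1))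
  · have : f (x - y) = 0 := h _ (by simpa [dist_eq_norm] using hy)
    simp [this]
  · have : (bump E n).normed μ y = 0 := by
      have hs := (bump E n).support_normed_eq (μ := μ)
      by_contra hne
      exact hy (hs ▸ (Function.mem_support.2 hne : y ∈ _))
    simp [this]

end Mollify

instance isAddHaarMeasure_plane : (volume : Measure (ℝ × ℝ)).IsAddHaarMeasure := by
  rw [Measure.volume_eq_prod]; infer_instance

instance isAddHaarMeasure_space : (volume : Measure (ℝ × ℝ × ℝ)).IsAddHaarMeasure := by
  rw [Measure.volume_eq_prod]; infer_instance

/-- The lift of a function on `ℝ × 𝕋²` to `ℝ × ℝ²`. -/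
def lift (φ : ℝ → T2 → ℝ) (z : ℝ × ℝ × ℝ) : ℝ := φ z.1 (mk2 z.2)

/-- The representative in `ℝ × [0,1)²` of a point of `ℝ × 𝕋²`. -/
def pt (z : ℝ × T2) : ℝ × ℝ × ℝ := (z.1, rep2 z.2)

/-- Space-time derivative of `φ` in the direction `(1, v)`. -/
def material (φ : ℝ → T2 → ℝ) (z : ℝ × T2) (v : ℝ × ℝ) : ℝ :=
  dtime φ z.1 z.2 + (v.1 * dfst φ z.1 z.2 + v.2 * dsnd φ z.1 z.2)

theorem hasDerivAt_lift {φ : ℝ → T2 → ℝ} {z : ℝ × ℝ × ℝ} (h : DifferentiableAt ℝ (lift φ) z)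
    {c : ℝ → ℝ × ℝ × ℝ} {c' : ℝ × ℝ × ℝ} {s : ℝ} (hc : HasDerivAt c c' s) (hs : c s = z) :
    HasDerivAt (fun r => lift φ (c r)) (fderiv ℝ (lift φ) z c') s := by
  subst hs
  exact h.hasFDerivAt.comp_hasDerivAt s hc

theorem dtime_eq {φ : ℝ → T2 → ℝ} {t : ℝ} {q : ℝ × ℝ} (h : DifferentiableAt ℝ (lift φ) (t, q)) :
    dtime φ t (mk2 q) = fderiv ℝ (lift φ) (t, q) (1, 0) :=
  (hasDerivAt_lift h ((hasDerivAt_id t).prodMk (hasDerivAt_const t q)) rfl).deriv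

theorem dfst_eq {φ : ℝ → T2 → ℝ} {t : ℝ} {q : ℝ × ℝ} (h : DifferentiableAt ℝ (lift φ) (t, q)) :
    dfst φ t (mk2 q) = fderiv ℝ (lift φ) (t, q) (0, (1, 0)) :=
  (hasDerivAt_lift h (c := fun s => (t, (q.1 + s, q.2)))
    ((hasDerivAt_const (0 : ℝ) t).prodMk (((hasDerivAt_id (0 : ℝ)).const_add q.1).prodMk
      (hasDerivAt_const (0 : ℝ) q.2))) (by simp)).deriv

theorem dsnd_eq {φ : ℝ → T2 → ℝ} {t : ℝ} {q : ℝ × ℝ} (h : DifferentiableAt ℝ (lift φ) (t, q)) :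
    dsnd φ t (mk2 q) = fderiv ℝ (lift φ) (t, q) (0, (0, 1)) :=
  (hasDerivAt_lift h (c := fun s => (t, (q.1, q.2 + s)))
    ((hasDerivAt_const (0 : ℝ) t).prodMk ((hasDerivAt_const (0 : ℝ) q.1).prodMk
      ((hasDerivAt_id (0 : ℝ)).const_add q.2))) (by simp)).deriv

theorem material_eq {φ : ℝ → T2 → ℝ} {t : ℝ} {q : ℝ × ℝ} (h : DifferentiableAt ℝ (lift φ) (t, q))
    (v : ℝ × ℝ) : material φ (t, mk2 q) v = fderiv ℝ (lift φ) (t, q) (1, v) := by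
  have e : ((1 : ℝ), v) = (1, 0) + v.1 • ((0 : ℝ), ((1 : ℝ), (0 : ℝ))) +
      v.2 • ((0 : ℝ), ((0 : ℝ), (1 : ℝ))) := by
    simp
  rw [material, dtime_eq h, dfst_eq h, dsnd_eq h, e, map_add, map_add, map_smul, map_smul,
    smul_eq_mul, smul_eq_mul, add_assoc]

theorem material_eq_pt {φ : ℝ → T2 → ℝ} {z : ℝ × T2} (h : DifferentiableAt ℝ (lift φ) (pt z))
    (v : ℝ × ℝ) : material φ z v = fderiv ℝ (lift φ) (pt z) (1, v) := by
  have := material_eq h v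
  rwa [mk2_rep2] at this

theorem abs_material_le {φ : ℝ → T2 → ℝ} {K : ℝ≥0} (hφ : LipschitzWith K (lift φ)) {z : ℝ × T2}
    (h : DifferentiableAt ℝ (lift φ) (pt z)) {v : ℝ × ℝ} (hv : ‖v‖ ≤ 1) :
    |material φ z v| ≤ K := by
  rw [material_eq_pt h, ← Real.norm_eq_abs]
  refine (ContinuousLinearMap.le_opNorm _ _).trans ?_
  have h1 : ‖((1 : ℝ), v)‖ ≤ 1 := by simp [Prod.norm_def] at hv ⊢; exact hv
  calc _ ≤ (K : ℝ) * 1 := mul_le_mul (norm_fderiv_le_of_lipschitz ℝ hφ) h1 (norm_nonneg _) K.2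
    _ = K := mul_one _

theorem measurePreserving_pt (a b : ℝ) : MeasurePreserving pt (stMeasure a b)
    ((volume : Measure (ℝ × ℝ × ℝ)).restrict (Icc a b ×ˢ unitSq)) := by
  have h := (MeasurePreserving.id ((volume : Measure ℝ).restrict (Icc a b))).prod
    measurePreserving_rep2
  rw [Measure.prod_restrict] at h
  exact h

theorem ae_pt {a b : ℝ} {p : ℝ × ℝ × ℝ → Prop} (h : ∀ᵐ z, p z) :
    ∀ᵐ z ∂(stMeasure a b), p (pt z) :=
  (measurePreserving_pt a b).quasiMeasurePreserving.ae (ae_restrict_of_ae h)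

/-- If the weak formulation with zero data holds for smooth test functions, then it does for
Lipschitz ones. -/
theorem weak_lipschitz {T : ℝ} {u : ℝ × T2 → ℝ × ℝ} {w : ℝ × T2 → ℝ}
    (hu : ∀ᵐ z ∂(stMeasure 0 T), ‖u z‖ ≤ 1)
    (hum : AEStronglyMeasurable u (stMeasure 0 T))
    (hw : Integrable w (stMeasure 0 T))
    (hweak : ∀ φ : ℝ → T2 → ℝ, IsTest T φ → ∫ z, w z * material φ z (u z) ∂(stMeasure 0 T) = 0)
    {φ : ℝ → T2 → ℝ} {K : ℝ≥0} (hφ : LipschitzWith K (lift φ)) {T' : ℝ} (hT' : T' < T)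
    (hφ0 : ∀ t, T' ≤ t → ∀ x, φ t x = 0) :
    ∫ z, w z * fderiv ℝ (lift φ) (pt z) (1, u z) ∂(stMeasure 0 T) = 0 := by
  set Ψ : ℕ → ℝ × ℝ × ℝ → ℝ := fun n => mollify volume n (lift φ) with hΨ
  -- Mollification commutes with integer translations, so the mollified lift is again the lift of a
  -- function on the torus.
  have hper : ∀ n t (q : ℝ × ℝ), Ψ n (t, rep2 (mk2 q)) = Ψ n (t, q) := fun n t q => by
    simp only [hΨ, mollify]
    congr 1
    ext y
    congr 1
    simp only [lift, Prod.fst_sub, Prod.snd_sub, mk2_sub, mk2_rep2]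
  set φn : ℕ → ℝ → T2 → ℝ := fun n t x => Ψ n (t, rep2 x) with hφn
  have hlift : ∀ n, lift (φn n) = Ψ n := fun n => funext fun z => hper n z.1 z.2
  have hsm : ∀ n, ContDiff ℝ ∞ (Ψ n) := fun n => contDiff_mollify hφ.continuous n
  have hdiff : ∀ n z, DifferentiableAt ℝ (lift (φn n)) z := fun n z => by
    rw [hlift]; exact (hsm n).differentiable (by simp) z
  have hLip : ∀ n, LipschitzWith K (lift (φn n)) := fun n => by
    rw [hlift]; exact lipschitzWith_mollify hφ n
  have htest : ∀ᶠ n in atTop, IsTest T (φn n) := by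
    have : ∀ᶠ n : ℕ in atTop, 1 / ((n : ℝ) + 1) < (T - T') / 2 :=
      tendsto_one_div_add_atTop_nhds_zero_nat.eventually (Iio_mem_nhds (by linarith))
    filter_upwards [this] with n hn
    refine ⟨?_, (T + T') / 2, by linarith, fun t ht x => mollify_eq_zero fun y hy => ?_⟩
    · have := hsm n
      rw [← hlift] at this
      exact this
    · refine hφ0 _ ?_ _
      rw [Metric.mem_ball, dist_eq_norm] at hy
      have h1 : |y.1 - t| < 1 / ((n : ℝ) + 1) :=
        lt_of_le_of_lt (norm_fst_le (y - (t, rep2 x))) hy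
      have := (abs_lt.1 h1).1
      linarith
  have hzero : ∀ᶠ n in atTop, ∫ z, w z * material (φn n) z (u z) ∂(stMeasure 0 T) = 0 := by
    filter_upwards [htest] with n hn using hweak _ hn
  have hlim : Tendsto (fun n => ∫ z, w z * material (φn n) z (u z) ∂(stMeasure 0 T)) atTop
      (𝓝 (∫ z, w z * fderiv ℝ (lift φ) (pt z) (1, u z) ∂(stMeasure 0 T))) := by
    refine tendsto_integral_of_dominated_convergence (fun z => |w z| * K) (fun n => ?_)
      (hw.abs.mul_const _) (fun n => ?_) ?_
    · refine hw.1.mul ?_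
      have h1 : ∀ z, material (φn n) z (u z) = fderiv ℝ (Ψ n) (pt z) (1, u z) := fun z => by
        rw [material_eq_pt (hdiff n _), hlift]
      simp only [h1]
      have hc : Continuous fun p : (ℝ × ℝ × ℝ) × (ℝ × ℝ × ℝ) => fderiv ℝ (Ψ n) p.1 p.2 :=
        (hsm n).continuous_fderiv_apply (by simp)
      exact hc.comp_aestronglyMeasurable
        (((measurePreserving_pt 0 T).measurable.aestronglyMeasurable).prodMk
          (aestronglyMeasurable_const.prodMk hum))
    · filter_upwards [hu] with z hz
      rw [norm_mul, Real.norm_eq_abs, Real.norm_eq_abs]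
      exact mul_le_mul_of_nonneg_left (abs_material_le (hLip n) (hdiff n _) hz) (abs_nonneg _)
    -- Almost everywhere convergence is known for one fixed direction at a time, whereas the
    -- direction `(1, u z)` depends on the point. It is decomposed into three fixed directions.
    · have hb : ∀ v : ℝ × ℝ × ℝ, ∀ᵐ z ∂(stMeasure 0 T),
          Tendsto (fun n => fderiv ℝ (Ψ n) (pt z) v) atTop (𝓝 (fderiv ℝ (lift φ) (pt z) v)) :=
        fun v => ae_pt (ae_tendsto_fderiv_mollify hφ v)
      filter_upwards [hb (1, 0), hb (0, (1, 0)), hb (0, (0, 1))] with z h1 h2 h3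
      refine Tendsto.const_mul _ ?_
      have e : ∀ v : ℝ × ℝ, ((1 : ℝ), v) = (1, 0) + v.1 • ((0 : ℝ), ((1 : ℝ), (0 : ℝ))) +
          v.2 • ((0 : ℝ), ((0 : ℝ), (1 : ℝ))) := by
        simp
      have h4 : ∀ n, material (φn n) z (u z) = fderiv ℝ (Ψ n) (pt z) (1, u z) := fun n => by
        rw [material_eq_pt (hdiff n _), hlift]
      simp only [h4]
      rw [e (u z)]
      simp only [map_add, map_smul]
      exact (h1.add (h2.const_smul _)).add (h3.const_smul _)
  exact tendsto_nhds_unique hlim (tendsto_const_nhds.congr' (hzero.mono fun n h => h.symm))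

/-! ### Uniqueness along one autonomous field -/

theorem dist_space (a b : ℝ) (p q : ℝ × ℝ) : dist (a, p) (b, q) = max (dist a b) (dist p q) := rfl

/-- If both points have the same integer part, the bound for `G` applies directly. Otherwise shift
both by either of the two integer parts: each time one of the points leaves the unit square, where
`G` is zero. The two comparisons with zero account for the factor 2. -/
theorem lipschitzWith_lift_of_support {G : ℝ × ℝ × ℝ → ℝ} {K : ℝ≥0} (hG : LipschitzWith K G)
    (h0 : ∀ t, ∀ q ∉ unitSq, G (t, q) = 0) :
    LipschitzWith (2 * K) (lift fun t x => G (t, rep2 x)) := by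
  refine LipschitzWith.of_dist_le_mul ?_
  rintro ⟨t, q⟩ ⟨t', q'⟩
  simp only [lift]
  set n := q - rep2 (mk2 q) with hn
  set n' := q' - rep2 (mk2 q') with hn'
  have hmk : mk2 n = 0 := by rw [hn, mk2_sub, mk2_rep2, sub_self]
  have hmk' : mk2 n' = 0 := by rw [hn', mk2_sub, mk2_rep2, sub_self]
  have e : rep2 (mk2 q) = q - n := by rw [hn]; abel
  have e' : rep2 (mk2 q') = q' - n' := by rw [hn']; abel
  have hd : ∀ m : ℝ × ℝ, dist (G (t, q - m)) (G (t', q' - m)) ≤ K * dist (t, q) (t', q') :=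
    fun m => by
      refine (hG.dist_le_mul _ _).trans (le_of_eq ?_)
      rw [dist_space, dist_space, dist_sub_right]
  rw [e, e']
  have hK : 0 ≤ (K : ℝ) * dist (t, q) (t', q') := by positivity
  push_cast
  by_cases hnn : n = n'
  · rw [← hnn]; linarith [hd n]
  · have z1 : G (t', q' - n) = 0 := h0 _ _ fun hmem => hnn (by
      have := rep2_mk2 hmem
      rw [mk2_sub, hmk, sub_zero, e'] at this
      exact (sub_right_injective this).symm)
    have z2 : G (t, q - n') = 0 := h0 _ _ fun hmem => hnn (by
      have := rep2_mk2 hmem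
      rw [mk2_sub, hmk', sub_zero, e] at this
      exact sub_right_injective this)
    have h1 := hd n
    have h2 := hd n'
    rw [z1] at h1
    rw [z2] at h2
    have := dist_triangle (G (t, q - n)) 0 (G (t', q' - n'))
    linarith

/-- Primitive in time of a compactly supported function. -/
def timePrim (a b : ℝ) (g : ℝ × ℝ × ℝ → ℝ) (z : ℝ × ℝ × ℝ) : ℝ :=
  -∫ σ in (max a (min z.1 b))..b, g (σ, z.2)

theorem exists_lipschitz_timePrim {a b : ℝ} (hab : a < b) {g : ℝ × ℝ × ℝ → ℝ}
    (hg : ContDiff ℝ ∞ g) (hgc : HasCompactSupport g) :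
    ∃ K : ℝ≥0, LipschitzWith K (timePrim a b g) := by
  obtain ⟨Lg, hLg⟩ := hg.lipschitzWith_of_hasCompactSupport hgc (by simp)
  obtain ⟨M, hM⟩ := hg.continuous.bounded_above_of_compact_support hgc
  have hM0 : 0 ≤ M := (norm_nonneg _).trans (hM 0)
  have hb0 : 0 ≤ b - a := by linarith
  refine ⟨(M + (b - a) * Lg).toNNReal, LipschitzWith.of_dist_le_mul ?_⟩
  rintro ⟨s, q⟩ ⟨s', q'⟩
  rw [Real.coe_toNNReal _ (by positivity)]
  simp only [timePrim, dist_neg_neg]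
  set c := max a (min s b)
  set c' := max a (min s' b)
  have hcc : |c - c'| ≤ |s - s'| := by
    refine (abs_max_sub_max_le_max _ _ _ _).trans ?_
    rw [sub_self, abs_zero]
    refine max_le (abs_nonneg _) ?_
    refine (abs_min_sub_min_le_max _ _ _ _).trans ?_
    rw [sub_self, abs_zero]
    exact max_le le_rfl (abs_nonneg _)
  have hcb : |b - c| ≤ b - a := by
    have h1 : a ≤ c := le_max_left _ _
    have h2 : c ≤ b := max_le hab.le (min_le_right _ _)
    rw [abs_of_nonneg (by linarith)]; linarith
  have hint : ∀ (p : ℝ × ℝ) (x y : ℝ), IntervalIntegrable (fun σ => g (σ, p)) volume x y :=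
    fun p x y => (hg.continuous.comp (by fun_prop : Continuous fun σ : ℝ => (σ, p))).intervalIntegrable
      _ _
  have h1 : ‖(∫ σ in c..b, g (σ, q)) - ∫ σ in c..b, g (σ, q')‖ ≤ Lg * ‖q - q'‖ * |b - c| := by
    rw [← intervalIntegral.integral_sub (hint _ _ _) (hint _ _ _)]
    refine intervalIntegral.norm_integral_le_of_norm_le_const fun σ _ => ?_
    have := hLg.dist_le_mul (σ, q) (σ, q')
    rw [dist_eq_norm] at this
    refine this.trans (le_of_eq ?_)
    rw [Prod.dist_eq]; simp [dist_eq_norm]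
  have h2 : ‖(∫ σ in c..b, g (σ, q')) - ∫ σ in c'..b, g (σ, q')‖ ≤ M * |c' - c| := by
    rw [intervalIntegral.integral_interval_sub_interval_comm (hint _ _ _) (hint _ _ _)
      (hint _ _ _), intervalIntegral.integral_same, sub_zero]
    exact intervalIntegral.norm_integral_le_of_norm_le_const fun σ _ => hM _
  have hq : ‖q - q'‖ ≤ dist (s, q) (s', q') := by
    rw [Prod.dist_eq, ← dist_eq_norm]; exact le_max_right _ _
  have hs : |s - s'| ≤ dist (s, q) (s', q') := by
    rw [Prod.dist_eq, ← Real.dist_eq]; exact le_max_left _ _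
  have hd := dist_triangle (∫ σ in c..b, g (σ, q)) (∫ σ in c..b, g (σ, q')) (∫ σ in c'..b, g (σ, q'))
  rw [dist_eq_norm (∫ σ in c..b, g (σ, q)) (∫ σ in c..b, g (σ, q')),
    dist_eq_norm (∫ σ in c..b, g (σ, q')) ] at hd
  have h3 : (Lg : ℝ) * ‖q - q'‖ * |b - c| ≤ Lg * dist (s, q) (s', q') * (b - a) := by gcongr
  have h4 : M * |c' - c| ≤ M * dist (s, q) (s', q') := by
    rw [abs_sub_comm]
    exact mul_le_mul_of_nonneg_left (hcc.trans hs) hM0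
  calc _ ≤ _ := hd
    _ ≤ Lg * dist (s, q) (s', q') * (b - a) + M * dist (s, q) (s', q') := by linarith
    _ = _ := by ring

theorem hasDerivAt_timePrim {a b : ℝ} {g : ℝ × ℝ × ℝ → ℝ} (hg : Continuous g) {s : ℝ}
    (hs : s ∈ Ioo a b) (q : ℝ × ℝ) : HasDerivAt (fun s => timePrim a b g (s, q)) (g (s, q)) s := by
  have hc : Continuous fun σ : ℝ => g (σ, q) := hg.comp (by fun_prop)
  have h1 : HasDerivAt (fun c => ∫ σ in c..b, g (σ, q)) (-g (s, q)) s :=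
    intervalIntegral.integral_hasDerivAt_left (hc.intervalIntegrable _ _)
      hc.stronglyMeasurable.stronglyMeasurableAtFilter hc.continuousAt
  have h2 := h1.neg
  rw [neg_neg] at h2
  refine h2.congr_of_eventuallyEq ?_
  filter_upwards [isOpen_Ioo.mem_nhds hs] with r hr
  simp only [timePrim, min_eq_left hr.2.le, max_eq_right hr.1.le, Pi.neg_apply]

/-- A weak solution with zero data that vanishes before time `a` also vanishes during `(a,b)` on
an open set `B` which is invariant under a Lipschitz, area preserving flow `Y` along the field. -/
theorem eq_zero_on_invariant {T a b : ℝ} {u : ℝ × T2 → ℝ × ℝ} {w : ℝ × T2 → ℝ}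
    (hu : ∀ᵐ z ∂(stMeasure 0 T), ‖u z‖ ≤ 1)
    (hum : AEStronglyMeasurable u (stMeasure 0 T))
    (hw : Integrable w (stMeasure 0 T))
    (hweak : ∀ φ : ℝ → T2 → ℝ, IsTest T φ → ∫ z, w z * material φ z (u z) ∂(stMeasure 0 T) = 0)
    (ha : 0 ≤ a) (hab : a < b) (hbT : b ≤ T)
    (hwa : ∀ᵐ z ∂(stMeasure 0 T), z.1 < a → w z = 0)
    {B : Set (ℝ × ℝ)} (hBo : IsOpen B) (hB : B ⊆ unitSq) (hBf : volume (frontier B) = 0)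
    {Y : ℝ → ℝ × ℝ → ℝ × ℝ} (hYm : Measurable fun z : ℝ × ℝ × ℝ => Y z.1 z.2)
    (hYp : ∀ s, MeasurePreserving (Y s) volume volume)
    (hYi : ∀ s q, Y s (Y (-s) q) = q) (hYB : ∀ s q, Y s q ∈ B ↔ q ∈ B)
    {K : ℝ} (hYL : ∀ s s' q q', q ∈ B → ‖Y s q - Y s' q'‖ ≤ K * ‖(s, q) - (s', q')‖)
    {v : ℝ × ℝ → ℝ × ℝ} (hv : Measurable v)
    (hYd : ∀ q ∈ B, ∀ᵐ s, HasDerivAt (fun s => Y s q) (v (Y s q)) s)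
    (huv : ∀ᵐ z ∂(stMeasure 0 T), z.1 ∈ Ioo a b → rep2 z.2 ∈ B → u z = v (rep2 z.2)) :
    ∀ᵐ z ∂(stMeasure 0 T), z.1 ∈ Ioo a b → rep2 z.2 ∈ B → w z = 0 := by
  have hYi' : ∀ s q, Y (-s) (Y s q) = q := fun s q => by
    have := hYi (-s) q; rwa [neg_neg] at this
  -- the flow on space-time
  have hm1 : Measurable fun z : ℝ × ℝ × ℝ => (z.1, Y z.1 z.2) := measurable_fst.prodMk hYm
  have hm2 : Measurable fun z : ℝ × ℝ × ℝ => (z.1, Y (-z.1) z.2) :=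
    measurable_fst.prodMk (hYm.comp (measurable_fst.neg.prodMk measurable_snd))
  let S : (ℝ × ℝ × ℝ) ≃ᵐ (ℝ × ℝ × ℝ) :=
    { toFun := fun z => (z.1, Y z.1 z.2)
      invFun := fun z => (z.1, Y (-z.1) z.2)
      left_inv := fun z => Prod.ext rfl (hYi' _ _)
      right_inv := fun z => Prod.ext rfl (hYi _ _)
      measurable_toFun := hm1
      measurable_invFun := hm2 }
  have hS : ∀ z, S z = (z.1, Y z.1 z.2) := fun _ => rfl
  have hSs : ∀ z, S.symm z = (z.1, Y (-z.1) z.2) := fun _ => rfl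
  have hSp : MeasurePreserving S volume volume := by
    have := (MeasurePreserving.id (volume : Measure ℝ)).skew_product (g := Y) hYm
      (Eventually.of_forall fun s => (hYp s).map_eq)
    exact this
  have hSsp : MeasurePreserving S.symm volume volume := hSp.symm S
  set U : Set (ℝ × ℝ × ℝ) := Ioo a b ×ˢ B with hU
  have hUo : IsOpen U := isOpen_Ioo.prod hBo
  have hUm := hUo.measurableSet
  have hSU : ∀ z, S z ∈ U ↔ z ∈ U := fun z => by
    simp only [hU, mem_prod, hS, hYB]
  have hUsub : U ⊆ Icc 0 T ×ˢ unitSq := fun z hz =>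
    ⟨⟨ha.trans hz.1.1.le, hz.1.2.le.trans hbT⟩, hB hz.2⟩
  set W : ℝ × ℝ × ℝ → ℝ := fun z => w (z.1, mk2 z.2) with hW
  have hWpt : ∀ z, W (pt z) = w z := fun z => by simp [hW, pt, mk2_rep2]
  have hpt := measurePreserving_pt 0 T
  have hmkp : MeasurePreserving (fun z : ℝ × ℝ × ℝ => (z.1, mk2 z.2))
      ((volume : Measure (ℝ × ℝ × ℝ)).restrict (Icc 0 T ×ˢ unitSq)) (stMeasure 0 T) := by
    have h := (MeasurePreserving.id ((volume : Measure ℝ).restrict (Icc 0 T))).prod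
      measurePreserving_mk2
    rw [Measure.prod_restrict] at h
    exact h
  have hWi : IntegrableOn W (Icc 0 T ×ˢ unitSq) := hmkp.integrable_comp_of_integrable hw
  have hWU : IntegrableOn W U := hWi.mono_set hUsub
  have hWS : IntegrableOn (W ∘ S) U := by
    have h1 : S ⁻¹' U = U := by ext z; exact hSU z
    have h2 := hSp.integrableOn_comp_preimage (f := W) (s := U) S.measurableEmbedding
    rw [h1] at h2
    exact h2.2 hWU
  -- The duality step. Given `g` supported in `U`, a test function whose material derivative is `g ∘
  -- S⁻¹` on `U` turns the weak formulation into the integral of `g` against `W ∘ S`. Since `g` is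
  -- arbitrary, `W ∘ S` vanishes on `U`.
  have key : ∀ g : ℝ × ℝ × ℝ → ℝ, ContDiff ℝ ∞ g → HasCompactSupport g → tsupport g ⊆ U →
      ∫ z, g z • (W ∘ S) z = 0 := by
    intro g hg hgc hgU
    have hg0 : ∀ z ∉ U, g z = 0 := fun z hz => image_eq_zero_of_notMem_tsupport fun h => hz (hgU h)
    -- a time after which `g` vanishes
    obtain ⟨b', hb'a, hb'b, hb'⟩ : ∃ b', a < b' ∧ b' < b ∧ ∀ z : ℝ × ℝ × ℝ, b' ≤ z.1 → g z = 0 := by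
      rcases (tsupport g).eq_empty_or_nonempty with he | hne
      · refine ⟨(a + b) / 2, by linarith, by linarith, fun z _ => ?_⟩
        exact image_eq_zero_of_notMem_tsupport (by simp [he])
      · obtain ⟨z₀, hz₀, hmax⟩ := hgc.isCompact.exists_isMaxOn hne continuous_fst.continuousOn
        have hz₀U := (hgU hz₀).1
        refine ⟨(z₀.1 + b) / 2, by linarith [hz₀U.1, hz₀U.2], by linarith [hz₀U.2],
          fun z hz => image_eq_zero_of_notMem_tsupport fun h => ?_⟩
        have : z.1 ≤ z₀.1 := hmax h
        linarith [hz₀U.2]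
    obtain ⟨K₁, hK₁⟩ := exists_lipschitz_timePrim hab hg hgc
    -- In the coordinates of the flow the adjoint problem is `∂ₜ G = g`. `G` vanishes from time `b'`
    -- on, as a test function must. Before `a` it is merely frozen, which is harmless because `w` is
    -- zero there.
    set G := timePrim a b g with hG
    have hGB : ∀ t, ∀ q ∉ B, G (t, q) = 0 := fun t q hq => by
      have : ∀ σ, g (σ, q) = 0 := fun σ => hg0 _ fun h => hq h.2
      simp [hG, timePrim, this]
    have hGt : ∀ t, b' ≤ t → ∀ q, G (t, q) = 0 := fun t ht q => by
      rw [hG, timePrim, neg_eq_zero]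
      have h1 : max a (min t b) ≤ b := max_le hab.le (min_le_right _ _)
      have h2 : b' ≤ max a (min t b) := le_max_of_le_right (le_min ht hb'b.le)
      rw [intervalIntegral.integral_congr (g := fun _ => (0 : ℝ)), intervalIntegral.integral_zero]
      intro σ hσ
      rw [uIcc_of_le h1] at hσ
      exact hb' _ (h2.trans hσ.1)
    -- Transported back by the flow, the solution is no longer smooth, but Lipschitz because the
    -- flow is; `weak_lipschitz` admits it. Invariance of `B` makes it vanish off `B`, so it extends
    -- by zero across the boundary.
    set Φ : ℝ × ℝ × ℝ → ℝ := fun z => G (z.1, Y (-z.1) z.2) with hΦ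
    have hΦB : ∀ t, ∀ q ∉ B, Φ (t, q) = 0 := fun t q hq => hGB _ _ (by rwa [hYB])
    have hK1 : (0 : ℝ) ≤ max 1 K := le_max_of_le_left zero_le_one
    have hΦL : LipschitzWith (K₁ * (max 1 K).toNNReal) Φ := by
      have aux : ∀ t t' q q', q ∈ B → dist (Φ (t, q)) (Φ (t', q')) ≤
          K₁ * (max 1 K * dist (t, q) (t', q')) := fun t t' q q' hq => by
        refine (hK₁.dist_le_mul _ _).trans ?_
        refine mul_le_mul_of_nonneg_left ?_ K₁.2
        rw [Prod.dist_eq]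
        refine max_le ?_ ?_
        · calc dist t t' ≤ dist (t, q) (t', q') := le_max_left _ _
            _ ≤ _ := le_mul_of_one_le_left dist_nonneg (le_max_left _ _)
        · rw [dist_eq_norm]
          refine (hYL (-t) (-t') q q' hq).trans ?_
          have e : ‖(-t, q) - (-t', q')‖ = dist (t, q) (t', q') := by
            rw [← dist_eq_norm, dist_space, dist_space, dist_neg_neg]
          rw [e]
          exact mul_le_mul_of_nonneg_right (le_max_right _ _) dist_nonneg
      refine LipschitzWith.of_dist_le_mul ?_
      rintro ⟨t, q⟩ ⟨t', q'⟩
      rw [NNReal.coe_mul, Real.coe_toNNReal _ hK1, mul_assoc]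
      by_cases hq : q ∈ B
      · exact aux _ _ _ _ hq
      · by_cases hq' : q' ∈ B
        · rw [dist_comm, dist_comm (t, q)]; exact aux _ _ _ _ hq'
        · rw [hΦB _ _ hq, hΦB _ _ hq', dist_self]; positivity
    have hLL := lipschitzWith_lift_of_support hΦL fun t q hq => hΦB t q fun h => hq (hB h)
    set φ : ℝ → T2 → ℝ := fun t x => Φ (t, rep2 x) with hφ
    have hφt : ∀ t, b' ≤ t → ∀ x, φ t x = 0 := fun t ht x => hGt t ht _
    have hzero := weak_lipschitz hu hum hw hweak hLL (hb'b.trans_le hbT) hφt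
    have hφΦ : ∀ t, ∀ q ∈ unitSq, lift φ (t, q) = Φ (t, q) := fun t q hq => by
      simp only [lift, hφ, rep2_mk2 hq]
    -- the material derivative
    have hfm : Measurable fun z : ℝ × ℝ × ℝ => fderiv ℝ (lift φ) z (1, v z.2) := by
      have h1 : Measurable (fderiv ℝ (lift φ)) := measurable_fderiv ℝ _
      have h2 : Continuous fun p : ((ℝ × ℝ × ℝ) →L[ℝ] ℝ) × (ℝ × ℝ × ℝ) => p.1 p.2 := by fun_prop
      exact h2.measurable.comp (h1.prodMk (measurable_const.prodMk (hv.comp measurable_snd)))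
    have hmat : ∀ᵐ z : ℝ × ℝ × ℝ, z ∈ U →
        fderiv ℝ (lift φ) z (1, v z.2) = g (z.1, Y (-z.1) z.2) := by
      have h1 : ∀ᵐ z : ℝ × ℝ × ℝ, z ∈ U →
          fderiv ℝ (lift φ) (S z) (1, v (S z).2) = g z := by
        have hd : ∀ᵐ z : ℝ × ℝ × ℝ, DifferentiableAt ℝ (lift φ) (S z) :=
          hSp.quasiMeasurePreserving.ae hLL.ae_differentiableAt
        have hdm : MeasurableSet {z : ℝ × ℝ × ℝ | DifferentiableAt ℝ (lift φ) (S z)} :=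
          S.measurable (measurableSet_of_differentiableAt ℝ (lift φ))
        have hset : MeasurableSet {z : ℝ × ℝ × ℝ | z ∈ U →
            fderiv ℝ (lift φ) (S z) (1, v (S z).2) = g z} :=
          MeasurableSet.imp (p := fun z => z ∈ U) hUm
            (measurableSet_eq_fun (hfm.comp S.measurable) hg.continuous.measurable)
        -- By Fubini, for almost every `q` the lift is differentiable at `(t, Y t q)` for almost
        -- every `t`. At such times the chain rule along the orbit computes the material derivative
        -- as the time derivative of `G` at fixed `q`.
        rw [Measure.volume_eq_prod] at hd ⊢
        rw [Measure.ae_prod_iff_ae_ae hset, Measure.ae_ae_comm hset]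
        rw [Measure.ae_prod_iff_ae_ae hdm, Measure.ae_ae_comm hdm] at hd
        filter_upwards [hd] with q hq
        by_cases hqB : q ∈ B
        · filter_upwards [hq, hYd q hqB] with t ht hYt htU
          have hc := hasDerivAt_lift ht (c := fun s => (s, Y s q))
            ((hasDerivAt_id t).prodMk hYt) rfl
          have hc2 := hasDerivAt_timePrim hg.continuous htU.1 q
          refine hc.unique (hc2.congr_of_eventuallyEq (Eventually.of_forall fun s => ?_))
          simp only
          rw [hφΦ _ _ (hB ((hYB s q).2 hqB))]
          simp only [hΦ, hYi', hG]
        · exact Eventually.of_forall fun t htU => absurd htU.2 hqB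
      have h2 := hSsp.quasiMeasurePreserving.ae h1
      filter_upwards [h2] with z hz hzU
      have h3 : S.symm z ∈ U := by rw [← hSU, S.apply_symm_apply]; exact hzU
      have := hz h3
      rwa [S.apply_symm_apply] at this
    -- the weak formulation reduces to the integral over `U`
    have hint : ∀ᵐ z ∂(stMeasure 0 T), w z * fderiv ℝ (lift φ) (pt z) (1, u z) =
        (U.indicator fun z => W z * g (S.symm z)) (pt z) := by
      have hn1 : ∀ᵐ z : ℝ × ℝ × ℝ, z.1 ≠ a ∧ z.1 ≠ b := by
        have : ∀ᵐ t : ℝ, t ≠ a ∧ t ≠ b :=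
          (Measure.ae_ne volume a).and (Measure.ae_ne volume b)
        exact Measure.quasiMeasurePreserving_fst.ae this
      have hn2 : ∀ᵐ z : ℝ × ℝ × ℝ, z.2 ∉ frontier B ∧ z.2 ∉ frontier unitSq := by
        have hf2 : volume (frontier unitSq) = 0 :=
          ((convex_Ico (0 : ℝ) 1).prod (convex_Ico (0 : ℝ) 1)).addHaar_frontier volume
        have : ∀ᵐ q : ℝ × ℝ, q ∉ frontier B ∧ q ∉ frontier unitSq :=
          (measure_eq_zero_iff_ae_notMem.1 hBf).and (measure_eq_zero_iff_ae_notMem.1 hf2)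
        exact Measure.quasiMeasurePreserving_snd.ae this
      filter_upwards [ae_pt hn1, ae_pt hn2, ae_pt hmat, hwa, huv] with z h1 h2 h3 h4 h5
      by_cases hzU : pt z ∈ U
      · rw [indicator_of_mem hzU, hWpt, h5 hzU.1 hzU.2]
        congr 1
        exact h3 hzU
      · rw [indicator_of_notMem hzU]
        rcases lt_trichotomy z.1 a with hlt | heq | hgt
        · rw [h4 hlt, zero_mul]
        · exact absurd heq h1.1
        -- Away from `U`, from times before `a` and from the null boundaries, the test function
        -- vanishes in a whole neighbourhood, hence so does its derivative.
        · suffices h : lift φ =ᶠ[𝓝 (pt z)] fun _ => 0 by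
            rw [h.fderiv_eq]; simp
          rcases lt_trichotomy z.1 b with hlt' | heq' | hgt'
          · have hq : rep2 z.2 ∉ B := fun h => hzU ⟨⟨hgt, hlt'⟩, h⟩
            have hq1 : rep2 z.2 ∈ interior unitSq := by
              by_contra hcon
              exact h2.2 ⟨subset_closure (rep2_mem _), hcon⟩
            have hq2 : rep2 z.2 ∉ closure B := fun hcon =>
              h2.1 ⟨hcon, by rwa [hBo.interior_eq]⟩
            have hnb : ∀ᶠ p in 𝓝 (pt z), p.2 ∈ interior unitSq ∩ (closure B)ᶜ :=
              continuous_snd.continuousAt.eventually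
                ((isOpen_interior.inter isClosed_closure.isOpen_compl).mem_nhds ⟨hq1, hq2⟩)
            filter_upwards [hnb] with p hp
            rw [show p = (p.1, p.2) from rfl, hφΦ _ _ (interior_subset hp.1)]
            exact hΦB _ _ fun h => hp.2 (subset_closure h)
          · exact absurd heq' h1.2
          · have hnb : ∀ᶠ p in 𝓝 (pt z), b < p.1 :=
              continuous_fst.continuousAt.eventually (Ioi_mem_nhds hgt')
            filter_upwards [hnb] with p hp
            exact hφt _ (hb'b.le.trans hp.le) _
    rw [integral_congr_ae hint] at hzero
    have hpe : ∀ F : ℝ × ℝ × ℝ → ℝ, AEStronglyMeasurable F (volume.restrict (Icc 0 T ×ˢ unitSq)) →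
        ∫ z, F (pt z) ∂(stMeasure 0 T) = ∫ z in Icc 0 T ×ˢ unitSq, F z := fun F hF => by
      rw [← hpt.map_eq] at hF ⊢
      exact (integral_map hpt.measurable.aemeasurable hF).symm
    rw [hpe, setIntegral_indicator hUm, inter_eq_right.2 hUsub, ← integral_indicator hUm,
      ← hSp.integral_comp S.measurableEmbedding] at hzero
    · rw [← hzero]
      refine integral_congr_ae (Eventually.of_forall fun z => ?_)
      by_cases hz : z ∈ U
      · have := (hSU z).2 hz
        simp only [indicator_of_mem this, S.symm_apply_apply, smul_eq_mul, Function.comp]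
        ring
      · have := mt (hSU z).1 hz
        simp only [indicator_of_notMem this, hg0 z hz, zero_smul]
    · exact (hWi.1.mul
        (hg.continuous.measurable.comp S.symm.measurable).aestronglyMeasurable).indicator hUm
  have hres := hUo.ae_eq_zero_of_integral_contDiff_smul_eq_zero hWS.locallyIntegrableOn key
  have hres2 := hSsp.quasiMeasurePreserving.ae hres
  filter_upwards [ae_pt hres2] with z hz h1 h2
  have hzU : pt z ∈ U := ⟨h1, h2⟩
  have h3 : S.symm (pt z) ∈ U := by rw [← hSU, S.apply_symm_apply]; exact hzU
  have := hz h3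
  rwa [Function.comp, S.apply_symm_apply, hWpt] at this

/-- A weak solution with zero data that vanishes before time `a` vanishes during `(a,b)` if the
flux does. -/
theorem eq_zero_of_flux_zero {T a b : ℝ} {u : ℝ × T2 → ℝ × ℝ} {w : ℝ × T2 → ℝ}
    (hu : ∀ᵐ z ∂(stMeasure 0 T), ‖u z‖ ≤ 1)
    (hum : AEStronglyMeasurable u (stMeasure 0 T))
    (hw : Integrable w (stMeasure 0 T))
    (hweak : ∀ φ : ℝ → T2 → ℝ, IsTest T φ → ∫ z, w z * material φ z (u z) ∂(stMeasure 0 T) = 0)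
    (ha : 0 ≤ a) (hab : a < b) (hbT : b ≤ T)
    (hwa : ∀ᵐ z ∂(stMeasure 0 T), z.1 < a → w z = 0)
    (huv : ∀ᵐ z ∂(stMeasure 0 T), z.1 ∈ Ioo a b → w z = 0 ∨ u z = 0) :
    ∀ᵐ z ∂(stMeasure 0 T), z.1 ∈ Ioo a b → w z = 0 := by
  classical
  -- As the product of `w` and `u` vanishes, replacing `u` by zero during `(a,b)` does not affect
  -- the weak formulation. The flow of the zero field is the identity, under which the whole open
  -- unit square is invariant.
  set u' : ℝ × T2 → ℝ × ℝ := (Prod.fst ⁻¹' Ioo a b)ᶜ.indicator u with hu'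
  have hms : MeasurableSet (Prod.fst ⁻¹' Ioo a b : Set (ℝ × T2)) :=
    measurable_fst measurableSet_Ioo
  set B : Set (ℝ × ℝ) := Ioo 0 1 ×ˢ Ioo 0 1 with hB
  have hmain := eq_zero_on_invariant (T := T) (a := a) (b := b) (u := u') (w := w)
    ?_ (hum.indicator hms.compl) hw ?_ ha hab hbT hwa (B := B) (isOpen_Ioo.prod isOpen_Ioo)
    (prod_mono Ioo_subset_Ico_self Ioo_subset_Ico_self)
    (((convex_Ioo (0 : ℝ) 1).prod (convex_Ioo (0 : ℝ) 1)).addHaar_frontier volume)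
    (Y := fun _ q => q) measurable_snd (fun s => MeasurePreserving.id _) (fun _ _ => rfl)
    (fun _ _ => Iff.rfl) (K := 1) (fun s s' q q' _ => by
      rw [one_mul]; exact norm_snd_le ((s, q) - (s', q'))) (v := fun _ => 0) measurable_const
    (fun q _ => Eventually.of_forall fun s => hasDerivAt_const s q) ?_
  · have hn : ∀ᵐ z : ℝ × ℝ × ℝ, z.2.1 ≠ 0 ∧ z.2.2 ≠ 0 := by
      have h1 : ∀ᵐ q : ℝ × ℝ, q.1 ≠ 0 ∧ q.2 ≠ 0 :=
        (Measure.quasiMeasurePreserving_fst.ae (Measure.ae_ne volume (0 : ℝ))).and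
          (Measure.quasiMeasurePreserving_snd.ae (Measure.ae_ne volume (0 : ℝ)))
      exact Measure.quasiMeasurePreserving_snd.ae h1
    filter_upwards [hmain, ae_pt hn] with z h1 h2 h3
    have hm := rep2_mem z.2
    exact h1 h3 ⟨⟨lt_of_le_of_ne hm.1.1 (Ne.symm h2.1), hm.1.2⟩,
      ⟨lt_of_le_of_ne hm.2.1 (Ne.symm h2.2), hm.2.2⟩⟩
  · filter_upwards [hu] with z hz
    rw [hu', indicator]
    split_ifs
    · exact hz
    · simp
  · intro φ hφ
    refine (integral_congr_ae ?_).trans (hweak φ hφ)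
    filter_upwards [huv] with z hz
    by_cases h : z.1 ∈ Ioo a b
    · rcases hz h with h0 | h0
      · simp [h0]
      · have : u' z = 0 := indicator_of_notMem (by simpa using h) _
        rw [this, h0]
    · have : u' z = u z := indicator_of_mem (by simpa using h) _
      rw [this]
  · refine Eventually.of_forall fun z hz _ => ?_
    exact indicator_of_notMem (fun h : z ∈ (Prod.fst ⁻¹' Ioo a b)ᶜ => h hz) _

theorem convex_box {w h : ℝ} (hw : 0 < w) (hh : 0 < h) (c : ℝ × ℝ) : Convex ℝ (box w h c) := by
  have : box w h c = Ioo (c.1 - w / 2) (c.1 + w / 2) ×ˢ Ioo (c.2 - h / 2) (c.2 + h / 2) := by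
    ext q
    rw [mem_box hw hh, abs_lt, abs_lt]
    simp only [mem_prod, mem_Ioo]
    constructor <;> rintro ⟨⟨h1, h2⟩, h3, h4⟩ <;> refine ⟨⟨?_, ?_⟩, ?_, ?_⟩ <;> linarith
  rw [this]
  exact (convex_Ioo _ _).prod (convex_Ioo _ _)

/-- A weak solution with zero data that vanishes before time `a` vanishes during `(a,b)` if the
field is that of a family of rotating rectangles. -/
theorem Cells.eq_zero {T a b : ℝ} {u : ℝ × T2 → ℝ × ℝ} {w : ℝ × T2 → ℝ} (C : Cells)
    (hu : ∀ᵐ z ∂(stMeasure 0 T), ‖u z‖ ≤ 1)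
    (hum : AEStronglyMeasurable u (stMeasure 0 T))
    (hw : Integrable w (stMeasure 0 T))
    (hweak : ∀ φ : ℝ → T2 → ℝ, IsTest T φ → ∫ z, w z * material φ z (u z) ∂(stMeasure 0 T) = 0)
    (ha : 0 ≤ a) (hab : a < b) (hbT : b ≤ T)
    (hwa : ∀ᵐ z ∂(stMeasure 0 T), z.1 < a → w z = 0)
    (huv : ∀ᵐ z ∂(stMeasure 0 T), z.1 ∈ Ioo a b → u z = C.vel z.2) :
    ∀ᵐ z ∂(stMeasure 0 T), z.1 ∈ Ioo a b → w z = 0 := by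
  have hbox : ∀ c ∈ C.cen '' C.carrier, ∀ᵐ z ∂(stMeasure 0 T),
      z.1 ∈ Ioo a b → rep2 z.2 ∈ box C.w C.h c → w z = 0 := by
    rintro c ⟨x, hx, rfl⟩
    have hm : 0 < max C.w C.h := lt_max_of_lt_left C.w_pos
    have hmi : 0 < max C.w⁻¹ C.h⁻¹ := lt_max_of_lt_left (inv_pos.2 C.w_pos)
    refine eq_zero_on_invariant hu hum hw hweak ha hab hbT hwa (isOpen_box C.w C.h (C.cen x))
      (C.box_subset x hx) ((convex_box C.w_pos C.h_pos _).addHaar_frontier volume)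
      (Y := fun s q => boxRot C.w C.h (C.cen x) (C.ang x s) q) ?_
      (fun s => measurePreserving_boxRot C.w_pos C.h_pos _ _) (fun s q => ?_)
      (fun s q => boxRot_mem_box C.w_pos C.h_pos)
      (K := 1 + max C.w C.h * (9 * max C.w⁻¹ C.h⁻¹)) (fun s s' q q' hq => ?_)
      (v := fun q => C.sgn x • boxField C.w C.h (q - C.cen x)) ?_ (fun q hq => ?_) ?_
    · exact (continuous_boxRot C.w C.h).measurable.comp (measurable_const.prodMk
        (Measurable.prodMk (measurable_fst.const_mul _) measurable_snd))
    · rw [boxRot_boxRot C.w_pos C.h_pos, ang, ang, ← mul_add, neg_add_cancel, mul_zero,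
        boxRot_zero C.w_pos C.h_pos]
    · have h1 := norm_boxRot_sub_angle_le C.w_pos C.h_pos (C.cen x) (C.ang x s) (C.ang x s') hq
      have h2 := norm_boxRot_sub_le C.w_pos C.h_pos (C.cen x) (C.ang x s') q q'
      have h3 : max C.w C.h / 2 * |C.ang x s - C.ang x s'| = |s - s'| := by
        rw [ang, ang, ← mul_sub, abs_mul, abs_mul, C.abs_sgn, one_mul, angSpeed,
          abs_of_pos (by positivity)]
        field_simp
      have h4 : |s - s'| ≤ ‖(s, q) - (s', q')‖ := norm_fst_le ((s, q) - (s', q'))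
      have h5 : ‖q - q'‖ ≤ ‖(s, q) - (s', q')‖ := norm_snd_le ((s, q) - (s', q'))
      have h6 := norm_add_le (boxRot C.w C.h (C.cen x) (C.ang x s) q -
        boxRot C.w C.h (C.cen x) (C.ang x s') q) (boxRot C.w C.h (C.cen x) (C.ang x s') q -
        boxRot C.w C.h (C.cen x) (C.ang x s') q')
      rw [sub_add_sub_cancel] at h6
      have h7 : max C.w C.h * (9 * (max C.w⁻¹ C.h⁻¹ * ‖q - q'‖)) ≤
          max C.w C.h * (9 * max C.w⁻¹ C.h⁻¹) * ‖(s, q) - (s', q')‖ := by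
        rw [← mul_assoc 9, ← mul_assoc]
        exact mul_le_mul_of_nonneg_left h5 (by positivity)
      linarith
    · exact ((measurable_boxField _ _).comp (measurable_id.sub_const _)).const_smul (C.sgn x)
    · set p := scale C.w⁻¹ C.h⁻¹ (q - C.cen x) with hp
      rcases eq_or_ne p 0 with h0 | h0
      · exact Eventually.of_forall fun τ =>
          hasDerivAt_boxRot C.w_pos C.h_pos (C.cen x) q (C.sgn x) τ (Or.inl h0)
      · have hk := C.sgn_mul_angSpeed_ne_zero x
        have hcount : {τ : ℝ | |(sqRot (C.ang x τ) p).1| = |(sqRot (C.ang x τ) p).2|}.Countable :=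
          (countable_diagonal_angles h0).preimage (mul_right_injective₀ hk)
        filter_upwards [hcount.ae_notMem volume] with τ hτ using
          hasDerivAt_boxRot C.w_pos C.h_pos (C.cen x) q (C.sgn x) τ (Or.inr hτ)
    · filter_upwards [huv] with z hz h1 h2
      have h3 := C.mem_of_mem_box x hx _ h2
      have h4 := C.cen_of_mem_box x hx _ h2
      have h5 := C.sgn_of_mem_box x hx _ h2
      rw [mk2_rep2] at h3 h4 h5
      rw [hz h1, vel_of_mem h3, h4, h5]
  have hall : ∀ᵐ z ∂(stMeasure 0 T), ∀ c ∈ C.cen '' C.carrier,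
      z.1 ∈ Ioo a b → rep2 z.2 ∈ box C.w C.h c → w z = 0 :=
    (ae_ball_iff C.countable_cen).2 hbox
  -- Now `w` vanishes inside the rectangles and `u` outside them. No regularity of the field across
  -- the edges is needed.
  refine eq_zero_of_flux_zero hu hum hw hweak ha hab hbT hwa ?_
  filter_upwards [hall, huv] with z h1 h2 h3
  by_cases hz : z.2 ∈ C.carrier
  · exact Or.inl (h1 _ ⟨_, hz, rfl⟩ h3 (C.rep2_mem_box _ hz))
  · exact Or.inr (by rw [h2 h3, vel_of_notMem hz])

/-! ### Finite schedules of rotations -/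

/-- A family of rectangles that rotates during the time interval `[a,b)`. -/
structure Step where
  C : Cells
  a : ℝ
  b : ℝ
  le : a ≤ b

/-- The time during which the step has been active at time `t`. -/
def Step.elapsed (s : Step) (t : ℝ) : ℝ := max 0 (min (t - s.a) (s.b - s.a))

theorem Step.elapsed_of_le (s : Step) {t : ℝ} (h : t ≤ s.a) : s.elapsed t = 0 := by
  rw [elapsed, max_eq_left]; exact (min_le_left _ _).trans (by linarith)

theorem Step.elapsed_of_ge (s : Step) {t : ℝ} (h : s.b ≤ t) : s.elapsed t = s.b - s.a := by
  rw [elapsed, min_eq_right (by linarith), max_eq_right (by linarith [s.le])]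

theorem Step.elapsed_of_mem (s : Step) {t : ℝ} (h1 : s.a ≤ t) (h2 : t ≤ s.b) :
    s.elapsed t = t - s.a := by
  rw [elapsed, min_eq_left (by linarith), max_eq_right (by linarith)]

theorem Step.elapsed_nonneg (s : Step) (t : ℝ) : 0 ≤ s.elapsed t := le_max_left _ _

theorem Step.elapsed_le (s : Step) (t : ℝ) : s.elapsed t ≤ s.b - s.a :=
  max_le (by linarith [s.le]) (min_le_right _ _)

theorem Step.lipschitz_elapsed (s : Step) : LipschitzWith 1 s.elapsed := by
  have : LipschitzWith 1 (fun t : ℝ => t - s.a) := by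
    refine LipschitzWith.of_dist_le_mul fun x y => ?_
    simp
  exact (this.min_const _).const_max _

open Classical in
/-- The time dependent velocity field of a schedule. -/
def fld : List Step → ℝ → T2 → ℝ × ℝ
  | [], _, _ => 0
  | s :: l, t, x => (if t ∈ Ico s.a s.b then s.C.vel x else 0) + fld l t x

/-- The flow of a schedule. -/
def flow : List Step → ℝ → T2 ≃ᵐ T2
  | [], _ => MeasurableEquiv.refl T2
  | s :: l, t => (s.C.map (s.elapsed t)).trans (flow l t)

/-- The steps of the schedule are in chronological order. -/
def Chrono (l : List Step) : Prop := l.Pairwise fun s s' => s.b ≤ s'.a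

theorem flow_append (l l' : List Step) (t : ℝ) :
    flow (l ++ l') t = (flow l t).trans (flow l' t) := by
  induction l with
  | nil => rfl
  | cons s l ih => rw [List.cons_append, flow, ih]; rfl

theorem flow_cons_apply (s : Step) (l : List Step) (t : ℝ) (x : T2) :
    flow (s :: l) t x = flow l t (s.C.map (s.elapsed t) x) := rfl

theorem measurePreserving_flow (l : List Step) (t : ℝ) :
    MeasurePreserving (flow l t) volume volume := by
  induction l with
  | nil => exact MeasurePreserving.id _
  | cons s l ih => exact ih.comp (s.C.measurePreserving_map _)

theorem measurable_flow (l : List Step) : Measurable fun z : ℝ × T2 => flow l z.1 z.2 := by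
  induction l with
  | nil => exact measurable_snd
  | cons s l ih =>
    exact ih.comp (measurable_fst.prodMk (s.C.measurable_mapFun_uncurry.comp
      ((s.lipschitz_elapsed.continuous.measurable.comp measurable_fst).prodMk measurable_snd)))

theorem measurable_flow_symm (l : List Step) :
    Measurable fun z : ℝ × T2 => (flow l z.1).symm z.2 := by
  induction l with
  | nil => exact measurable_snd
  | cons s l ih =>
    exact s.C.measurable_mapFun_uncurry.comp
      ((s.lipschitz_elapsed.continuous.measurable.comp measurable_fst).neg.prodMk ih)

theorem flow_of_le {l : List Step} {t : ℝ} (h : ∀ s ∈ l, t ≤ s.a) :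
    flow l t = MeasurableEquiv.refl T2 := by
  induction l with
  | nil => rfl
  | cons s l ih =>
    rw [flow, ih fun s' hs' => h s' (List.mem_cons_of_mem _ hs'),
      s.elapsed_of_le (h s List.mem_cons_self), Cells.map_zero]
    rfl

theorem flow_of_ge {l : List Step} {t t' : ℝ} (h : ∀ s ∈ l, s.b ≤ t) (h' : ∀ s ∈ l, s.b ≤ t') :
    flow l t = flow l t' := by
  induction l with
  | nil => rfl
  | cons s l ih =>
    rw [flow, flow, ih (fun s' hs' => h s' (List.mem_cons_of_mem _ hs'))
      (fun s' hs' => h' s' (List.mem_cons_of_mem _ hs')),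
      s.elapsed_of_ge (h s List.mem_cons_self), s.elapsed_of_ge (h' s List.mem_cons_self)]

theorem Cells.dist_map_le (C : Cells) (τ : ℝ) (x : T2) : dist (C.map τ x) x ≤ |τ| := by
  obtain ⟨γ, h1, h2, -⟩ := C.exists_curve x
  have h0 : mk2 (γ 0) = x := by rw [h2, C.map_zero]; rfl
  rw [← h2 τ]
  conv_lhs => rw [← h0]
  refine (dist_mk2_le _ _).trans ?_
  have := h1.dist_le_mul τ 0
  rwa [NNReal.coe_one, one_mul, dist_eq_norm, Real.dist_eq, sub_zero] at this

/-- The speed is at most one, so the total displacement is bounded by the total duration. This is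
the quantitative reason why inserting short swaps changes little. -/
theorem dist_flow_le (l : List Step) (t : ℝ) (x : T2) :
    dist (flow l t x) x ≤ (l.map fun s => s.b - s.a).sum := by
  induction l generalizing x with
  | nil => simp [flow]
  | cons s l ih =>
    rw [flow_cons_apply, List.map_cons, List.sum_cons]
    have h1 := ih (s.C.map (s.elapsed t) x)
    have h2 := s.C.dist_map_le (s.elapsed t) x
    rw [abs_of_nonneg (s.elapsed_nonneg t)] at h2
    have h3 := s.elapsed_le t
    linarith [dist_triangle (flow l t (s.C.map (s.elapsed t) x)) (s.C.map (s.elapsed t) x) x]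

theorem fld_of_lt {l : List Step} {t : ℝ} (h : ∀ s ∈ l, t < s.a) (x : T2) : fld l t x = 0 := by
  induction l with
  | nil => rfl
  | cons s l ih =>
    rw [fld, ih fun s' hs' => h s' (List.mem_cons_of_mem _ hs'), if_neg, add_zero]
    exact fun hm => absurd hm.1 (not_le.2 (h s List.mem_cons_self))

theorem measurable_fld (l : List Step) : Measurable fun z : ℝ × T2 => fld l z.1 z.2 := by
  classical
  induction l with
  | nil => exact measurable_const
  | cons s l ih =>
    exact (Measurable.ite (measurable_fst measurableSet_Ico)
      (s.C.measurable_vel.comp measurable_snd) measurable_const).add ih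

theorem Chrono.lt_of_lt {s : Step} {l : List Step} (hl : Chrono (s :: l)) {t : ℝ} (ht : t < s.b) :
    ∀ s' ∈ l, t < s'.a := fun s' hs' => ht.trans_le ((List.pairwise_cons.1 hl).1 s' hs')

theorem Chrono.tail {s : Step} {l : List Step} (hl : Chrono (s :: l)) : Chrono l :=
  (List.pairwise_cons.1 hl).2

theorem norm_fld_le {l : List Step} (hl : Chrono l) (t : ℝ) (x : T2) : ‖fld l t x‖ ≤ 1 := by
  induction l with
  | nil => simp [fld]
  | cons s l ih =>
    rw [fld]
    split_ifs with h
    · rw [fld_of_lt (hl.lt_of_lt h.2), add_zero]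
      exact s.C.norm_vel_le x
    · rw [zero_add]; exact ih hl.tail

/-- Every orbit of the flow lifts to a Lipschitz curve that solves the differential equation. -/
theorem exists_curve_flow {l : List Step} (hl : Chrono l) (x : T2) : ∃ γ : ℝ → ℝ × ℝ,
    LipschitzWith l.length γ ∧ (∀ t, mk2 (γ t) = flow l t x) ∧
      ∀ᵐ t, HasDerivAt γ (fld l t (flow l t x)) t := by
  induction l generalizing x with
  | nil =>
    refine ⟨fun _ => rep2 x, LipschitzWith.const' _, fun t => mk2_rep2 x,
      Eventually.of_forall fun t => hasDerivAt_const _ _⟩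
  | cons s l ih =>
    obtain ⟨γ₁, L₁, m₁, d₁⟩ := s.C.exists_curve x
    obtain ⟨γ₂, L₂, m₂, d₂⟩ := ih hl.tail (s.C.map (s.b - s.a) x)
    have hid : ∀ t ≤ s.b, flow l t = MeasurableEquiv.refl T2 := fun t ht =>
      flow_of_le fun s' hs' => ht.trans ((List.pairwise_cons.1 hl).1 s' hs')
    -- replace the second curve by one that is constant up to time `s.b`
    set δ : ℝ → ℝ × ℝ := fun t => γ₂ (max t s.b) - γ₂ s.b with hδ
    have hδ0 : ∀ t ≤ s.b, δ t = 0 := fun t ht => by simp [hδ, max_eq_right ht]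
    refine ⟨fun t => γ₁ (s.elapsed t) + δ t, ?_, fun t => ?_, ?_⟩
    · have h1 : LipschitzWith 1 (fun t => γ₁ (s.elapsed t)) := by
        have := L₁.comp s.lipschitz_elapsed
        rw [mul_one] at this
        exact this
      have h2 : LipschitzWith (l.length : ℝ≥0) δ := by
        have h3 : LipschitzWith (l.length : ℝ≥0) (fun t : ℝ => γ₂ (max t s.b)) := by
          have := L₂.comp (LipschitzWith.id.max_const s.b)
          rw [mul_one] at this
          exact this
        refine LipschitzWith.of_dist_le_mul fun a b => ?_
        simpa [hδ] using h3.dist_le_mul a b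
      have := h1.add h2
      rwa [add_comm (1 : ℝ≥0), ← Nat.cast_succ] at this
    · rw [mk2_add, m₁, flow_cons_apply]
      rcases le_or_gt t s.b with ht | ht
      · rw [hδ0 t ht, hid t ht]
        exact add_zero _
      · rw [s.elapsed_of_ge ht.le, hδ]
        simp only [max_eq_left ht.le]
        rw [mk2_sub, m₂, m₂, hid s.b le_rfl]
        exact add_sub_cancel _ _
    · have hne : ∀ᵐ t : ℝ, t ≠ s.a ∧ t ≠ s.b :=
        (Measure.ae_ne volume s.a).and (Measure.ae_ne volume s.b)
      have d₁' : ∀ᵐ t : ℝ, HasDerivAt γ₁ (s.C.vel (s.C.map (t - s.a) x)) (t - s.a) :=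
        (measurePreserving_sub_right volume s.a).quasiMeasurePreserving.ae d₁
      filter_upwards [hne, d₁', d₂] with t hn h1 h2
      rw [flow_cons_apply, fld]
      rcases lt_or_gt_of_ne hn.2 with hb | hb
      · have hδd : HasDerivAt δ 0 t := by
          refine (hasDerivAt_const t (0 : ℝ × ℝ)).congr_of_eventuallyEq ?_
          filter_upwards [Iio_mem_nhds hb] with r hr using hδ0 r (le_of_lt hr)
        rw [fld_of_lt (hl.lt_of_lt hb), hid t hb.le]
        refine HasDerivAt.add ?_ hδd
        rcases lt_or_gt_of_ne hn.1 with ha | ha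
        · rw [if_neg fun h => absurd h.1 (not_le.2 ha)]
          refine (hasDerivAt_const t (γ₁ 0)).congr_of_eventuallyEq ?_
          filter_upwards [Iio_mem_nhds ha] with r hr
          rw [s.elapsed_of_le (le_of_lt hr)]
        · rw [if_pos ⟨ha.le, hb⟩, s.elapsed_of_mem ha.le hb.le]
          refine (h1.comp_sub_const t s.a).congr_of_eventuallyEq ?_
          filter_upwards [Ioi_mem_nhds ha, Iio_mem_nhds hb] with r hr hr'
          rw [s.elapsed_of_mem (le_of_lt hr) (le_of_lt hr')]
      · rw [if_neg fun h => absurd h.2 (not_lt.2 hb.le), s.elapsed_of_ge hb.le]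
        refine HasDerivAt.add ?_ ?_
        · refine (hasDerivAt_const t (γ₁ (s.b - s.a))).congr_of_eventuallyEq ?_
          filter_upwards [Ioi_mem_nhds hb] with r hr
          rw [s.elapsed_of_ge (le_of_lt hr)]
        · refine (h2.sub_const (γ₂ s.b)).congr_of_eventuallyEq ?_
          filter_upwards [Ioi_mem_nhds hb] with r hr
          simp only [hδ, max_eq_left (le_of_lt (mem_Ioi.1 hr))]

/-- Weak solutions with zero data along the field of a schedule vanish. -/
theorem eq_zero_of_fld {T t₀ : ℝ} {u : ℝ × T2 → ℝ × ℝ} {w : ℝ × T2 → ℝ} {l : List Step}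
    (hl : Chrono l) (hlT : ∀ s ∈ l, s.b ≤ T) (ht₀ : 0 ≤ t₀) (hl0 : ∀ s ∈ l, t₀ ≤ s.a)
    (hu : ∀ᵐ z ∂(stMeasure 0 T), ‖u z‖ ≤ 1)
    (hum : AEStronglyMeasurable u (stMeasure 0 T))
    (hw : Integrable w (stMeasure 0 T))
    (hweak : ∀ φ : ℝ → T2 → ℝ, IsTest T φ → ∫ z, w z * material φ z (u z) ∂(stMeasure 0 T) = 0)
    (hul : ∀ᵐ z ∂(stMeasure 0 T), t₀ < z.1 → u z = fld l z.1 z.2)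
    (hw0 : ∀ᵐ z ∂(stMeasure 0 T), z.1 < t₀ → w z = 0) :
    ∀ᵐ z ∂(stMeasure 0 T), w z = 0 := by
  have hne : ∀ c : ℝ, ∀ᵐ z ∂(stMeasure 0 T), z.1 ≠ c := fun c => by
    have : ∀ᵐ z : ℝ × ℝ × ℝ, z.1 ≠ c :=
      Measure.quasiMeasurePreserving_fst.ae (Measure.ae_ne volume c)
    exact ae_pt this
  -- passing an interval on which the field vanishes
  have pass : ∀ {a b : ℝ}, 0 ≤ a → b ≤ T → (∀ᵐ z ∂(stMeasure 0 T), z.1 < a → w z = 0) →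
      (∀ᵐ z ∂(stMeasure 0 T), z.1 ∈ Ioo a b → w z = 0) →
      ∀ᵐ z ∂(stMeasure 0 T), z.1 < b → w z = 0 := fun {a b} ha hb h1 h2 => by
    filter_upwards [h1, h2, hne a] with z h1 h2 h3 h4
    rcases lt_or_gt_of_ne h3 with h | h
    · exact h1 h
    · exact h2 ⟨h, h4⟩
  -- Each step advances `t₀` to its end, first across the idle gap before the step and then across
  -- the step itself. The empty schedule leaves an idle interval up to `T`.
  induction l generalizing t₀ with
  | nil =>
    have hfin : ∀ᵐ z ∂(stMeasure 0 T), z.1 < T → w z = 0 := by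
      rcases lt_or_ge t₀ T with h | h
      · refine pass ht₀ le_rfl hw0 (eq_zero_of_flux_zero hu hum hw hweak ht₀ h le_rfl hw0 ?_)
        filter_upwards [hul] with z hz h1
        exact Or.inr (hz h1.1)
      · filter_upwards [hw0] with z hz h1 using hz (h1.trans_le h)
    have hT : ∀ᵐ z ∂(stMeasure 0 T), z.1 ≤ T := by
      have := (measurePreserving_pt 0 T).quasiMeasurePreserving.ae
        (ae_restrict_mem (measurableSet_Icc.prod measurableSet_unitSq))
      filter_upwards [this] with z hz using hz.1.2
    filter_upwards [hfin, hT, hne T] with z h1 h2 h3 using h1 (lt_of_le_of_ne h2 h3)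
  | cons s l ih =>
    have ha0 := hl0 s List.mem_cons_self
    have hbT := hlT s List.mem_cons_self
    have h1 : ∀ᵐ z ∂(stMeasure 0 T), z.1 < s.a → w z = 0 := by
      rcases lt_or_eq_of_le ha0 with h | h
      · refine pass ht₀ (s.le.trans hbT) hw0 (eq_zero_of_flux_zero hu hum hw hweak ht₀ h
          (s.le.trans hbT) hw0 ?_)
        filter_upwards [hul] with z hz h1
        refine Or.inr ?_
        rw [hz h1.1, fld, if_neg fun h => absurd h.1 (not_le.2 h1.2), zero_add,
          fld_of_lt (hl.lt_of_lt (h1.2.trans_le s.le))]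
      · rwa [← h]
    have h2 : ∀ᵐ z ∂(stMeasure 0 T), z.1 < s.b → w z = 0 := by
      rcases lt_or_eq_of_le s.le with h | h
      · refine pass (ht₀.trans ha0) hbT h1 (s.C.eq_zero hu hum hw hweak (ht₀.trans ha0) h hbT h1 ?_)
        filter_upwards [hul] with z hz h1
        rw [hz (ha0.trans_lt h1.1), fld, if_pos ⟨h1.1.le, h1.2⟩,
          fld_of_lt (hl.lt_of_lt h1.2), add_zero]
      · rwa [← h]
    refine ih hl.tail (fun s' hs' => hlT s' (List.mem_cons_of_mem _ hs'))
      ((ht₀.trans ha0).trans s.le) (fun s' hs' => (List.pairwise_cons.1 hl).1 s' hs') ?_ h2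
    filter_upwards [hul] with z hz h3
    rw [hz ((ha0.trans s.le).trans_lt h3), fld, if_neg fun h => absurd h.2 (not_lt.2 h3.le),
      zero_add]

/-! ### Flows give weak solutions -/

instance isFiniteMeasure_stMeasure (a b : ℝ) : IsFiniteMeasure (stMeasure a b) := by
  unfold stMeasure; infer_instance

/-- A jointly measurable, area preserving flow along a bounded field with Lipschitz orbits. -/
structure RegularFlow (T : ℝ) (u : ℝ → T2 → ℝ × ℝ) (y : ℝ → T2 ≃ᵐ T2) : Prop where
  preserving : ∀ t, MeasurePreserving (y t) volume volume
  measurable : Measurable fun z : ℝ × T2 => y z.1 z.2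
  measurable_symm : Measurable fun z : ℝ × T2 => (y z.1).symm z.2
  zero : y 0 = MeasurableEquiv.refl T2
  bound : ∀ᵐ z ∂(stMeasure 0 T), ‖u z.1 z.2‖ ≤ 1
  aesm : AEStronglyMeasurable (Function.uncurry u) (stMeasure 0 T)
  curve : ∃ K : ℝ≥0, ∀ᵐ x : T2, ∃ γ : ℝ → ℝ × ℝ, LipschitzWith K γ ∧
    (∀ t, mk2 (γ t) = y t x) ∧
    ∀ᵐ t ∂((volume : Measure ℝ).restrict (Icc 0 T)), HasDerivAt γ (u t (y t x)) t

theorem IsTest.contDiff_lift {T : ℝ} {φ : ℝ → T2 → ℝ} (hφ : IsTest T φ) :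
    ContDiff ℝ ∞ (lift φ) := hφ.1

theorem IsTest.differentiable_lift {T : ℝ} {φ : ℝ → T2 → ℝ} (hφ : IsTest T φ) :
    Differentiable ℝ (lift φ) := hφ.contDiff_lift.differentiable (by simp)

theorem IsTest.exists_bound {T : ℝ} {φ : ℝ → T2 → ℝ} (hφ : IsTest T φ) (a b : ℝ) :
    ∃ M : ℝ, 0 ≤ M ∧ ∀ z : ℝ × T2, z.1 ∈ Icc a b → ∀ v : ℝ × ℝ, ‖v‖ ≤ 1 →
      |material φ z v| ≤ M := by
  have hK : IsCompact (Icc a b ×ˢ (Icc (0 : ℝ) 1 ×ˢ Icc (0 : ℝ) 1)) :=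
    isCompact_Icc.prod (isCompact_Icc.prod isCompact_Icc)
  obtain ⟨M, hM⟩ := hK.exists_bound_of_continuousOn (f := fderiv ℝ (lift φ))
    (hφ.contDiff_lift.continuous_fderiv (by simp)).continuousOn
  refine ⟨max M 0, le_max_right _ _, fun z hz v hv => ?_⟩
  have hmem := rep2_mem z.2
  have h1 := hM (pt z) ⟨hz, Ico_subset_Icc_self hmem.1, Ico_subset_Icc_self hmem.2⟩
  rw [material_eq_pt (hφ.differentiable_lift _), ← Real.norm_eq_abs]
  refine (ContinuousLinearMap.le_opNorm _ _).trans ?_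
  have h2 : ‖((1 : ℝ), v)‖ ≤ 1 := by simp [Prod.norm_def] at hv ⊢; exact hv
  calc _ ≤ max M 0 * 1 :=
        mul_le_mul (h1.trans (le_max_left _ _)) h2 (norm_nonneg _) (le_max_right _ _)
    _ = _ := mul_one _

theorem IsTest.continuous_material {T : ℝ} {φ : ℝ → T2 → ℝ} (hφ : IsTest T φ) :
    Continuous fun p : (ℝ × ℝ × ℝ) × (ℝ × ℝ) => fderiv ℝ (lift φ) p.1 (1, p.2) := by
  have hc : Continuous fun p : (ℝ × ℝ × ℝ) × (ℝ × ℝ × ℝ) => fderiv ℝ (lift φ) p.1 p.2 :=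
    hφ.contDiff_lift.continuous_fderiv_apply (by simp)
  exact hc.comp (continuous_fst.prodMk (continuous_const.prodMk continuous_snd))

theorem IsTest.aestronglyMeasurable_material {T : ℝ} {φ : ℝ → T2 → ℝ} (hφ : IsTest T φ)
    {μ : Measure (ℝ × T2)} {v : ℝ × T2 → ℝ × ℝ} (hv : AEStronglyMeasurable v μ) :
    AEStronglyMeasurable (fun z => material φ z (v z)) μ := by
  have h1 : ∀ z, material φ z (v z) = fderiv ℝ (lift φ) (pt z) (1, v z) := fun z =>
    material_eq_pt (hφ.differentiable_lift _) _
  simp only [h1]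
  have hpt : Measurable pt := (measurePreserving_pt 0 0).measurable
  exact hφ.continuous_material.comp_aestronglyMeasurable
    (hpt.aestronglyMeasurable.prodMk hv)

theorem ae_mem_Icc (a b : ℝ) : ∀ᵐ z ∂(stMeasure a b), z.1 ∈ Icc a b := by
  have := (measurePreserving_pt a b).quasiMeasurePreserving.ae
    (ae_restrict_mem (measurableSet_Icc.prod measurableSet_unitSq))
  filter_upwards [this] with z hz using hz.1

/-- Along an orbit the material derivative integrates to the increment of the test function. -/
theorem IsTest.integral_material_curve {T : ℝ} (hT : 0 ≤ T) {φ : ℝ → T2 → ℝ} (hφ : IsTest T φ)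
    {K : ℝ≥0} {γ γ' : ℝ → ℝ × ℝ} (hγ : LipschitzWith K γ)
    (hd : ∀ᵐ t ∂((volume : Measure ℝ).restrict (Icc 0 T)), HasDerivAt γ (γ' t) t) :
    ∫ t in Icc 0 T, material φ (t, mk2 (γ t)) (γ' t) = -φ 0 (mk2 (γ 0)) := by
  have hloc : LocallyLipschitz fun t : ℝ => lift φ (t, γ t) := by
    have h1 : LocallyLipschitz (lift φ) :=
      (hφ.contDiff_lift.of_le (m := 1) (by exact_mod_cast le_top)).locallyLipschitz
    exact h1.comp (LipschitzWith.id.prodMk hγ).locallyLipschitz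
  -- The test function need not be globally Lipschitz, but its composition with the orbit is
  -- Lipschitz on the compact interval. This makes it absolutely continuous, and the fundamental
  -- theorem of calculus applies.
  obtain ⟨K', hK'⟩ := LocallyLipschitzOn.exists_lipschitzOnWith_of_compact
    (s := uIcc 0 T) isCompact_uIcc hloc.locallyLipschitzOn
  have hac := (hK'.absolutelyContinuousOnInterval).integral_deriv_eq_sub
  rw [intervalIntegral.integral_of_le hT, ← integral_Icc_eq_integral_Ioc] at hac
  obtain ⟨T', hT', h0⟩ := hφ.2
  have hend : lift φ (T, γ T) = 0 := h0 T hT'.le _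
  rw [hend, zero_sub] at hac
  refine Eq.trans (integral_congr_ae ?_) hac
  filter_upwards [hd] with t ht
  rw [material_eq (hφ.differentiable_lift _)]
  exact (hasDerivAt_lift (hφ.differentiable_lift _) (c := fun s => (s, γ s))
    ((hasDerivAt_id t).prodMk ht) rfl).deriv.symm

namespace RegularFlow

variable {T : ℝ} {u : ℝ → T2 → ℝ × ℝ} {y : ℝ → T2 ≃ᵐ T2}

/-- The flow on space-time. -/
def skew (h : RegularFlow T u y) : ℝ × T2 ≃ᵐ ℝ × T2 where
  toFun z := (z.1, y z.1 z.2)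
  invFun z := (z.1, (y z.1).symm z.2)
  left_inv z := by simp
  right_inv z := by simp
  measurable_toFun := measurable_fst.prodMk h.measurable
  measurable_invFun := measurable_fst.prodMk h.measurable_symm

theorem measurePreserving_skew (h : RegularFlow T u y) (a b : ℝ) :
    MeasurePreserving h.skew (stMeasure a b) (stMeasure a b) :=
  (MeasurePreserving.id ((volume : Measure ℝ).restrict (Icc a b))).skew_product
    (g := fun t x => y t x) h.measurable (Eventually.of_forall fun t => (h.preserving t).map_eq)

/-- The flow preserves the measure on space-time, so almost every orbit meets a given null set only
at a null set of times. This is what allows the values of the field on diagonals and dyadic lines to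
be ignored. -/
theorem congr_field (h : RegularFlow T u y) {u' : ℝ → T2 → ℝ × ℝ}
    (hu : ∀ᵐ z ∂(stMeasure 0 T), u' z.1 z.2 = u z.1 z.2) : RegularFlow T u' y := by
  have hcurve : ∀ᵐ x : T2, ∀ᵐ t ∂((volume : Measure ℝ).restrict (Icc 0 T)),
      u' t (y t x) = u t (y t x) := by
    have h1 := (h.measurePreserving_skew 0 T).quasiMeasurePreserving.ae hu
    have h3 : ∀ᵐ p ∂((volume : Measure T2).prod ((volume : Measure ℝ).restrict (Icc 0 T))),
        u' p.2 (y p.2 p.1) = u p.2 (y p.2 p.1) :=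
      (Measure.measurePreserving_swap (μ := (volume : Measure T2))
        (ν := (volume : Measure ℝ).restrict (Icc 0 T))).quasiMeasurePreserving.ae h1
    exact Measure.ae_ae_of_ae_prod h3
  obtain ⟨K, hK⟩ := h.curve
  refine ⟨h.preserving, h.measurable, h.measurable_symm, h.zero, ?_, ?_, K, ?_⟩
  · filter_upwards [hu, h.bound] with z h1 h2
    rwa [h1]
  · exact h.aesm.congr (hu.mono fun z hz => hz.symm)
  · filter_upwards [hK, hcurve] with x ⟨γ, g1, g2, g3⟩ hx
    refine ⟨γ, g1, g2, ?_⟩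
    filter_upwards [g3, hx] with t h1 h2
    rwa [h2]

theorem isLagrangianFlow (h : RegularFlow T u y) : IsLagrangianFlow T u y where
  preserving t _ := h.preserving t
  curve := by
    obtain ⟨K, hK⟩ := h.curve
    filter_upwards [hK] with x ⟨γ, g1, g2, g3⟩
    exact ⟨γ, (g1.lipschitzOnWith (s := uIcc 0 T)).absolutelyContinuousOnInterval,
      fun t _ => g2 t, g3⟩

/-- After the change of variables by the flow, the transported function is constant along each
orbit, and the material derivative of the test function integrates in time to minus its initial
value. -/
theorem integral_material (h : RegularFlow T u y) (hT : 0 ≤ T) {g : T2 → ℝ} (hg : Measurable g)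
    {M : ℝ} (hM : ∀ x, |g x| ≤ M) {φ : ℝ → T2 → ℝ} (hφ : IsTest T φ) :
    ∫ z, g ((y z.1).symm z.2) * material φ z (u z.1 z.2) ∂(stMeasure 0 T) =
      -∫ x, g x * φ 0 x := by
  obtain ⟨Mφ, hMφ0, hMφ⟩ := hφ.exists_bound 0 T
  have hM0 : 0 ≤ M := (abs_nonneg _).trans (hM 0)
  have hint : Integrable (fun z : ℝ × T2 => g ((y z.1).symm z.2) * material φ z (u z.1 z.2))
      (stMeasure 0 T) := by
    refine Integrable.of_bound (C := M * Mφ)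
      ((hg.comp h.measurable_symm).aestronglyMeasurable.mul
        (hφ.aestronglyMeasurable_material h.aesm)) ?_
    filter_upwards [h.bound, ae_mem_Icc 0 T] with z h1 h2
    rw [norm_mul]
    exact mul_le_mul (hM _) (hMφ z h2 _ h1) (norm_nonneg _) hM0
  have hQ := h.measurePreserving_skew 0 T
  rw [← hQ.integral_comp h.skew.measurableEmbedding]
  have hint2 : Integrable (fun z => g ((y (h.skew z).1).symm (h.skew z).2) *
      material φ (h.skew z) (u (h.skew z).1 (h.skew z).2)) (stMeasure 0 T) :=
    (hQ.integrable_comp_emb h.skew.measurableEmbedding).2 hint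
  have e1 : ∀ z : ℝ × T2, (h.skew z).1 = z.1 := fun _ => rfl
  have e2 : ∀ z : ℝ × T2, (h.skew z).2 = y z.1 z.2 := fun _ => rfl
  refine (integral_prod_symm _ hint2).trans ?_
  rw [← integral_neg]
  obtain ⟨K, hK⟩ := h.curve
  refine integral_congr_ae ?_
  filter_upwards [hK] with x ⟨γ, g1, g2, g3⟩
  simp only [e1, e2, MeasurableEquiv.symm_apply_apply]
  rw [integral_const_mul, ← mul_neg]
  congr 1
  have := hφ.integral_material_curve hT g1 g3
  simp only [g2, h.zero] at this
  exact this

theorem refl (T : ℝ) : RegularFlow T (fun _ _ => 0) (fun _ => MeasurableEquiv.refl T2) where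
  preserving _ := MeasurePreserving.id _
  measurable := measurable_snd
  measurable_symm := measurable_snd
  zero := rfl
  bound := by simp
  aesm := aestronglyMeasurable_const
  curve := ⟨0, Eventually.of_forall fun x => ⟨fun _ => rep2 x, LipschitzWith.const _,
    fun _ => mk2_rep2 x, Eventually.of_forall fun t => hasDerivAt_const _ _⟩⟩

/-- Transporting the constant 1 by the flow, and also by the flow at rest, gives two identities with
the same right side. Their difference contains no time derivative and is the divergence condition.
-/
theorem isDivFree (h : RegularFlow T u y) (hT : 0 ≤ T) : IsDivFree T u where
  integrable := Integrable.of_bound h.aesm 1 h.bound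
  div_zero φ hφ hδ := by
    obtain ⟨δ, hδ0, hδ⟩ := hδ
    have h1 := h.integral_material hT (g := fun _ => 1) measurable_const (M := 1) (by simp) hφ
    have h2 := (RegularFlow.refl T).integral_material hT (g := fun _ => 1) measurable_const
      (M := 1) (by simp) hφ
    have h0 : ∀ x, φ 0 x = 0 := hδ 0 hδ0.le
    obtain ⟨Mφ, hMφ0, hMφ⟩ := hφ.exists_bound 0 T
    have i1 : Integrable (fun z : ℝ × T2 => material φ z (u z.1 z.2)) (stMeasure 0 T) := by
      refine Integrable.of_bound (hφ.aestronglyMeasurable_material h.aesm) Mφ ?_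
      filter_upwards [h.bound, ae_mem_Icc 0 T] with z h1 h2 using hMφ z h2 _ h1
    have i2 : Integrable (fun z : ℝ × T2 => material φ z 0) (stMeasure 0 T) := by
      refine Integrable.of_bound (hφ.aestronglyMeasurable_material aestronglyMeasurable_const) Mφ ?_
      filter_upwards [ae_mem_Icc 0 T] with z h2 using hMφ z h2 _ (by simp)
    simp only [h0, mul_zero, integral_zero, neg_zero, one_mul] at h1 h2
    have h3 : ∫ z, (material φ z (u z.1 z.2) - material φ z 0) ∂(stMeasure 0 T) = 0 := by
      rw [integral_sub i1 i2, h1, h2, sub_zero]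
    refine Eq.trans ?_ h3
    congr 1
    ext z
    simp [material]

theorem integrable_comp (h : RegularFlow T u y) {g : T2 → ℝ} (hg : Measurable g) {M : ℝ}
    (hM : ∀ x, |g x| ≤ M) :
    Integrable (Function.uncurry fun t x => g ((y t).symm x)) (stMeasure 0 T) :=
  Integrable.of_bound (hg.comp h.measurable_symm).aestronglyMeasurable M
    (Eventually.of_forall fun _ => hM _)

theorem isWeakSolution (h : RegularFlow T u y) (hT : 0 ≤ T) {g f₀ : T2 → ℝ} (hg : Measurable g)
    {M : ℝ} (hM : ∀ x, |g x| ≤ M) (hf₀ : f₀ =ᵐ[volume] g) :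
    IsWeakSolution T u f₀ (fun t x => g ((y t).symm x)) where
  field := h.isDivFree hT
  data := (Integrable.of_bound hg.aestronglyMeasurable M
    (Eventually.of_forall hM)).congr hf₀.symm
  integrable := h.integrable_comp hg hM
  flux := by
    have hM0 : 0 ≤ M := (abs_nonneg _).trans (hM 0)
    refine Integrable.of_bound (C := M * 1)
      ((hg.comp h.measurable_symm).aestronglyMeasurable.smul h.aesm) ?_
    filter_upwards [h.bound] with z hz
    rw [norm_smul]
    exact mul_le_mul (hM _) hz (norm_nonneg _) hM0
  weak φ hφ := by
    have h1 := h.integral_material hT hg hM hφ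
    have h2 : ∫ x, f₀ x * φ 0 x = ∫ x, g x * φ 0 x :=
      integral_congr_ae (hf₀.mono fun x hx => by simp only [hx])
    rw [h2, ← h1]
    rfl

theorem isRenormalised (h : RegularFlow T u y) (hT : 0 ≤ T) {g f₀ : T2 → ℝ} (hg : Measurable g)
    {M : ℝ} (hM : ∀ x, |g x| ≤ M) (hf₀ : f₀ =ᵐ[volume] g) :
    IsRenormalised T u f₀ (fun t x => g ((y t).symm x)) := by
  refine ⟨h.isWeakSolution hT hg hM hf₀, fun β hβ ⟨C, hC⟩ => ?_⟩
  exact h.isWeakSolution hT (g := fun x => β (g x)) (hβ.measurable.comp hg) (fun x => hC _)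
    (hf₀.mono fun x hx => by simp only [hx])

theorem isLagrangianSolution (h : RegularFlow T u y) {g f₀ : T2 → ℝ} (hg : Measurable g)
    {M : ℝ} (hM : ∀ x, |g x| ≤ M) (hf₀ : f₀ =ᵐ[volume] g) :
    IsLagrangianSolution T u f₀ (fun t x => g ((y t).symm x)) := by
  refine ⟨h.integrable_comp hg hM, y, g, h.isLagrangianFlow,
    Integrable.of_bound hg.aestronglyMeasurable M (Eventually.of_forall hM), ?_, fun t _ =>
      EventuallyEq.rfl⟩
  rw [h.zero]
  exact hf₀

end RegularFlow

theorem regularFlow_flow {l : List Step} (hl : Chrono l) {T : ℝ} (h0 : ∀ s ∈ l, 0 ≤ s.a) :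
    RegularFlow T (fld l) (flow l) where
  preserving := measurePreserving_flow l
  measurable := measurable_flow l
  measurable_symm := measurable_flow_symm l
  zero := flow_of_le h0
  bound := Eventually.of_forall fun z => norm_fld_le hl _ _
  aesm := (measurable_fld l).aestronglyMeasurable
  curve := ⟨l.length, Eventually.of_forall fun x => by
    obtain ⟨γ, h1, h2, h3⟩ := exists_curve_flow hl x
    exact ⟨γ, h1, h2, ae_restrict_of_ae h3⟩⟩

/-- Uniqueness of weak solutions along the field of a schedule. -/
theorem IsWeakSolution.unique {T : ℝ} {u : ℝ → T2 → ℝ × ℝ} {l : List Step} (hl : Chrono l)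
    (h0 : ∀ s ∈ l, 0 ≤ s.a) (hT : ∀ s ∈ l, s.b ≤ T)
    (hu : ∀ᵐ z ∂(stMeasure 0 T), u z.1 z.2 = fld l z.1 z.2) {f₀ : T2 → ℝ} {f g : ℝ → T2 → ℝ}
    (hf : IsWeakSolution T u f₀ f) (hg : IsWeakSolution T u f₀ g) :
    Function.uncurry g =ᵐ[stMeasure 0 T] Function.uncurry f := by
  have hu1 : ∀ᵐ z ∂(stMeasure 0 T), ‖u z.1 z.2‖ ≤ 1 := by
    filter_upwards [hu] with z hz
    rw [hz]; exact norm_fld_le hl _ _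
  have key := eq_zero_of_fld (T := T) (t₀ := 0) (u := fun z => u z.1 z.2)
    (w := fun z => g z.1 z.2 - f z.1 z.2) hl hT le_rfl h0 hu1 hf.field.integrable.1
    (hg.integrable.sub hf.integrable) ?_ (hu.mono fun z hz _ => hz) ?_
  · filter_upwards [key] with z hz
    exact sub_eq_zero.1 hz
  · intro φ hφ
    obtain ⟨Mφ, hMφ0, hMφ⟩ := hφ.exists_bound 0 T
    have hb : ∀ᵐ z ∂(stMeasure 0 T), ‖material φ z (u z.1 z.2)‖ ≤ Mφ := by
      filter_upwards [hu1, ae_mem_Icc 0 T] with z h1 h2 using hMφ z h2 _ h1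
    have hmm := hφ.aestronglyMeasurable_material hf.field.integrable.1
    have i1 : Integrable (fun z => g z.1 z.2 * material φ z (u z.1 z.2)) (stMeasure 0 T) :=
      hg.integrable.mul_bdd hmm hb
    have i2 : Integrable (fun z => f z.1 z.2 * material φ z (u z.1 z.2)) (stMeasure 0 T) :=
      hf.integrable.mul_bdd hmm hb
    simp only [sub_mul]
    rw [integral_sub i1 i2]
    have w1 := hg.weak φ hφ
    have w2 := hf.weak φ hφ
    exact sub_eq_zero.2 (w1.trans w2.symm)
  · filter_upwards [ae_mem_Icc 0 T] with z hz h
    exact absurd hz.1 (not_le.2 h)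

/-! ### Dyadic levels -/

/-- The index of the dyadic interval of length `2⁻ᴺ` that contains `a`. -/
def lev (N : ℕ) (a : ℝ) : ℤ := ⌊2 ^ N * a⌋

theorem measurable_lev (N : ℕ) : Measurable (lev N) :=
  Int.measurable_floor.comp (measurable_const_mul _)

theorem lev_eq_iff {N : ℕ} {a : ℝ} {r : ℤ} :
    lev N a = r ↔ (r : ℝ) / 2 ^ N ≤ a ∧ a < (r + 1) / 2 ^ N := by
  have h : (0 : ℝ) < 2 ^ N := by positivity
  rw [lev, Int.floor_eq_iff, div_le_iff₀ h, lt_div_iff₀ h, mul_comm]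

theorem lev_of_le {M N : ℕ} (h : M ≤ N) (a : ℝ) : lev M a = lev N a / 2 ^ (N - M) := by
  have h2 : (0 : ℤ) < 2 ^ (N - M) := by positivity
  have e : (2 : ℝ) ^ N = 2 ^ M * 2 ^ (N - M) := by rw [← pow_add]; congr 1; omega
  symm
  rw [Int.ediv_eq_iff_of_pos h2, lev, lev, e]
  have p : (0 : ℝ) < 2 ^ (N - M) := by positivity
  constructor
  · rw [Int.le_floor]
    push_cast
    nlinarith [Int.floor_le (2 ^ M * a : ℝ)]
  · rw [Int.floor_lt]
    push_cast
    nlinarith [Int.lt_floor_add_one (2 ^ M * a : ℝ)]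

theorem lev_nonneg {a : ℝ} (ha : 0 ≤ a) (N : ℕ) : 0 ≤ lev N a :=
  Int.floor_nonneg.2 (by positivity)

theorem lev_lt {a : ℝ} (ha : a < 1) (N : ℕ) : lev N a < 2 ^ N := by
  rw [lev, Int.floor_lt]
  push_cast
  have : (0 : ℝ) < 2 ^ N := by positivity
  nlinarith

/-! ### Strips -/

/-- A family of intervals of length `w`, concentric with the dyadic intervals of level `N` and
index in `I`. -/
structure Strips where
  N : ℕ
  w : ℝ
  w_pos : 0 < w
  w_le : w ≤ 1 / 2 ^ N
  I : Set ℤ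
  I_sub : I ⊆ Ico 0 (2 ^ N)

namespace Strips

variable (X Y : Strips)

/-- The centre of the dyadic interval of a point. -/
def cen (a : ℝ) : ℝ := (lev X.N a + 1 / 2) / 2 ^ X.N

/-- The union of the intervals. -/
def carrier : Set ℝ := {a | lev X.N a ∈ X.I ∧ |a - X.cen a| < X.w / 2}

theorem measurable_cen : Measurable X.cen :=
  (((measurable_of_countable (fun r : ℤ => (r : ℝ))).comp (measurable_lev X.N)).add_const
    _).div_const _

theorem measurableSet_carrier : MeasurableSet X.carrier :=
  ((measurable_lev X.N) (MeasurableSet.of_discrete (s := X.I))).inter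
    (measurableSet_lt (measurable_id.sub X.measurable_cen).abs measurable_const)

theorem lev_cen (a : ℝ) : lev X.N (X.cen a) = lev X.N a := by
  have h : (0 : ℝ) < 2 ^ X.N := by positivity
  rw [lev_eq_iff, cen]
  constructor
  · gcongr; linarith
  · gcongr; norm_num

theorem lev_of_near {a b : ℝ} (h : |b - X.cen a| < X.w / 2) : lev X.N b = lev X.N a := by
  have hp : (0 : ℝ) < 2 ^ X.N := by positivity
  have hw := X.w_le
  rw [abs_lt, cen, add_div, div_div] at h
  have e : (1 : ℝ) / (2 * 2 ^ X.N) = (1 / 2 ^ X.N) / 2 := by field_simp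
  rw [lev_eq_iff, add_div]
  rw [e] at h
  constructor <;> linarith [h.1, h.2]

theorem cen_congr {a b : ℝ} (h : lev X.N b = lev X.N a) : X.cen b = X.cen a := by
  rw [cen, cen, h]

theorem mem_carrier_of_near {a b : ℝ} (ha : a ∈ X.carrier) (h : |b - X.cen a| < X.w / 2) :
    b ∈ X.carrier := by
  have h1 := X.lev_of_near h
  refine ⟨h1 ▸ ha.1, ?_⟩
  rwa [X.cen_congr h1]

theorem carrier_sub : X.carrier ⊆ Ico 0 1 := by
  intro a ha
  have hp : (0 : ℝ) < 2 ^ X.N := by positivity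
  obtain ⟨h1, h2⟩ := X.I_sub ha.1
  have h3 := lev_eq_iff.1 (rfl : lev X.N a = lev X.N a)
  refine ⟨le_trans ?_ h3.1, h3.2.trans_le ?_⟩
  · have : (0 : ℝ) ≤ lev X.N a := by exact_mod_cast h1
    positivity
  · rw [div_le_one hp]
    exact_mod_cast h2

/-- The rectangles that are products of the intervals of two families. -/
def cells (σ : ℝ × ℝ → ℝ) (hσ : Measurable σ) (habs : ∀ c, |σ c| = 1) : Cells where
  w := X.w
  h := Y.w
  w_pos := X.w_pos
  h_pos := Y.w_pos
  carrier := {x | rep x.1 ∈ X.carrier ∧ rep x.2 ∈ Y.carrier}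
  cen x := (X.cen (rep x.1), Y.cen (rep x.2))
  sgn x := σ (X.cen (rep x.1), Y.cen (rep x.2))
  measurableSet_carrier :=
    ((measurable_rep.comp measurable_fst) X.measurableSet_carrier).inter
      ((measurable_rep.comp measurable_snd) Y.measurableSet_carrier)
  measurable_cen := (X.measurable_cen.comp (measurable_rep.comp measurable_fst)).prodMk
    (Y.measurable_cen.comp (measurable_rep.comp measurable_snd))
  measurable_sgn := hσ.comp ((X.measurable_cen.comp (measurable_rep.comp measurable_fst)).prodMk
    (Y.measurable_cen.comp (measurable_rep.comp measurable_snd)))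
  abs_sgn _ := habs _
  rep2_mem_box x hx := (mem_box X.w_pos Y.w_pos).2 ⟨hx.1.2, hx.2.2⟩
  box_subset x hx q hq := by
    rw [mem_box X.w_pos Y.w_pos] at hq
    exact ⟨X.carrier_sub (X.mem_carrier_of_near hx.1 hq.1),
      Y.carrier_sub (Y.mem_carrier_of_near hx.2 hq.2)⟩
  mem_of_mem_box x hx q hq := by
    rw [mem_box X.w_pos Y.w_pos] at hq
    have h1 := X.mem_carrier_of_near hx.1 hq.1
    have h2 := Y.mem_carrier_of_near hx.2 hq.2
    have e := rep2_mk2 (q := q) ⟨X.carrier_sub h1, Y.carrier_sub h2⟩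
    change (rep2 (mk2 q)).1 ∈ _ ∧ (rep2 (mk2 q)).2 ∈ _
    rw [e]
    exact ⟨h1, h2⟩
  cen_of_mem_box x hx q hq := by
    rw [mem_box X.w_pos Y.w_pos] at hq
    have h1 := X.mem_carrier_of_near hx.1 hq.1
    have h2 := Y.mem_carrier_of_near hx.2 hq.2
    have e := rep2_mk2 (q := q) ⟨X.carrier_sub h1, Y.carrier_sub h2⟩
    change (X.cen (rep2 (mk2 q)).1, Y.cen (rep2 (mk2 q)).2) = _
    rw [e, X.cen_congr (X.lev_of_near hq.1), Y.cen_congr (Y.lev_of_near hq.2)]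
  sgn_of_mem_box x hx q hq := by
    rw [mem_box X.w_pos Y.w_pos] at hq
    have h1 := X.mem_carrier_of_near hx.1 hq.1
    have h2 := Y.mem_carrier_of_near hx.2 hq.2
    have e := rep2_mk2 (q := q) ⟨X.carrier_sub h1, Y.carrier_sub h2⟩
    change σ (X.cen (rep2 (mk2 q)).1, Y.cen (rep2 (mk2 q)).2) = _
    rw [e, X.cen_congr (X.lev_of_near hq.1), Y.cen_congr (Y.lev_of_near hq.2)]
  countable_cen := by
    refine (countable_range fun p : ℤ × ℤ =>
      (((p.1 : ℝ) + 1 / 2) / 2 ^ X.N, ((p.2 : ℝ) + 1 / 2) / 2 ^ Y.N)).mono ?_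
    rintro _ ⟨x, -, rfl⟩
    exact ⟨(lev X.N (rep x.1), lev Y.N (rep x.2)), rfl⟩

variable {X Y} {σ : ℝ × ℝ → ℝ} {hσ : Measurable σ} {habs : ∀ c, |σ c| = 1}

/-- The flow preserves the dyadic intervals of both coordinates. -/
theorem lev_map_cells (τ : ℝ) (x : T2) :
    lev X.N (rep ((X.cells Y σ hσ habs).map τ x).1) = lev X.N (rep x.1) ∧
      lev Y.N (rep ((X.cells Y σ hσ habs).map τ x).2) = lev Y.N (rep x.2) := by
  have h := (X.cells Y σ hσ habs).cen_mapFun x τ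
  have h1 : X.cen (rep ((X.cells Y σ hσ habs).map τ x).1) = X.cen (rep x.1) :=
    congrArg Prod.fst h
  have h2 : Y.cen (rep ((X.cells Y σ hσ habs).map τ x).2) = Y.cen (rep x.2) :=
    congrArg Prod.snd h
  rw [← X.lev_cen, h1, X.lev_cen, ← Y.lev_cen (rep _), h2, Y.lev_cen]
  exact ⟨rfl, rfl⟩

/-- After a half turn every rectangle is reflected in its centre. -/
theorem rep2_map_cells_of_mem {τ : ℝ} (hτ : angSpeed X.w Y.w * τ = 4) {x : T2}
    (h1 : rep x.1 ∈ X.carrier) (h2 : rep x.2 ∈ Y.carrier) :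
    rep2 ((X.cells Y σ hσ habs).map τ x) =
      (2 * X.cen (rep x.1) - rep x.1, 2 * Y.cen (rep x.2) - rep x.2) := by
  have hx : x ∈ (X.cells Y σ hσ habs).carrier := ⟨h1, h2⟩
  rw [Cells.map_apply, Cells.rep2_mapFun hx]
  have e : boxRot X.w Y.w (X.cen (rep x.1), Y.cen (rep x.2))
      ((X.cells Y σ hσ habs).ang x τ) (rep2 x) =
      (X.cen (rep x.1), Y.cen (rep x.2)) + (X.cen (rep x.1), Y.cen (rep x.2)) - rep2 x := by
    have ha : (X.cells Y σ hσ habs).ang x τ = (X.cells Y σ hσ habs).sgn x * 4 := by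
      rw [Cells.ang, mul_assoc, ← hτ]; rfl
    rcases eq_or_eq_neg_of_abs_eq ((X.cells Y σ hσ habs).abs_sgn x) with hs | hs
    · rw [ha, hs, one_mul, boxRot_four X.w_pos Y.w_pos]
    · rw [ha, hs, neg_one_mul, boxRot_neg_four X.w_pos Y.w_pos]
  refine e.trans ?_
  ext <;> simp [rep2] <;> ring

theorem map_cells_of_notMem (τ : ℝ) {x : T2}
    (h : ¬(rep x.1 ∈ X.carrier ∧ rep x.2 ∈ Y.carrier)) :
    (X.cells Y σ hσ habs).map τ x = x :=
  Cells.mapFun_of_notMem (C := X.cells Y σ hσ habs) h τ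

end Strips

/-! ### The strips of a binary swap -/

/-- The indices of the dyadic intervals of level `k - 1` in the `n`-th slab. -/
def slabIdx (k n : ℕ) : Set ℤ :=
  Ico (((n : ℤ) - 1) * 2 ^ (k - 1 - k / 2)) ((n : ℤ) * 2 ^ (k - 1 - k / 2))

namespace Idx

variable (P : Idx)

theorem one_le_k : 1 ≤ P.k := P.one_le_m.trans P.m_le_k

theorem slabIdx_sub : slabIdx P.k P.n ⊆ Ico 0 (2 ^ (P.k - 1)) := by
  rintro r ⟨h1, h2⟩
  have hn : (1 : ℤ) ≤ P.n := by exact_mod_cast P.one_le_n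
  have hn2 : (P.n : ℤ) ≤ 2 ^ (P.k / 2) := by exact_mod_cast P.n_le
  have hk := P.one_le_k
  refine ⟨le_trans (mul_nonneg (by omega) (by positivity)) h1, h2.trans_le ?_⟩
  calc (P.n : ℤ) * 2 ^ (P.k - 1 - P.k / 2) ≤ 2 ^ (P.k / 2) * 2 ^ (P.k - 1 - P.k / 2) := by gcongr
    _ = 2 ^ (P.k - 1) := by rw [← pow_add]; congr 1; omega

/-- The intervals of length `2⁻ᵏ` that are rotated in the first phase. -/
def outer : Strips where
  N := P.k - 1
  w := 1 / 2 ^ P.k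
  w_pos := by positivity
  w_le := one_div_le_one_div_of_le (by positivity) (pow_le_pow_right₀ (by norm_num) (by omega))
  I := slabIdx P.k P.n
  I_sub := P.slabIdx_sub

/-- The intervals of length `2⁻ᵏ⁻¹` that are rotated in the second phase. -/
def inner : Strips where
  N := P.k + 1
  w := 1 / 2 ^ (P.k + 1)
  w_pos := by positivity
  w_le := le_rfl
  I := {r | r / 4 ∈ slabIdx P.k P.n ∧ (r % 4 = 1 ∨ r % 4 = 2)}
  I_sub := by
    rintro r ⟨h1, -⟩
    have h := P.slabIdx_sub h1
    have hk := P.one_le_k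
    have e : (2 : ℤ) ^ (P.k + 1) = 4 * 2 ^ (P.k - 1) := by
      rw [show P.k + 1 = 2 + (P.k - 1) by omega, pow_add]; norm_num
    rw [mem_Ico] at h ⊢
    rw [e]
    omega

end Idx

/-- All dyadic intervals of level `L`. -/
def fullStrips (L : ℕ) : Strips where
  N := L
  w := 1 / 2 ^ L
  w_pos := by positivity
  w_le := le_rfl
  I := Ico 0 (2 ^ L)
  I_sub := subset_rfl

/-- The orientation of the rotation in the strip of level `L` containing `b`. -/
def parity (L : ℕ) (b : ℝ) : ℝ := if Even (lev L b) then -1 else 1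

theorem measurable_parity (L : ℕ) : Measurable (parity L) :=
  (measurable_of_countable fun r : ℤ => if Even r then (-1 : ℝ) else 1).comp (measurable_lev L)

theorem abs_parity (L : ℕ) (b : ℝ) : |parity L b| = 1 := by
  unfold parity; split_ifs <;> simp

/-- Rectangles in `X × (strips of level L)` with alternating orientation, or their reflection. -/
def orient (i L : ℕ) (X : Strips) : Cells :=
  if i = 1 then X.cells (fullStrips L) (fun c => parity L c.2)
    ((measurable_parity L).comp measurable_snd) (fun _ => abs_parity _ _)
  else (fullStrips L).cells X (fun c => -parity L c.1)
    ((measurable_parity L).comp measurable_fst).neg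
    (fun _ => by rw [abs_neg]; exact abs_parity _ _)

/-! ### Generic points -/

/-- Points that are not dyadic rationals. -/
def NonDyadic (a : ℝ) : Prop := ∀ (N : ℕ) (r : ℤ), a ≠ r / 2 ^ N

/-- Points of the torus with non-dyadic coordinates, off the diagonals of all dyadic rectangles. -/
structure Generic (x : T2) : Prop where
  fst : NonDyadic (rep x.1)
  snd : NonDyadic (rep x.2)
  off : ∀ (p q N M : ℕ) (r s : ℤ), |(rep x.1 - (r + 1 / 2) / 2 ^ N) / (1 / 2 ^ p)| ≠
    |(rep x.2 - (s + 1 / 2) / 2 ^ M) / (1 / 2 ^ q)|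

theorem Generic.swap {x : T2} (h : Generic x) : Generic x.swap :=
  ⟨h.snd, h.fst, fun p q N M r s => (h.off q p M N s r).symm⟩

theorem ae_nonDyadic : ∀ᵐ a : ℝ, NonDyadic a := by
  unfold NonDyadic
  rw [ae_all_iff]
  intro N
  rw [ae_all_iff]
  intro r
  rw [ae_iff]
  simp

theorem ae_off_diagonals (w h : ℝ) (hw : 0 < w) (hh : 0 < h) (c : ℝ × ℝ) :
    ∀ᵐ q : ℝ × ℝ, |(q.1 - c.1) / w| ≠ |(q.2 - c.2) / h| := by
  have hd1 := measure_eq_zero_iff_ae_notMem.1 (volume_diagonal (h / w))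
  have hd2 := measure_eq_zero_iff_ae_notMem.1 (volume_diagonal (-(h / w)))
  have hT := (measurePreserving_sub_right (volume : Measure (ℝ × ℝ)) c).quasiMeasurePreserving
  filter_upwards [hT.ae hd1, hT.ae hd2] with q h1 h2 h3
  rcases abs_eq_abs.1 h3 with h4 | h4
  · apply h1
    simp only [Prod.fst_sub, Prod.snd_sub]
    rw [div_eq_iff hw.ne'] at h4
    rw [h4]; field_simp
  · apply h2
    simp only [Prod.fst_sub, Prod.snd_sub]
    rw [div_eq_iff hw.ne'] at h4
    rw [h4]; field_simp

theorem ae_generic : ∀ᵐ x : T2, Generic x := by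
  have hrep : ∀ᵐ a : UnitAddCircle, NonDyadic (rep a) :=
    measurePreserving_rep.quasiMeasurePreserving.ae (ae_restrict_of_ae ae_nonDyadic)
  have h1 : ∀ᵐ x : T2, NonDyadic (rep x.1) := Measure.quasiMeasurePreserving_fst.ae hrep
  have h2 : ∀ᵐ x : T2, NonDyadic (rep x.2) := Measure.quasiMeasurePreserving_snd.ae hrep
  have h3 : ∀ᵐ x : T2, ∀ (p q N M : ℕ) (r s : ℤ),
      |(rep x.1 - (r + 1 / 2) / 2 ^ N) / (1 / 2 ^ p)| ≠
        |(rep x.2 - (s + 1 / 2) / 2 ^ M) / (1 / 2 ^ q)| := by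
    simp only [ae_all_iff]
    intro p q N M r s
    exact measurePreserving_rep2.quasiMeasurePreserving.ae (ae_restrict_of_ae
      (ae_off_diagonals (1 / 2 ^ p) (1 / 2 ^ q) (by positivity) (by positivity)
        (((r : ℝ) + 1 / 2) / 2 ^ N, ((s : ℝ) + 1 / 2) / 2 ^ M)))
  filter_upwards [h1, h2, h3] with x a b c using ⟨a, b, c⟩

theorem NonDyadic.lev_lt {a : ℝ} (h : NonDyadic a) (N : ℕ) : (lev N a : ℝ) / 2 ^ N < a :=
  lt_of_le_of_ne (lev_eq_iff.1 rfl).1 (h N _).symm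

theorem lt_lev_add_one (N : ℕ) (a : ℝ) : a < (lev N a + 1) / 2 ^ N := (lev_eq_iff.1 rfl).2

theorem NonDyadic.mem_fullStrips {b : ℝ} (h : NonDyadic b) (hb : b ∈ Ico (0 : ℝ) 1) (L : ℕ) :
    b ∈ (fullStrips L).carrier := by
  refine ⟨⟨lev_nonneg hb.1 _, Mixing.lev_lt hb.2 _⟩, ?_⟩
  have h1 := h.lev_lt L
  have h2 := lt_lev_add_one L b
  change |b - (lev L b + 1 / 2) / 2 ^ L| < 1 / 2 ^ L / 2
  rw [add_div, div_div] at *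
  have e : (1 : ℝ) / (2 * 2 ^ L) = (1 / 2 ^ L) / 2 := by field_simp
  rw [abs_lt, e]
  constructor <;> linarith

namespace Idx

variable {P : Idx}

theorem lev_pred_k (a : ℝ) : lev (P.k - 1) a = lev (P.k + 1) a / 4 := by
  have hk := P.one_le_k
  rw [lev_of_le (show P.k - 1 ≤ P.k + 1 by omega)]
  congr 1
  rw [show P.k + 1 - (P.k - 1) = 2 by omega]; norm_num

theorem inv_two_pow_k : (1 : ℝ) / 2 ^ P.k = 2 * (1 / 2 ^ (P.k + 1)) := by
  rw [pow_succ]; field_simp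

theorem inv_two_pow_pred_k : (1 : ℝ) / 2 ^ (P.k - 1) = 4 * (1 / 2 ^ (P.k + 1)) := by
  have hk := P.one_le_k
  rw [show P.k + 1 = P.k - 1 + 2 by omega, pow_add]; field_simp; norm_num

theorem cen_outer (a : ℝ) :
    P.outer.cen a = (4 * (lev (P.k + 1) a / 4 : ℤ) + 2) * (1 / 2 ^ (P.k + 1)) := by
  change ((lev (P.k - 1) a : ℝ) + 1 / 2) / 2 ^ (P.k - 1) = _
  rw [div_eq_mul_one_div, P.inv_two_pow_pred_k, P.lev_pred_k]
  ring

theorem cen_inner (a : ℝ) :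
    P.inner.cen a = (lev (P.k + 1) a + 1 / 2) * (1 / 2 ^ (P.k + 1)) := by
  change ((lev (P.k + 1) a : ℝ) + 1 / 2) / 2 ^ (P.k + 1) = _
  rw [div_eq_mul_one_div]

/-- The middle half of a dyadic interval of level `k - 1` is made of its second and third quarters,
where the digits `k` and `k + 1` are `01` and `10`. By `mem_inner` the second phase acts on the same
non-dyadic points. -/
theorem mem_outer {a : ℝ} (ha : NonDyadic a) : a ∈ P.outer.carrier ↔
    lev (P.k - 1) a ∈ slabIdx P.k P.n ∧ (lev (P.k + 1) a % 4 = 1 ∨ lev (P.k + 1) a % 4 = 2) := by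
  refine and_congr Iff.rfl ?_
  have h1 := ha.lev_lt (P.k + 1)
  have h2 := lt_lev_add_one (P.k + 1) a
  have hV : (0 : ℝ) < 1 / 2 ^ (P.k + 1) := by positivity
  change |a - P.outer.cen a| < 1 / 2 ^ P.k / 2 ↔ _
  rw [P.cen_outer, P.inv_two_pow_k, mul_div_cancel_left₀ _ (by norm_num : (2 : ℝ) ≠ 0), abs_lt]
  rw [div_eq_mul_one_div] at h1 h2
  set V : ℝ := 1 / 2 ^ (P.k + 1)
  set A := lev (P.k + 1) a
  have hA : A = 4 * (A / 4) + A % 4 := by omega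
  have hAr : (A : ℝ) = 4 * ((A / 4 : ℤ) : ℝ) + ((A % 4 : ℤ) : ℝ) := by exact_mod_cast hA
  have hm : A % 4 = 0 ∨ A % 4 = 1 ∨ A % 4 = 2 ∨ A % 4 = 3 := by omega
  rw [hAr] at h1 h2
  rcases hm with h | h | h | h <;> rw [h] at h1 h2 ⊢ <;> push_cast at h1 h2
  · simp only [show ¬((0 : ℤ) = 1 ∨ (0 : ℤ) = 2) by omega, iff_false]
    rintro ⟨h3, -⟩; nlinarith
  · simp only [true_or, iff_true]
    constructor <;> nlinarith
  · simp only [or_true, iff_true]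
    constructor <;> nlinarith
  · simp only [show ¬((3 : ℤ) = 1 ∨ (3 : ℤ) = 2) by omega, iff_false]
    rintro ⟨-, h3⟩; nlinarith

theorem mem_inner {a : ℝ} (ha : NonDyadic a) : a ∈ P.inner.carrier ↔
    lev (P.k - 1) a ∈ slabIdx P.k P.n ∧ (lev (P.k + 1) a % 4 = 1 ∨ lev (P.k + 1) a % 4 = 2) := by
  have h1 := ha.lev_lt (P.k + 1)
  have h2 := lt_lev_add_one (P.k + 1) a
  have h3 : |a - P.inner.cen a| < 1 / 2 ^ (P.k + 1) / 2 := by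
    rw [P.cen_inner, abs_lt]
    rw [div_eq_mul_one_div] at h1 h2
    constructor <;> linarith
  rw [P.lev_pred_k]
  exact ⟨fun h => h.1, fun h => ⟨h, h3⟩⟩

end Idx

/-! ### The field of a binary swap -/

theorem sqField_swap {p : ℝ × ℝ} (hp : |p.1| ≠ |p.2|) : sqField p.swap = -(sqField p).swap := by
  unfold sqField
  rcases lt_or_gt_of_ne hp with h | h
  · rw [if_pos (by simpa using h), if_neg (not_lt.2 h.le)]; simp
  · rw [if_neg (by simpa using h.le), if_pos h]; simp

/-- Reflection in the diagonal reverses the sense of rotation. This is the origin of the minus sign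
of the parity in `orient`. -/
theorem boxField_swap {w h : ℝ} {z : ℝ × ℝ} (hz : |z.1 / w| ≠ |z.2 / h|) :
    boxField h w z.swap = -(boxField w h z).swap := by
  have e : scale h⁻¹ w⁻¹ z.swap = (scale w⁻¹ h⁻¹ z).swap := rfl
  have hp : |(scale w⁻¹ h⁻¹ z).1| ≠ |(scale w⁻¹ h⁻¹ z).2| := by
    simp only [scale]
    rwa [mul_comm, ← div_eq_mul_inv, mul_comm, ← div_eq_mul_inv]
  rw [boxField, boxField, e, sqField_swap hp, angSpeed, angSpeed, max_comm]
  ext <;> simp [scale]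

theorem vel_orient_swap {i L p : ℕ} (hi : i ≠ 1) {X : Strips} (hX : X.w = 1 / 2 ^ p) {x : T2}
    (hx : Generic x) : (orient i L X).vel x = ((orient 1 L X).vel x.swap).swap := by
  rw [orient, if_neg hi, orient, if_pos rfl]
  by_cases h : rep x.1 ∈ (fullStrips L).carrier ∧ rep x.2 ∈ X.carrier
  · rw [Cells.vel_of_mem (by exact h), Cells.vel_of_mem (by exact ⟨h.2, h.1⟩)]
    have hz := hx.swap.off p L X.N L (lev X.N (rep x.2)) (lev L (rep x.1))
    rw [← hX] at hz
    have := boxField_swap (w := X.w) (h := 1 / 2 ^ L)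
      (z := rep2 x.swap - (X.cen (rep x.2), (fullStrips L).cen (rep x.1))) hz
    change (-parity L ((fullStrips L).cen (rep x.1))) • boxField (1 / 2 ^ L) X.w
      (rep2 x.swap - (X.cen (rep x.2), (fullStrips L).cen (rep x.1))).swap = _
    rw [this, smul_neg, neg_smul, neg_neg]
    rfl
  · rw [Cells.vel_of_notMem (by exact h), Cells.vel_of_notMem (by exact fun h' => h ⟨h'.2, h'.1⟩)]
    rfl

theorem vel_orient_one {L p : ℕ} {X : Strips} (hX : X.w = 1 / 2 ^ p) {x : T2} (hx : Generic x) :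
    (orient 1 L X).vel x = open Classical in if rep x.1 ∈ X.carrier then
      parity L (rep x.2) • rotField X.w (1 / 2 ^ L)
        (rep x.1 - X.cen (rep x.1), rep x.2 - (lev L (rep x.2) + 1 / 2) * (1 / 2 ^ L)) else 0 := by
  have hb := hx.snd.mem_fullStrips (rep_mem x.2) L
  rw [orient, if_pos rfl]
  split_ifs with h
  · rw [Cells.vel_of_mem (by exact ⟨h, hb⟩)]
    have hz := hx.off p L X.N L (lev X.N (rep x.1)) (lev L (rep x.2))
    rw [← hX] at hz
    have := rotField_eq_boxField (w := X.w) (h := 1 / 2 ^ L) X.w_pos (by positivity)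
      (z := rep2 x - (X.cen (rep x.1), (fullStrips L).cen (rep x.2))) hz
    have e : (rep x.1 - X.cen (rep x.1), rep x.2 - ((lev L (rep x.2) : ℝ) + 1 / 2) * (1 / 2 ^ L))
        = rep2 x - (X.cen (rep x.1), (fullStrips L).cen (rep x.2)) := by
      simp only [rep2, Prod.mk_sub_mk]
      rw [← div_eq_mul_one_div]; rfl
    rw [e, this]
    change parity L ((fullStrips L).cen (rep x.2)) • _ = _
    congr 1
    simp only [parity]
    rw [show lev L ((fullStrips L).cen (rep x.2)) = lev L (rep x.2) from
      (fullStrips L).lev_cen _]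
  · exact Cells.vel_of_notMem (by exact fun h' => h h'.1)

/-- The endpoints of the slab are multiples of `2^{-(k-1)}`, so membership can be read off from the
level `k - 1`. The closed right endpoint is dyadic and plays no role. -/
theorem Idx.swap_condition (P : Idx) {a : ℝ} (ha : NonDyadic a) :
    (a ∈ slab P.k P.n ∧ a - 2 * (1 / 2 ^ P.k) * ⌊a / (2 * (1 / 2 ^ P.k))⌋ - 1 / 2 ^ P.k / 2 ∈
      Ioo (0 : ℝ) (1 / 2 ^ P.k)) ↔ a ∈ P.outer.carrier := by
  have hk := P.one_le_k
  have hd : (2 : ℝ) * (1 / 2 ^ P.k) = 1 / 2 ^ (P.k - 1) := by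
    rw [P.inv_two_pow_pred_k, P.inv_two_pow_k]; ring
  have hfl : ⌊a / (1 / 2 ^ (P.k - 1))⌋ = lev (P.k - 1) a := by
    rw [lev]; congr 1; field_simp
  rw [hd, hfl]
  have hslab : a ∈ slab P.k P.n ↔ lev (P.k - 1) a ∈ slabIdx P.k P.n := by
    have hp : (2 : ℝ) ^ (P.k - 1) = 2 ^ (P.k - 1 - P.k / 2) * 2 ^ (P.k / 2) := by
      rw [← pow_add]; congr 1; omega
    have e1 : ∀ r : ℝ, r / 2 ^ (P.k / 2) = r * 2 ^ (P.k - 1 - P.k / 2) / 2 ^ (P.k - 1) := by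
      intro r; rw [hp]; field_simp
    have n1 := ha (P.k - 1) ((P.n : ℤ) * 2 ^ (P.k - 1 - P.k / 2))
    rw [slab, slabIdx, mem_Icc, mem_Ico, e1, e1, lev, Int.le_floor, Int.floor_lt,
      div_le_iff₀ (by positivity), le_div_iff₀ (by positivity), mul_comm a]
    push_cast at n1 ⊢
    refine and_congr Iff.rfl ⟨fun h => lt_of_le_of_ne h ?_, le_of_lt⟩
    intro h'
    apply n1
    rw [← h']; field_simp
  rw [hslab]
  refine and_congr Iff.rfl ?_
  change _ ↔ |a - P.outer.cen a| < 1 / 2 ^ P.k / 2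
  rw [P.cen_outer, ← P.lev_pred_k, P.inv_two_pow_pred_k, P.inv_two_pow_k, abs_lt, mem_Ioo]
  constructor <;> rintro ⟨h1, h2⟩ <;> constructor <;> linarith

/-- The binary swap field is the field of rotating rectangles in each of its two phases. -/
theorem swapField_eq (P : Idx) (L : ℕ) {x : T2} (hx : Generic x) (t : ℝ) :
    swapField P.i P.k P.n L t x =
      if t < 2 * (1 / 2 ^ P.k) then (orient P.i L P.outer).vel x
      else (orient P.i L P.inner).vel x := by
  have one : ∀ x, Generic x → swapFst P.k P.n L t x =
      if t < 2 * (1 / 2 ^ P.k) then (orient 1 L P.outer).vel x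
      else (orient 1 L P.inner).vel x := by
    clear hx x
    intro x hx
    classical
    have hfl : ⌊rep x.2 / (1 / 2 ^ L)⌋ = lev L (rep x.2) := by
      rw [lev]; congr 1; field_simp
    have hd : (2 : ℝ) * (1 / 2 ^ P.k) = 1 / 2 ^ (P.k - 1) := by
      rw [P.inv_two_pow_pred_k, P.inv_two_pow_k]; ring
    have hfl' : ⌊rep x.1 / (2 * (1 / 2 ^ P.k))⌋ = lev (P.k - 1) (rep x.1) := by
      rw [lev, hd]; congr 1; field_simp
    rw [swapFst, vel_orient_one (p := P.k) (X := P.outer) rfl hx,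
      vel_orient_one (p := P.k + 1) (X := P.inner) rfl hx]
    by_cases hc : rep x.1 ∈ P.outer.carrier
    · rw [if_pos ((P.swap_condition hx.fst).2 hc), if_pos hc,
        if_pos ((P.mem_inner hx.fst).2 ((P.mem_outer hx.fst).1 hc)), flipField]
      have hpar : (if Even (lev L (rep x.2)) then (-1 : ℝ) else 1) = parity L (rep x.2) := rfl
      simp only [hfl, hfl', hpar]
      have hmod := ((P.mem_outer hx.fst).1 hc).2
      have hV : (0 : ℝ) < 1 / 2 ^ (P.k + 1) := by positivity
      have h1 := hx.fst.lev_lt (P.k + 1)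
      have h2 := lt_lev_add_one (P.k + 1) (rep x.1)
      rw [div_eq_mul_one_div] at h1 h2
      have hw1 : P.outer.w = 2 * (1 / 2 ^ (P.k + 1)) := P.inv_two_pow_k
      have hw2 : P.inner.w = 1 / 2 ^ (P.k + 1) := rfl
      rw [hw1, hw2, P.lev_pred_k, P.cen_outer, P.cen_inner, P.inv_two_pow_k]
      set V : ℝ := 1 / 2 ^ (P.k + 1)
      set A := lev (P.k + 1) (rep x.1)
      have hAr : (A : ℝ) = 4 * ((A / 4 : ℤ) : ℝ) + ((A % 4 : ℤ) : ℝ) := by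
        exact_mod_cast (by omega : A = 4 * (A / 4) + A % 4)
      split_ifs with ht hz
      · congr 3; ring
      · rw [mul_div_cancel_left₀ _ (by norm_num : (2 : ℝ) ≠ 0)] at hz ⊢
        have : A % 4 = 1 := by
          rcases hmod with h | h
          · exact h
          · rw [hAr, h] at h1 h2; push_cast at h1 h2; nlinarith
        congr 3
        rw [hAr, this]; push_cast; ring
      · rw [mul_div_cancel_left₀ _ (by norm_num : (2 : ℝ) ≠ 0)] at hz ⊢
        have : A % 4 = 2 := by
          rcases hmod with h | h
          · rw [hAr, h] at h1 h2; push_cast at h1 h2; nlinarith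
          · exact h
        congr 3
        rw [hAr, this]; push_cast; ring
    · rw [if_neg (fun h => hc ((P.swap_condition hx.fst).1 h)), if_neg hc,
        if_neg (fun h => hc ((P.mem_outer hx.fst).2 ((P.mem_inner hx.fst).1 h)))]
      simp
  rw [swapField]
  rcases P.i_mem with hi | hi
  · rw [if_pos hi, one x hx, hi]
  · have hi1 : P.i ≠ 1 := by omega
    rw [if_neg hi1, one _ hx.swap, vel_orient_swap (p := P.k) hi1 rfl hx,
      vel_orient_swap (p := P.k + 1) hi1 rfl hx]
    split_ifs <;> rfl

/-! ### The action of a binary swap on digits -/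

/-- The `c`-th coordinate of a point of the torus, as a number in `[0,1)`. -/
def crd (c : ℕ) (x : T2) : ℝ := if c = 1 then rep x.1 else rep x.2

theorem measurable_crd (c : ℕ) : Measurable (crd c) := by
  unfold crd
  split_ifs
  · exact measurable_rep.comp measurable_fst
  · exact measurable_rep.comp measurable_snd

theorem crd_mem (c : ℕ) (x : T2) : crd c x ∈ Ico (0 : ℝ) 1 := by
  unfold crd; split_ifs <;> exact rep_mem _

/-- The exchange of the binary digits `k` and `k + 1`. -/
def digitSwap (k : ℕ) (a : ℝ) : ℝ :=
  if lev (k + 1) a % 4 = 1 then a + 1 / 2 ^ (k + 1)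
  else if lev (k + 1) a % 4 = 2 then a - 1 / 2 ^ (k + 1) else a

open Classical in
/-- The exchange of the binary digits `k` and `k + 1` in the `n`-th slab. -/
def slabSwap (k n : ℕ) (a : ℝ) : ℝ :=
  if lev (k - 1) a ∈ slabIdx k n then digitSwap k a else a

theorem Strips.reflect_mem {X : Strips} {a : ℝ} (ha : a ∈ X.carrier) :
    2 * X.cen a - a ∈ X.carrier ∧ X.cen (2 * X.cen a - a) = X.cen a := by
  have h : |2 * X.cen a - a - X.cen a| < X.w / 2 := by
    have := ha.2
    rw [abs_sub_comm] at this
    convert this using 2; ring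
  exact ⟨X.mem_carrier_of_near ha h, X.cen_congr (X.lev_of_near h)⟩

/-- Two point reflections compose to the translation by twice the difference of the centres. The
centre of the middle half and that of the quarter reached by the first reflection are `2^{-(k+2)}`
apart, so the quarters `01` and `10` are exchanged by translations of length `2^{-(k+1)}`. -/
theorem Idx.reflect_reflect (P : Idx) {a : ℝ} (ha : NonDyadic a) :
    (a ∈ P.outer.carrier ∧ 2 * P.outer.cen a - a ∈ P.inner.carrier ∧
      2 * P.inner.cen (2 * P.outer.cen a - a) - (2 * P.outer.cen a - a) = slabSwap P.k P.n a) ∨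
    (a ∉ P.outer.carrier ∧ a ∉ P.inner.carrier ∧ slabSwap P.k P.n a = a) := by
  by_cases hc : a ∈ P.outer.carrier
  · left
    have hc' := hc
    rw [P.mem_outer ha] at hc'
    obtain ⟨h1, h2⟩ := hc'
    have b1 := ha.lev_lt (P.k + 1)
    have b2 := lt_lev_add_one (P.k + 1) a
    have h3 : lev (P.k - 1) (2 * P.outer.cen a - a) = lev (P.k - 1) a :=
      P.outer.lev_of_near (a := a) (by
        have := hc.2
        rw [abs_sub_comm] at this
        convert this using 2; ring)
    -- Writing the index of the quarter as `4s + r`, the first reflection maps it to `4s + 3 - r`.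
    have hlev : lev (P.k + 1) (2 * P.outer.cen a - a) =
        8 * (lev (P.k + 1) a / 4) + 3 - lev (P.k + 1) a := by
      rw [lev_eq_iff, P.cen_outer]
      rw [div_eq_mul_one_div] at b1 b2 ⊢
      rw [div_eq_mul_one_div (_ + 1 : ℝ)]
      push_cast
      constructor <;> nlinarith
    have hnd : NonDyadic (2 * P.outer.cen a - a) := by
      intro N r h
      rw [P.cen_outer] at h
      refine ha (N + (P.k + 1)) ((8 * (lev (P.k + 1) a / 4) + 4) * 2 ^ N - r * 2 ^ (P.k + 1)) ?_
      push_cast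
      rw [pow_add _ N (P.k + 1), sub_div]
      have e : (r : ℝ) * 2 ^ (P.k + 1) / (2 ^ N * 2 ^ (P.k + 1)) = r / 2 ^ N := by field_simp
      rw [e, ← h]
      field_simp
      ring
    have hin : 2 * P.outer.cen a - a ∈ P.inner.carrier := by
      rw [P.mem_inner hnd, h3]
      refine ⟨h1, ?_⟩
      rw [hlev]; omega
    refine ⟨hc, hin, ?_⟩
    rw [slabSwap, if_pos h1, digitSwap, P.cen_inner, hlev, P.cen_outer]
    have hAr : (lev (P.k + 1) a : ℝ) =
        4 * ((lev (P.k + 1) a / 4 : ℤ) : ℝ) + ((lev (P.k + 1) a % 4 : ℤ) : ℝ) := by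
      exact_mod_cast (by omega : lev (P.k + 1) a =
        4 * (lev (P.k + 1) a / 4) + lev (P.k + 1) a % 4)
    push_cast
    rcases h2 with h2 | h2
    · rw [if_pos h2, hAr, h2]; push_cast; ring
    · rw [if_neg (by omega), if_pos h2, hAr, h2]; push_cast; ring
  · right
    have hc' := hc
    rw [P.mem_outer ha] at hc'
    refine ⟨hc, by rwa [P.mem_inner ha], ?_⟩
    rw [slabSwap]
    split_ifs with h
    · rw [digitSwap, if_neg fun h' => hc' ⟨h, Or.inl h'⟩, if_neg fun h' => hc' ⟨h, Or.inr h'⟩]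
    · rfl

/-- The composition of the two phases of a binary swap. -/
def Idx.swapMap (P : Idx) (L : ℕ) : T2 ≃ᵐ T2 :=
  ((orient P.i L P.outer).map (2 * (1 / 2 ^ P.k))).trans
    ((orient P.i L P.inner).map (1 / 2 ^ P.k))

/-- The hypothesis on `L` makes the strips no higher than the rectangles are wide, so the angular
speed is governed by the width alone. The duration of the phase then corresponds to the angle 4,
half of the period 8. -/
theorem Idx.angSpeed_outer (P : Idx) {L : ℕ} (hL : P.k + 1 ≤ L) :
    angSpeed P.outer.w (fullStrips L).w * (2 * (1 / 2 ^ P.k)) = 4 := by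
  have h : (fullStrips L).w ≤ P.outer.w :=
    one_div_le_one_div_of_le (by positivity) (pow_le_pow_right₀ (by norm_num) (by omega))
  rw [angSpeed, max_eq_left h]
  change 2 / (1 / 2 ^ P.k) * (2 * (1 / 2 ^ P.k)) = (4 : ℝ)
  field_simp; norm_num

theorem Idx.angSpeed_inner (P : Idx) {L : ℕ} (hL : P.k + 1 ≤ L) :
    angSpeed P.inner.w (fullStrips L).w * (1 / 2 ^ P.k) = 4 := by
  have h : (fullStrips L).w ≤ P.inner.w :=
    one_div_le_one_div_of_le (by positivity) (pow_le_pow_right₀ (by norm_num) (by omega))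
  rw [angSpeed, max_eq_left h]
  change 2 / (1 / 2 ^ (P.k + 1)) * (1 / 2 ^ P.k) = (4 : ℝ)
  rw [pow_succ]
  field_simp; norm_num

theorem angSpeed_comm (w h : ℝ) : angSpeed w h = angSpeed h w := by
  rw [angSpeed, angSpeed, max_comm]

/-- Along the strips' own coordinate the two phases reflect in the same centre and cancel; the other
coordinate is handled by `reflect_reflect`. -/
theorem Idx.rep2_swapMap (P : Idx) {L : ℕ} (hL : P.k + 1 ≤ L) {x : T2} (hx : Generic x) :
    rep2 (P.swapMap L x) = if P.i = 1 then (slabSwap P.k P.n (rep x.1), rep x.2)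
      else (rep x.1, slabSwap P.k P.n (rep x.2)) := by
  have e : P.swapMap L x = (orient P.i L P.inner).map (1 / 2 ^ P.k)
    ((orient P.i L P.outer).map (2 * (1 / 2 ^ P.k)) x) := rfl
  rw [e]
  unfold orient
  split_ifs with hi
  · have hb := hx.snd.mem_fullStrips (rep_mem x.2) L
    have hb' := Strips.reflect_mem hb
    rcases P.reflect_reflect hx.fst with ⟨h1, h2, h3⟩ | ⟨h1, h2, h3⟩
    · have s1 := Strips.rep2_map_cells_of_mem (σ := fun c => parity L c.2)
        (hσ := (measurable_parity L).comp measurable_snd) (habs := fun _ => abs_parity _ _)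
        (P.angSpeed_outer hL) h1 hb
      have s11 := congrArg Prod.fst s1
      have s12 := congrArg Prod.snd s1
      simp only [rep2] at s11 s12
      rw [Strips.rep2_map_cells_of_mem (P.angSpeed_inner hL) (by rw [s11]; exact h2)
        (by rw [s12]; exact hb'.1), s11, s12, h3, hb'.2]
      simp
    · rw [Strips.map_cells_of_notMem _ (fun h => h1 h.1),
        Strips.map_cells_of_notMem _ (fun h => h2 h.1), h3]
      rfl
  · have hb := hx.fst.mem_fullStrips (rep_mem x.1) L
    have hb' := Strips.reflect_mem hb
    rcases P.reflect_reflect hx.snd with ⟨h1, h2, h3⟩ | ⟨h1, h2, h3⟩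
    · have s1 := Strips.rep2_map_cells_of_mem (σ := fun c => -parity L c.1)
        (hσ := ((measurable_parity L).comp measurable_fst).neg)
        (habs := fun _ => by rw [abs_neg]; exact abs_parity _ _)
        ((congrArg (· * _) (angSpeed_comm _ _)).trans (P.angSpeed_outer hL)) hb h1
      have s11 := congrArg Prod.fst s1
      have s12 := congrArg Prod.snd s1
      simp only [rep2] at s11 s12
      rw [Strips.rep2_map_cells_of_mem
        ((congrArg (· * _) (angSpeed_comm _ _)).trans (P.angSpeed_inner hL))
        (by rw [s11]; exact hb'.1) (by rw [s12]; exact h2), s11, s12, h3, hb'.2]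
      simp
    · rw [Strips.map_cells_of_notMem _ (fun h => h1 h.2),
        Strips.map_cells_of_notMem _ (fun h => h2 h.2), h3]
      rfl

theorem Idx.crd_swapMap (P : Idx) {L : ℕ} (hL : P.k + 1 ≤ L) {x : T2} (hx : Generic x)
    {c : ℕ} (hc : c = 1 ∨ c = 2) :
    crd c (P.swapMap L x) = if c = P.i then slabSwap P.k P.n (crd c x) else crd c x := by
  have h := P.rep2_swapMap hL hx
  have h1 := congrArg Prod.fst h
  have h2 := congrArg Prod.snd h
  simp only [rep2] at h1 h2
  rcases hc with rfl | rfl <;> rcases P.i_mem with hi | hi <;>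
    simp only [hi, crd, h1, h2] <;> simp

/-- During a swap with index `k` the first `k - 1` binary digits of both coordinates are
preserved. -/
theorem lev_orient {i L M : ℕ} {X : Strips} (hX : M ≤ X.N) (hL : M ≤ L) (c : ℕ) (τ : ℝ) (x : T2) :
    lev M (crd c ((orient i L X).map τ x)) = lev M (crd c x) := by
  have hL' : M ≤ (fullStrips L).N := hL
  unfold orient crd
  split_ifs with h1 h2 h2
  · rw [lev_of_le hX, (Strips.lev_map_cells τ x).1, ← lev_of_le hX]
  · rw [lev_of_le hL', (Strips.lev_map_cells τ x).1, ← lev_of_le hL']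
  · rw [lev_of_le hL', (Strips.lev_map_cells τ x).2, ← lev_of_le hL']
  · rw [lev_of_le hX, (Strips.lev_map_cells τ x).2, ← lev_of_le hX]

/-- The `j`-th binary digit. -/
def dig (j : ℕ) (a : ℝ) : ℤ := lev j a % 2

theorem lev_add_div (j k : ℕ) (h : k ≤ j) (a : ℝ) (e : ℤ) :
    lev j (a + e / 2 ^ k) = lev j a + e * 2 ^ (j - k) := by
  have : (2 : ℝ) ^ j * (a + e / 2 ^ k) = 2 ^ j * a + ((e * 2 ^ (j - k) : ℤ) : ℝ) := by
    have : (2 : ℝ) ^ j = 2 ^ k * 2 ^ (j - k) := by rw [← pow_add]; congr 1; omega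
    push_cast
    rw [this]; field_simp
  rw [lev, this, Int.floor_add_intCast, ← lev]

theorem digitSwap_eq (k : ℕ) (a : ℝ) : ∃ e : ℤ, digitSwap k a = a + e / 2 ^ (k + 1) ∧
    (lev (k + 1) a + e) / 4 = lev (k + 1) a / 4 ∧
    (lev (k + 1) a + e) % 2 = lev (k + 1) a / 2 % 2 ∧
    (lev (k + 1) a + e) / 2 % 2 = lev (k + 1) a % 2 := by
  unfold digitSwap
  split_ifs with h1 h2
  · refine ⟨1, by push_cast; ring, ?_⟩; omega
  · refine ⟨-1, by push_cast; ring, ?_⟩; omega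
  · refine ⟨0, by push_cast; ring, ?_⟩; omega

theorem lev_digitSwap {k j : ℕ} (hj : j < k) (a : ℝ) : lev j (digitSwap k a) = lev j a := by
  obtain ⟨e, he, h4, -, -⟩ := digitSwap_eq k a
  have hl : lev (k + 1) (digitSwap k a) = lev (k + 1) a + e := by
    rw [he, lev_add_div _ _ le_rfl]; simp
  have e2 : k + 1 - j = 2 + (k - 1 - j) := by omega
  have p : (2 : ℤ) ^ (k + 1 - j) = 4 * 2 ^ (k - 1 - j) := by rw [e2, pow_add]; norm_num
  rw [lev_of_le (show j ≤ k + 1 by omega), lev_of_le (show j ≤ k + 1 by omega), hl, p,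
    ← Int.ediv_ediv_of_nonneg (by norm_num), ← Int.ediv_ediv_of_nonneg (by norm_num), h4]

theorem dig_digitSwap (k j : ℕ) (a : ℝ) :
    dig j (digitSwap k a) = dig (Equiv.swap k (k + 1) j) a := by
  obtain ⟨e, he, h4, h1, h2⟩ := digitSwap_eq k a
  have hl : lev (k + 1) (digitSwap k a) = lev (k + 1) a + e := by
    rw [he, lev_add_div _ _ le_rfl]; simp
  have hd : ∀ b, lev k b = lev (k + 1) b / 2 := fun b => by
    rw [lev_of_le (Nat.le_succ k)]; simp
  rcases lt_trichotomy j k with h | h | h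
  · rw [Equiv.swap_apply_of_ne_of_ne (by omega) (by omega), dig, dig, lev_digitSwap h]
  · subst h
    rw [Equiv.swap_apply_left, dig, dig, hd, hl, h2]
  · rcases Nat.lt_or_ge (k + 1) j with h' | h'
    · rw [Equiv.swap_apply_of_ne_of_ne (by omega) (by omega), dig, dig, he,
        lev_add_div _ _ h'.le]
      have : (2 : ℤ) ^ (j - (k + 1)) = 2 * 2 ^ (j - (k + 1) - 1) := by
        rw [← pow_succ']; congr 1; omega
      rw [this, mul_left_comm]
      omega
    · obtain rfl : j = k + 1 := by omega
      rw [Equiv.swap_apply_right, dig, dig, hd, hl, h1]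

namespace Idx

/-! ### The time order -/

/-- The decisive feature is that `k` decreases within a block of constant `m`: digits from far out
are moved inwards one position at a time. In each block the truncated schedule omits an initial
stretch of the full one. -/
theorem timeLT_iff {P Q : Idx} : P.TimeLT Q ↔ P.m < Q.m ∨ P.m = Q.m ∧ (Q.k < P.k ∨ Q.k = P.k ∧
    (Q.i < P.i ∨ Q.i = P.i ∧ Q.n < P.n)) := by
  simp [TimeLT, lex4, Prod.Lex.toLex_lt_toLex]

theorem lt_iff {P Q : Idx} : P < Q ↔ P.k < Q.k ∨ P.k = Q.k ∧ (P.m < Q.m ∨ P.m = Q.m ∧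
    (P.i < Q.i ∨ P.i = Q.i ∧ P.n < Q.n)) := by
  have : P < Q ↔ lex4 P.k P.m P.i P.n < lex4 Q.k Q.m Q.i Q.n := Iff.rfl
  rw [this]
  simp [lex4, Prod.Lex.toLex_lt_toLex]

theorem k_le_of_le {P Q : Idx} (h : P ≤ Q) : P.k ≤ Q.k := by
  rcases h.lt_or_eq with h | rfl
  · rw [lt_iff] at h; omega
  · rfl

theorem TimeLT.trans {P Q R : Idx} (h : P.TimeLT Q) (h' : Q.TimeLT R) : P.TimeLT R := by
  rw [timeLT_iff] at *; omega

theorem not_timeLT_self (P : Idx) : ¬P.TimeLT P := by rw [timeLT_iff]; omega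

theorem timeLT_total {P Q : Idx} (h : P ≠ Q) : P.TimeLT Q ∨ Q.TimeLT P := by
  by_contra! hn
  rw [timeLT_iff, timeLT_iff] at hn
  exact h (Idx.ext (by omega) (by omega) (by omega) (by omega))

/-! ### Durations -/

theorem dur_pos (P : Idx) : 0 < P.dur := by unfold dur; positivity

/-- Indices grouped by their first entry. -/
def equivSigma : Idx ≃ Σ k : ℕ, Fin k × Fin 2 × Fin (2 ^ (k / 2)) where
  toFun P := ⟨P.k, ⟨P.m - 1, by have := P.one_le_m; have := P.m_le_k; omega⟩,
    ⟨P.i - 1, by have := P.i_mem; omega⟩, ⟨P.n - 1, by have := P.one_le_n; have := P.n_le; omega⟩⟩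
  invFun s := ⟨s.1, s.2.1 + 1, s.2.2.1 + 1, s.2.2.2 + 1, by omega, by omega, by omega, by omega,
    by omega⟩
  left_inv P := by
    have h1 := P.one_le_m
    have h2 := P.i_mem
    have h3 := P.one_le_n
    ext <;> simp <;> omega
  right_inv s := by simp

/-- There are `k · 2 · 2^{⌊k/2⌋}` indices with first entry `k`. The even `k` contribute `12 ∑ j
2^{-j} = 24`, and the odd ones `6 ∑ j 2^{-j} + 3 ∑ 2^{-j} = 18`. -/
theorem hasSum_dur : HasSum Idx.dur 42 := by
  set F : (Σ k : ℕ, Fin k × Fin 2 × Fin (2 ^ (k / 2))) → ℝ := fun s => 3 / 2 ^ s.1 with hF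
  have hfib : ∀ k : ℕ, HasSum (fun c => F ⟨k, c⟩) (6 * k * 2 ^ (k / 2) / 2 ^ k) := by
    intro k
    have h := hasSum_fintype (fun c : Fin k × Fin 2 × Fin (2 ^ (k / 2)) => F ⟨k, c⟩)
    convert h using 1
    simp [hF]
    ring
  have hgeo : HasSum (fun j : ℕ => (j : ℝ) * (1 / 2) ^ j) 2 := by
    have h := hasSum_coe_mul_geometric_of_norm_lt_one (r := (1 / 2 : ℝ)) (by norm_num)
    rwa [show (1 / 2 : ℝ) / (1 - 1 / 2) ^ 2 = 2 by norm_num] at h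
  have hgeo' : HasSum (fun j : ℕ => (1 / 2 : ℝ) ^ j) 2 := hasSum_geometric_two
  set g : ℕ → ℝ := fun k => 6 * k * 2 ^ (k / 2) / 2 ^ k with hgdef
  have hg : HasSum g 42 := by
    have he : HasSum (fun j : ℕ => g (2 * j)) (12 * 2) := by
      refine (hgeo.mul_left 12).congr_fun fun j => ?_
      simp only [hgdef]
      rw [Nat.mul_div_cancel_left _ (by norm_num), two_mul j, pow_add, one_div, inv_pow]
      push_cast; field_simp; ring
    have ho : HasSum (fun j : ℕ => g (2 * j + 1)) (6 * 2 + 3 * 2) := by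
      refine ((hgeo.mul_left 6).add (hgeo'.mul_left 3)).congr_fun fun j => ?_
      simp only [hgdef]
      rw [show (2 * j + 1) / 2 = j by omega, pow_succ, two_mul j, pow_add, one_div, inv_pow]
      push_cast; field_simp; ring
    have h := HasSum.even_add_odd he ho
    rwa [show (12 * 2 + (6 * 2 + 3 * 2) : ℝ) = 42 by norm_num] at h
  have hs : Summable F := by
    rw [summable_sigma_of_nonneg fun s => by positivity]
    exact ⟨fun k => (hfib k).summable, by simpa only [(hfib _).tsum_eq] using hg.summable⟩
  have h := HasSum.sigma_of_hasSum hg hfib hs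
  exact (equivSigma.hasSum_iff (f := F) (a := 42)).2 h

/-- The total duration of the swaps with index in `S`. -/
def total (S : Set Idx) : ℝ := ∑' Q, S.indicator dur Q

theorem summable_indicator (S : Set Idx) : Summable (S.indicator dur) :=
  hasSum_dur.summable.indicator S

theorem total_mono {S S' : Set Idx} (h : S ⊆ S') : total S ≤ total S' :=
  (summable_indicator S).tsum_le_tsum
    (indicator_le_indicator_of_subset h fun Q => Q.dur_pos.le) (summable_indicator S')

theorem total_union {S S' : Set Idx} (h : Disjoint S S') :
    total (S ∪ S') = total S + total S' := by
  rw [total, indicator_union_of_disjoint h]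
  exact (summable_indicator S).tsum_add (summable_indicator S')

theorem total_finset (S : Finset Idx) : total S = ∑ P ∈ S, P.dur := by
  rw [total, ← tsum_subtype, Finset.tsum_subtype']

theorem total_singleton (P : Idx) : total {P} = P.dur := by
  have := total_finset {P}
  rwa [Finset.coe_singleton, Finset.sum_singleton] at this

theorem total_univ : total univ = 42 := by
  rw [total, indicator_univ, hasSum_dur.tsum_eq]

theorem total_nonneg (S : Set Idx) : 0 ≤ total S :=
  tsum_nonneg fun Q => indicator_nonneg (fun Q _ => Q.dur_pos.le) Q

theorem start_eq (P : Idx) : P.start = total {Q | Q.TimeLT P} :=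
  tsum_subtype {Q : Idx | Q.TimeLT P} dur

theorem start_nonneg (P : Idx) : 0 ≤ P.start := by rw [start_eq]; exact total_nonneg _

theorem start_add_dur (P : Idx) : P.start + P.dur = total ({Q | Q.TimeLT P} ∪ {P}) := by
  rw [start_eq, ← total_singleton P, total_union]
  rw [disjoint_singleton_right]
  exact P.not_timeLT_self

theorem start_add_dur_le_total {P : Idx} {S : Set Idx} (h : ∀ Q, Q.TimeLT P → Q ∈ S)
    (hP : P ∈ S) : P.start + P.dur ≤ total S := by
  rw [start_add_dur]
  exact total_mono (union_subset h (singleton_subset_iff.2 hP))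

theorem TimeLT.start_add_dur_le {P Q : Idx} (h : P.TimeLT Q) : P.start + P.dur ≤ Q.start := by
  rw [start_eq Q]
  exact start_add_dur_le_total (fun R hR => hR.trans h) h

theorem start_add_dur_le (P : Idx) : P.start + P.dur ≤ 42 := by
  rw [← total_univ]
  exact start_add_dur_le_total (fun _ _ => mem_univ _) (mem_univ _)

theorem start_injective : Function.Injective Idx.start := by
  intro P Q h
  by_contra hne
  rcases timeLT_total hne with h' | h'
  · have := h'.start_add_dur_le; have := P.dur_pos; linarith
  · have := h'.start_add_dur_le; have := Q.dur_pos; linarith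

theorem timeLT_iff_start {P Q : Idx} : P.TimeLT Q ↔ P.start < Q.start := by
  constructor
  · intro h
    have := h.start_add_dur_le; have := P.dur_pos; linarith
  · intro h
    have hne : P ≠ Q := fun e => by rw [e] at h; exact lt_irrefl _ h
    rcases timeLT_total hne with h' | h'
    · exact h'
    · have := h'.start_add_dur_le; have := Q.dur_pos; linarith

theorem eq_of_mem_window {P Q : Idx} {t : ℝ} (hP : t ∈ P.window) (hQ : t ∈ Q.window) : P = Q := by
  by_contra hne
  rcases timeLT_total hne with h | h
  · exact absurd hP.2 (not_lt.2 (h.start_add_dur_le.trans hQ.1))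
  · exact absurd hQ.2 (not_lt.2 (h.start_add_dur_le.trans hP.1))

/-- The time at which all swaps with `m`-entry less than `m` are completed. -/
def cut (m : ℕ) : ℝ := total {Q | Q.m < m}

theorem start_add_dur_le_cut {P : Idx} {m : ℕ} (h : P.m < m) : P.start + P.dur ≤ cut m :=
  start_add_dur_le_total (fun Q hQ => by rw [timeLT_iff] at hQ; change Q.m < m; omega) h

theorem cut_le_start {P : Idx} {m : ℕ} (h : m ≤ P.m) : cut m ≤ P.start := by
  rw [start_eq]
  exact total_mono fun Q (hQ : Q.m < m) => timeLT_iff.2 (Or.inl (hQ.trans_le h))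

theorem cut_le (m : ℕ) : cut m ≤ 42 := by
  rw [← total_univ]; exact total_mono (subset_univ _)

/-- Finitely many swaps already last longer than `s`, and their `m`-entries are bounded. Statements
about finitely many blocks therefore reach every time before 42. -/
theorem exists_cut_gt {s : ℝ} (hs : s < 42) : ∃ m, s < cut m := by
  obtain ⟨S, hS⟩ := (hasSum_dur.eventually (lt_mem_nhds hs)).exists
  refine ⟨S.sup Idx.m + 1, hS.trans_le ?_⟩
  rw [← total_finset]
  exact total_mono fun P hP => Nat.lt_succ_of_le (Finset.le_sup (f := Idx.m) hP)

/-! ### Finite sets of indices -/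

theorem finite_k_le (N : ℕ) : {P : Idx | P.k ≤ N}.Finite := by
  have hinj : Function.Injective fun P : Idx => (P.k, P.m, P.i, P.n) := by
    intro P Q h
    simp only [Prod.mk.injEq] at h
    exact Idx.ext h.1 h.2.1 h.2.2.1 h.2.2.2
  refine ((finite_Iic (N, N, 2, 2 ^ N)).preimage hinj.injOn).subset ?_
  intro P (hP : P.k ≤ N)
  have h1 := P.m_le_k
  have h2 := P.i_mem
  have h3 : P.n ≤ 2 ^ N := P.n_le.trans (Nat.pow_le_pow_right (by norm_num) (by omega))
  simp only [mem_preimage, mem_Iic, Prod.mk_le_mk]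
  exact ⟨hP, by omega, by omega, h3⟩

/-- The indices `P ≤ K`, as a finite set. -/
def upTo (K : Idx) : Finset Idx :=
  ((finite_k_le K.k).subset fun _ h => k_le_of_le h : (Iic K).Finite).toFinset

theorem mem_upTo {K P : Idx} : P ∈ upTo K ↔ P ≤ K := by simp [upTo]

theorem coe_upTo (K : Idx) : (upTo K : Set Idx) = Iic K := by ext; simp [mem_upTo]

/-- The largest index with first entry `N + 1`. -/
def top (N : ℕ) : Idx where
  k := N + 1
  m := N + 1
  i := 2
  n := 2 ^ ((N + 1) / 2)
  one_le_m := by omega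
  m_le_k := le_rfl
  i_mem := Or.inr rfl
  one_le_n := Nat.one_le_two_pow
  n_le := le_rfl

theorem le_top_iff {P : Idx} {N : ℕ} : P ≤ top N ↔ P.k ≤ N + 1 := by
  refine ⟨k_le_of_le, fun h => not_lt.1 fun h' => ?_⟩
  rw [lt_iff] at h'
  have h1 := P.m_le_k
  have h2 := P.i_mem
  have h3 := P.n_le
  simp only [top] at h'
  have : P.k = N + 1 := by omega
  rw [this] at h3
  omega

theorem tendsto_top : Tendsto top atTop atTop := by
  refine tendsto_atTop.2 fun P => ?_
  filter_upwards [eventually_ge_atTop P.k] with N hN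
  exact le_top_iff.2 (by omega)

instance : Nonempty Idx := ⟨top 0⟩

instance : Countable Idx := equivSigma.injective.countable

/-- The order of starting times. -/
def TimeLE (P Q : Idx) : Prop := P.start ≤ Q.start

instance : IsTrans Idx TimeLE := ⟨fun _ _ _ h h' => le_trans (α := ℝ) h h'⟩
instance : Std.Antisymm TimeLE := ⟨fun _ _ h h' => start_injective (le_antisymm h h')⟩
instance : Std.Total TimeLE := ⟨fun P Q => le_total P.start Q.start⟩
instance : DecidableRel TimeLE := Classical.decRel _

/-! ### Schedules -/

/-- The two phases of a binary swap. -/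
def steps (P : Idx) (L : ℕ) : List Step :=
  [⟨orient P.i L P.outer, P.start, P.start + 2 * (1 / 2 ^ P.k),
      le_add_of_nonneg_right (by positivity)⟩,
    ⟨orient P.i L P.inner, P.start + 2 * (1 / 2 ^ P.k), P.start + P.dur, by
      have h : (0 : ℝ) < 1 / 2 ^ P.k := by positivity
      rw [dur, div_eq_mul_one_div 3]; linarith⟩]

theorem dur_eq (P : Idx) : P.dur = 3 * (1 / 2 ^ P.k) := by rw [dur, div_eq_mul_one_div]

theorem mem_steps {P : Idx} {L : ℕ} {s : Step} (hs : s ∈ P.steps L) :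
    P.start ≤ s.a ∧ s.b ≤ P.start + P.dur := by
  have h : (0 : ℝ) < 1 / 2 ^ P.k := by positivity
  have hd := P.dur_eq
  simp only [steps, List.mem_cons, List.not_mem_nil, or_false] at hs
  rcases hs with rfl | rfl
  · exact ⟨le_rfl, by simp only; linarith⟩
  · exact ⟨by simp only; linarith, le_rfl⟩

theorem chrono_steps (P : Idx) (L : ℕ) : Chrono (P.steps L) := by simp [Chrono, steps]

theorem sum_steps (P : Idx) (L : ℕ) : ((P.steps L).map fun s => s.b - s.a).sum = P.dur := by
  simp [steps]

theorem flow_steps_of_ge (P : Idx) (L : ℕ) {t : ℝ} (ht : P.start + P.dur ≤ t) :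
    flow (P.steps L) t = P.swapMap L := by
  have h : (0 : ℝ) < 1 / 2 ^ P.k := by positivity
  have hd := P.dur_eq
  simp only [steps, flow]
  rw [Step.elapsed_of_ge _ (by simp only; linarith), Step.elapsed_of_ge _ (by simpa using ht)]
  simp only [swapMap, hd]
  have e1 : P.start + 2 * (1 / 2 ^ P.k) - P.start = 2 * (1 / 2 ^ P.k : ℝ) := by ring
  have e2 : P.start + 3 * (1 / 2 ^ P.k) - (P.start + 2 * (1 / 2 ^ P.k)) = (1 / 2 ^ P.k : ℝ) := by
    ring
  rw [e1, e2]
  rfl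

theorem lev_flow_steps (P : Idx) {L M : ℕ} (hM : M < P.k) (hL : P.k + 1 ≤ L) (c : ℕ) (t : ℝ)
    (x : T2) : lev M (crd c (flow (P.steps L) t x)) = lev M (crd c x) := by
  have h1 : M ≤ P.outer.N := Nat.le_sub_one_of_lt hM
  have h2 : M ≤ P.inner.N := by change M ≤ P.k + 1; omega
  simp only [steps, flow_cons_apply]
  change lev M (crd c (Cells.map _ _ (Cells.map _ _ x))) = _
  rw [lev_orient h2 (by omega), lev_orient h1 (by omega)]

theorem fld_steps_of_notMem (P : Idx) (L : ℕ) {t : ℝ} (ht : t ∉ P.window) (x : T2) :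
    fld (P.steps L) t x = 0 := by
  have h : (0 : ℝ) < 1 / 2 ^ P.k := by positivity
  have hd := P.dur_eq
  simp only [steps, fld]
  rw [if_neg, if_neg]
  · simp
  · exact fun h' => ht ⟨by linarith [h'.1], h'.2⟩
  · exact fun h' => ht ⟨h'.1, by linarith [h'.2]⟩

theorem fld_steps_of_mem (P : Idx) (L : ℕ) {t : ℝ} (ht : t ∈ P.window) {x : T2} (hx : Generic x) :
    fld (P.steps L) t x = swapField P.i P.k P.n L (t - P.start) x := by
  rw [swapField_eq P L hx]
  simp only [steps, fld]
  split_ifs with h1 h2 h3 h3 h4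
  · exact absurd h1.2 (not_lt.2 h2.1)
  · exact absurd h1.2 (not_lt.2 h2.1)
  · simp
  · exact absurd (by linarith [h1.2]) h3
  · linarith [h4.1]
  · simp
  · exact absurd ⟨ht.1, by linarith⟩ h1
  · exact absurd ⟨by linarith, ht.2⟩ h4

end Idx

/-! ### Schedules of finite sets of swaps, and the mixing fields -/

theorem fld_append (l l' : List Step) (t : ℝ) (x : T2) :
    fld (l ++ l') t x = fld l t x + fld l' t x := by
  induction l with
  | nil => simp [fld]
  | cons s l ih => rw [List.cons_append, fld, ih, fld, add_assoc]

/-- The schedule of all the swaps with index in `S`. -/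
def sched (L : Idx → ℕ) (S : Finset Idx) : List Step :=
  (S.sort Idx.TimeLE).flatMap fun P => P.steps (L P)

variable {L : Idx → ℕ}

theorem mem_sched {S : Finset Idx} {s : Step} : s ∈ sched L S ↔ ∃ P ∈ S, s ∈ P.steps (L P) := by
  simp [sched, List.mem_flatMap]

/-- A sorted list without repetitions is determined by its elements, so the list of the union is the
concatenation. Every later decomposition of the flow into consecutive maps rests on this. -/
theorem sched_union {A B : Finset Idx} (h : ∀ P ∈ A, ∀ Q ∈ B, P.TimeLT Q) :
    sched L (A ∪ B) = sched L A ++ sched L B := by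
  rw [sched, sched, sched, ← List.flatMap_append]
  congr 1
  have hd : Disjoint A B := Finset.disjoint_left.2 fun P hA hB => P.not_timeLT_self (h P hA P hB)
  refine List.Perm.eq_of_pairwise (le := Idx.TimeLE) (fun P Q _ _ h1 h2 => antisymm h1 h2)
    (Finset.pairwise_sort _ _) ?_ ?_
  · refine List.pairwise_append.2 ⟨Finset.pairwise_sort _ _, Finset.pairwise_sort _ _, ?_⟩
    intro P hP Q hQ
    rw [Finset.mem_sort] at hP hQ
    exact (Idx.timeLT_iff_start.1 (h P hP Q hQ)).le
  · rw [List.perm_ext_iff_of_nodup (Finset.sort_nodup _ _)]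
    · intro P; simp
    · refine List.nodup_append'.2 ⟨Finset.sort_nodup _ _, Finset.sort_nodup _ _, ?_⟩
      intro P hP hQ
      rw [Finset.mem_sort] at hP hQ
      exact Finset.disjoint_left.1 hd hP hQ

theorem sched_singleton (P : Idx) : sched L {P} = P.steps (L P) := by
  simp [sched, Finset.sort_singleton]

/-- Induction on a finite set of indices, removing the last one in time. -/
theorem timeInduction {p : Finset Idx → Prop} (h0 : p ∅)
    (h1 : ∀ (S : Finset Idx) (P : Idx), (∀ Q ∈ S, Q.TimeLT P) → p S → p (S ∪ {P}))
    (S : Finset Idx) : p S := by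
  refine Finset.induction_on_max_value Idx.start S h0 fun P S hP hmax ih => ?_
  rw [Finset.insert_eq, Finset.union_comm]
  refine h1 S P (fun Q hQ => ?_) ih
  rw [Idx.timeLT_iff_start]
  exact lt_of_le_of_ne (hmax Q hQ) fun e => hP (Idx.start_injective e ▸ hQ)

theorem sched_empty : sched L ∅ = [] := by simp [sched]

theorem sched_snoc {S : Finset Idx} {P : Idx} (h : ∀ Q ∈ S, Q.TimeLT P) :
    sched L (S ∪ {P}) = sched L S ++ P.steps (L P) := by
  rw [sched_union (by simpa using h), sched_singleton]

theorem chrono_sched (S : Finset Idx) : Chrono (sched L S) := by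
  induction S using timeInduction with
  | h0 => rw [sched_empty]; exact List.Pairwise.nil
  | h1 S P h ih =>
    rw [sched_snoc h]
    refine List.pairwise_append.2 ⟨ih, P.chrono_steps _, fun s hs s' hs' => ?_⟩
    obtain ⟨Q, hQ, hs⟩ := mem_sched.1 hs
    exact (Idx.mem_steps hs).2.trans ((h Q hQ).start_add_dur_le.trans (Idx.mem_steps hs').1)

theorem nonneg_of_mem_sched {S : Finset Idx} {s : Step} (h : s ∈ sched L S) : 0 ≤ s.a := by
  obtain ⟨Q, -, hs⟩ := mem_sched.1 h
  exact Q.start_nonneg.trans (Idx.mem_steps hs).1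

theorem le_of_mem_sched {S : Finset Idx} {s : Step} (h : s ∈ sched L S) : s.b ≤ 42 := by
  obtain ⟨Q, -, hs⟩ := mem_sched.1 h
  exact (Idx.mem_steps hs).2.trans Q.start_add_dur_le

theorem sum_sched (S : Finset Idx) :
    ((sched L S).map fun s => s.b - s.a).sum = ∑ P ∈ S, P.dur := by
  induction S using timeInduction with
  | h0 => simp [sched_empty]
  | h1 S P h ih =>
    have hd : Disjoint S {P} := Finset.disjoint_singleton_right.2 fun hP =>
      P.not_timeLT_self (h P hP)
    rw [sched_snoc h, List.map_append, List.sum_append, ih, P.sum_steps,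
      Finset.sum_union hd, Finset.sum_singleton]

/-- This holds also in the middle of a swap, where no description by digits is available, because
the rotating rectangles never leave a dyadic square of level `M`. -/
theorem lev_flow_sched {S : Finset Idx} {M : ℕ} (hS : ∀ P ∈ S, M < P.k)
    (hL : ∀ P : Idx, P.k + 1 ≤ L P) (c : ℕ) (t : ℝ) (x : T2) :
    lev M (crd c (flow (sched L S) t x)) = lev M (crd c x) := by
  induction S using timeInduction with
  | h0 => simp [sched_empty, flow]
  | h1 S P h ih =>
    rw [sched_snoc h, flow_append]
    change lev M (crd c (flow (P.steps (L P)) t (flow (sched L S) t x))) = _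
    rw [P.lev_flow_steps (hS P (by simp)) (hL P),
      ih fun Q hQ => hS Q (Finset.mem_union_left _ hQ)]

theorem fld_sched_of_notMem {S : Finset Idx} {t : ℝ} (h : ∀ P ∈ S, t ∉ P.window) (x : T2) :
    fld (sched L S) t x = 0 := by
  induction S using timeInduction with
  | h0 => simp [sched_empty, fld]
  | h1 S P hS ih =>
    rw [sched_snoc hS, fld_append, ih fun Q hQ => h Q (Finset.mem_union_left _ hQ),
      P.fld_steps_of_notMem _ (h P (by simp)), add_zero]

theorem fld_sched_of_mem {S : Finset Idx} {P : Idx} (hP : P ∈ S) {t : ℝ} (ht : t ∈ P.window)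
    {x : T2} (hx : Generic x) :
    fld (sched L S) t x = swapField P.i P.k P.n (L P) (t - P.start) x := by
  induction S using timeInduction with
  | h0 => simp at hP
  | h1 S Q hS ih =>
    rw [sched_snoc hS, fld_append]
    by_cases hPS : P ∈ S
    · have hne : t ∉ Q.window := fun h => by
        rw [Idx.eq_of_mem_window ht h] at hPS
        exact Q.not_timeLT_self (hS Q hPS)
      rw [ih hPS, Q.fld_steps_of_notMem _ hne, add_zero]
    · obtain rfl : P = Q := by simpa [hPS] using hP
      rw [fld_sched_of_notMem, zero_add, P.fld_steps_of_mem _ ht hx]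
      intro R hR h
      rw [Idx.eq_of_mem_window ht h] at hPS
      exact hPS hR

theorem mixField_of_mem {S : Set Idx} {P : Idx} (hP : P ∈ S) {t : ℝ} (ht : t ∈ P.window) (x : T2) :
    mixField S L t x = swapField P.i P.k P.n (L P) (t - P.start) x := by
  have h : ∃ P ∈ S, t ∈ P.window := ⟨P, hP, ht⟩
  have e : h.choose = P := Idx.eq_of_mem_window h.choose_spec.2 ht
  rw [mixField, dif_pos h, e]

theorem mixField_of_notMem {S : Set Idx} {t : ℝ} (h : ∀ P ∈ S, t ∉ P.window) (x : T2) :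
    mixField S L t x = 0 := by
  rw [mixField, dif_neg]
  rintro ⟨P, hP, ht⟩
  exact h P hP ht

theorem mixFin_eq (K : Idx) (t : ℝ) {x : T2} (hx : Generic x) :
    mixFin K L t x = fld (sched L (Idx.upTo K)) t x := by
  by_cases h : ∃ P ∈ Iic K, t ∈ P.window
  · obtain ⟨P, hP, ht⟩ := h
    rw [mixFin, mixField_of_mem hP ht, fld_sched_of_mem (Idx.mem_upTo.2 hP) ht hx]
  · push Not at h
    rw [mixFin, mixField_of_notMem h, fld_sched_of_notMem]
    exact fun P hP => h P (Idx.mem_upTo.1 hP)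

theorem ae_mixFin_eq (K : Idx) (a b : ℝ) :
    ∀ᵐ z ∂(stMeasure a b), mixFin K L z.1 z.2 = fld (sched L (Idx.upTo K)) z.1 z.2 := by
  have h : ∀ᵐ z ∂(stMeasure a b), Generic z.2 := Measure.quasiMeasurePreserving_snd.ae ae_generic
  filter_upwards [h] with z hz using mixFin_eq K z.1 hz

/-- At a given time at most one swap is active, and the finite fields contain it as soon as `K` has
passed its index. -/
theorem eventually_mixFin_eq (t : ℝ) : ∀ᶠ K in atTop, ∀ x, mixFin K L t x = mixInf L t x := by
  by_cases h : ∃ P : Idx, t ∈ P.window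
  · obtain ⟨P, ht⟩ := h
    filter_upwards [eventually_ge_atTop P] with K hK x
    rw [mixFin, mixInf, mixField_of_mem (show P ∈ Iic K from hK) ht,
      mixField_of_mem (mem_univ P) ht]
  · push Not at h
    refine Eventually.of_forall fun K x => ?_
    rw [mixFin, mixInf, mixField_of_notMem fun P _ => h P, mixField_of_notMem fun P _ => h P]

variable {L : Idx → ℕ}

/-! ### Completed schedules and the reversal of digits -/

/-- The map performed by the completed schedule. -/
def final (L : Idx → ℕ) (S : Finset Idx) : T2 ≃ᵐ T2 := flow (sched L S) 42

theorem measurePreserving_final (S : Finset Idx) : MeasurePreserving (final L S) volume volume :=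
  measurePreserving_flow _ _

theorem ae_generic_final (S : Finset Idx) : ∀ᵐ x, Generic (final L S x) :=
  (measurePreserving_final S).quasiMeasurePreserving.ae ae_generic

theorem final_union {A B : Finset Idx} (h : ∀ P ∈ A, ∀ Q ∈ B, P.TimeLT Q) (x : T2) :
    final L (A ∪ B) x = final L B (final L A x) := by
  rw [final, sched_union h, flow_append]; rfl

theorem final_singleton (P : Idx) : final L {P} = P.swapMap (L P) := by
  rw [final, sched_singleton, P.flow_steps_of_ge _ P.start_add_dur_le]

theorem final_empty (x : T2) : final L ∅ x = x := by simp [final, sched_empty, flow]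

theorem slabIdx_unique {k n n' : ℕ} {r : ℤ} (h : r ∈ slabIdx k n) (h' : r ∈ slabIdx k n') :
    n = n' := by
  have aux : ∀ {n n' : ℕ}, r ∈ slabIdx k n → r ∈ slabIdx k n' → ¬n < n' := by
    intro n n' h h' hlt
    have h1 : (n : ℤ) ≤ n' - 1 := by omega
    have h2 : (n : ℤ) * 2 ^ (k - 1 - k / 2) ≤ ((n' : ℤ) - 1) * 2 ^ (k - 1 - k / 2) := by gcongr
    have := h.2
    have := h'.1
    omega
  have := aux h h'
  have := aux h' h
  omega

-- The slabs of one stage are disjoint, and exchanging digits `k` and `k + 1` keeps a point in its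
-- slab. So at most one swap of the stage acts on a given point, and the order of the slabs is
-- irrelevant.
open Classical in
theorem ae_crd_final_of_const (hL : ∀ P : Idx, P.k + 1 ≤ L P) {m k i : ℕ} (S : Finset Idx)
    (hS : ∀ P ∈ S, P.m = m ∧ P.k = k ∧ P.i = i) :
    ∀ᵐ x, ∀ c, (c = 1 ∨ c = 2) → crd c (final L S x) =
      if c = i ∧ ∃ P ∈ S, lev (k - 1) (crd c x) ∈ slabIdx k P.n then digitSwap k (crd c x)
      else crd c x := by
  induction S using timeInduction with
  | h0 => exact Eventually.of_forall fun x c _ => by simp [final_empty]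
  | h1 S P h ih =>
    obtain ⟨hm, hk, hi⟩ := hS P (by simp)
    filter_upwards [ih fun Q hQ => hS Q (Finset.mem_union_left _ hQ),
      ae_generic_final (L := L) S] with x hx hg c hc
    rw [final_union (by simpa using h), final_singleton, P.crd_swapMap (hL P) hg hc, hk, hi,
      hx c hc]
    by_cases hci : c = i
    · simp only [hci, true_and, if_true]
      have hk1 : k - 1 < k := by have := P.one_le_k; omega
      by_cases hP : lev (k - 1) (crd i x) ∈ slabIdx k P.n
      · have hnot : ¬∃ Q ∈ S, lev (k - 1) (crd i x) ∈ slabIdx k Q.n := by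
          rintro ⟨Q, hQ, hQn⟩
          obtain ⟨hm', hk', hi'⟩ := hS Q (Finset.mem_union_left _ hQ)
          have e : P = Q := Idx.ext (by omega) (by omega) (by omega) (slabIdx_unique hP hQn)
          exact P.not_timeLT_self (h P (e ▸ hQ))
        rw [if_neg hnot, slabSwap, if_pos hP, if_pos ⟨P, by simp, hP⟩]
      · have hiff : (∃ Q ∈ S ∪ {P}, lev (k - 1) (crd i x) ∈ slabIdx k Q.n) ↔
            ∃ Q ∈ S, lev (k - 1) (crd i x) ∈ slabIdx k Q.n := by
          constructor
          · rintro ⟨Q, hQ, hQn⟩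
            rcases Finset.mem_union.1 hQ with hQ | hQ
            · exact ⟨Q, hQ, hQn⟩
            · rw [Finset.mem_singleton.1 hQ] at hQn
              exact absurd hQn hP
          · rintro ⟨Q, hQ, hQn⟩
            exact ⟨Q, Finset.mem_union_left _ hQ, hQn⟩
        simp only [hiff]
        split_ifs with h'
        · rw [slabSwap, lev_digitSwap hk1, if_neg hP]
        · rw [slabSwap, if_neg hP]
    · simp [hci]

/-- The indices with given first three entries. -/
def stage (m k i : ℕ) : Finset Idx :=
  (Idx.finite_k_le k).toFinset.filter fun P => P.m = m ∧ P.k = k ∧ P.i = i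

theorem mem_stage {m k i : ℕ} {P : Idx} : P ∈ stage m k i ↔ P.m = m ∧ P.k = k ∧ P.i = i := by
  simp only [stage, Finset.mem_filter, Finite.mem_toFinset, mem_ofPred_eq, and_iff_right_iff_imp]
  rintro ⟨-, h, -⟩
  exact h.le

/-- The `2^{⌊k/2⌋}` slabs cover the unit interval, so a complete stage exchanges the two digits
everywhere in the coordinate `i`. -/
theorem ae_dig_stage (hL : ∀ P : Idx, P.k + 1 ≤ L P) {m k i : ℕ} (hm : 1 ≤ m) (hmk : m ≤ k)
    (hi : i = 1 ∨ i = 2) :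
    ∀ᵐ x, ∀ c, (c = 1 ∨ c = 2) → ∀ j, dig j (crd c (final L (stage m k i) x)) =
      dig (if c = i then Equiv.swap k (k + 1) j else j) (crd c x) := by
  filter_upwards [ae_crd_final_of_const hL (stage m k i) fun P hP => mem_stage.1 hP] with x hx c hc j
  rw [hx c hc]
  by_cases hci : c = i
  · rw [if_pos hci, if_pos, dig_digitSwap]
    refine ⟨hci, ?_⟩
    have ha := crd_mem c x
    set r := lev (k - 1) (crd c x)
    have hr0 : 0 ≤ r := lev_nonneg ha.1 _
    have hr1 : r < 2 ^ (k - 1) := lev_lt ha.2 _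
    set q : ℤ := 2 ^ (k - 1 - k / 2) with hq
    have hq0 : 0 < q := by positivity
    have hmul : (2 : ℤ) ^ (k - 1) = 2 ^ (k / 2) * q := by
      rw [hq, ← pow_add]; congr 1; omega
    have hd0 : 0 ≤ r / q := Int.ediv_nonneg hr0 hq0.le
    have hd1 : r / q < 2 ^ (k / 2) := Int.ediv_lt_of_lt_mul hq0 (hmul ▸ hr1)
    have hd2 : (r / q).toNat + 1 ≤ 2 ^ (k / 2) := by
      have : (((r / q).toNat : ℕ) : ℤ) < ((2 ^ (k / 2) : ℕ) : ℤ) := by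
        rw [Int.toNat_of_nonneg hd0]; exact_mod_cast hd1
      exact_mod_cast this
    -- A slab consists of `q` consecutive dyadic intervals of level `k - 1`, so the interval of
    -- index `r` lies in slab number `r / q`, counted from zero; the index `n` counts from one.
    refine ⟨⟨k, m, i, (r / q).toNat + 1, hm, hmk, hi, by omega, hd2⟩,
      mem_stage.2 ⟨rfl, rfl, rfl⟩, ?_⟩
    have h1 := Int.ediv_mul_le r hq0.ne'
    have h2 := Int.lt_ediv_add_one_mul_self r hq0
    simp only [slabIdx, mem_Ico]
    push_cast
    rw [Int.toNat_of_nonneg hd0, add_sub_cancel_right, ← hq]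
    exact ⟨h1, h2⟩
  · rw [if_neg hci, if_neg fun h => hci h.1]

/-- The indices with `m`-entry `m` and first entry between `k` and `N`. -/
def block (m k N : ℕ) : Finset Idx :=
  (Idx.finite_k_le N).toFinset.filter fun P => P.m = m ∧ k ≤ P.k

theorem mem_block {m k N : ℕ} {P : Idx} : P ∈ block m k N ↔ P.m = m ∧ k ≤ P.k ∧ P.k ≤ N := by
  simp only [block, Finset.mem_filter, Finite.mem_toFinset, mem_ofPred_eq]
  tauto

/-- The adjacent transpositions `(N, N+1), …, (k, k+1)`, performed in this order, compose to a
cycle: the digit at `N + 1` moves down to `k` and the digits in between move up by one. The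
induction is on the number `d` of stages. -/
theorem ae_dig_block (hL : ∀ P : Idx, P.k + 1 ≤ L P) {m N : ℕ} (hm : 1 ≤ m) (d : ℕ) :
    ∀ k, k + d = N + 1 → m ≤ k → ∀ᵐ x, ∀ c, (c = 1 ∨ c = 2) → ∀ j,
      dig j (crd c (final L (block m k N) x)) =
        dig (if j = k then N + 1 else if k < j ∧ j ≤ N + 1 then j - 1 else j) (crd c x) := by
  induction d with
  | zero =>
    intro k hk hmk
    have he : block m k N = ∅ := by
      ext P; simp only [mem_block, Finset.notMem_empty, iff_false]; omega
    refine Eventually.of_forall fun x c _ j => ?_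
    rw [he, final_empty]
    congr 1
    split_ifs <;> omega
  | succ d ih =>
    intro k hk hmk
    -- The stage with the smallest `k` comes last in time, and in it `i = 2` precedes `i = 1`. The
    -- two halves act on different coordinates, so each coordinate sees one transposition.
    have he : block m k N = (block m (k + 1) N ∪ stage m k 2) ∪ stage m k 1 := by
      ext P
      have := P.i_mem
      simp only [mem_block, mem_stage, Finset.mem_union]
      omega
    have hord : ∀ P ∈ block m (k + 1) N, ∀ Q ∈ stage m k 2, P.TimeLT Q := by
      intro P hP Q hQ
      rw [mem_block] at hP; rw [mem_stage] at hQ; rw [Idx.timeLT_iff]; omega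
    have hord' : ∀ P ∈ block m (k + 1) N ∪ stage m k 2, ∀ Q ∈ stage m k 1, P.TimeLT Q := by
      intro P hP Q hQ
      rw [Finset.mem_union, mem_block, mem_stage] at hP; rw [mem_stage] at hQ
      rw [Idx.timeLT_iff]; omega
    have q1 := (measurePreserving_final (L := L) (block m (k + 1) N)).quasiMeasurePreserving
    have q2 := (measurePreserving_final (L := L)
      (block m (k + 1) N ∪ stage m k 2)).quasiMeasurePreserving
    filter_upwards [ih (k + 1) (by omega) (by omega),
      q1.ae (ae_dig_stage hL hm hmk (Or.inr rfl)),
      q2.ae (ae_dig_stage hL hm hmk (Or.inl rfl))] with x h1 h2 h3 c hc j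
    have e : (if c = 2 then Equiv.swap k (k + 1) (if c = 1 then Equiv.swap k (k + 1) j else j)
        else if c = 1 then Equiv.swap k (k + 1) j else j) = Equiv.swap k (k + 1) j := by
      rcases hc with rfl | rfl <;> simp
    rw [he, final_union hord', h3 c hc, final_union hord, h2 c hc, e, h1 c hc]
    congr 1
    have hsw : ∀ j, Equiv.swap k (k + 1) j = if j = k then k + 1 else if j = k + 1 then k else j :=
      fun j => Equiv.swap_apply_def _ _ _
    rw [hsw]
    split_ifs <;> omega

/-- The indices with `m`-entry at most `M` and first entry at most `N`. -/
def blocks (M N : ℕ) : Finset Idx := (Idx.finite_k_le N).toFinset.filter fun P => P.m ≤ M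

theorem mem_blocks {M N : ℕ} {P : Idx} : P ∈ blocks M N ↔ P.m ≤ M ∧ P.k ≤ N := by
  simp only [blocks, Finset.mem_filter, Finite.mem_toFinset, mem_ofPred_eq]
  tauto

/-- The first `M` digits after the first `M` blocks are the last `M` of the first `N + 1` digits,
in reverse order. -/
theorem ae_dig_blocks (hL : ∀ P : Idx, P.k + 1 ≤ L P) {N : ℕ} (M : ℕ) (hM : M ≤ N) :
    ∀ᵐ x, ∀ c, (c = 1 ∨ c = 2) → ∀ j,
      dig j (crd c (final L (blocks M N) x)) =
        dig (if j = 0 then 0 else if j ≤ M then N + 2 - j else if j ≤ N + 1 then j - M else j)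
          (crd c x) := by
  induction M with
  | zero =>
    have he : blocks 0 N = ∅ := by
      ext P
      have := P.one_le_m
      simp only [mem_blocks, Finset.notMem_empty, iff_false]; omega
    refine Eventually.of_forall fun x c _ j => ?_
    rw [he, final_empty]
    congr 1
    split_ifs <;> omega
  | succ M ih =>
    have he : blocks (M + 1) N = blocks M N ∪ block (M + 1) (M + 1) N := by
      ext P
      have := P.m_le_k
      simp only [mem_blocks, mem_block, Finset.mem_union]
      omega
    have hord : ∀ P ∈ blocks M N, ∀ Q ∈ block (M + 1) (M + 1) N, P.TimeLT Q := by
      intro P hP Q hQ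
      rw [mem_blocks] at hP; rw [mem_block] at hQ; rw [Idx.timeLT_iff]; omega
    have q1 := (measurePreserving_final (L := L) (blocks M N)).quasiMeasurePreserving
    filter_upwards [ih (by omega), q1.ae (ae_dig_block (N := N) hL (by omega) (N - M) (M + 1)
      (by omega) le_rfl)] with x h1 h2 c hc j
    rw [he, final_union hord, h2 c hc, h1 c hc]
    congr 1
    generalize hs : (if j = M + 1 then N + 1 else if M + 1 < j ∧ j ≤ N + 1 then j - 1 else j) = s
    have hs' : (j = M + 1 ∧ s = N + 1) ∨ (M + 1 < j ∧ j ≤ N + 1 ∧ s = j - 1) ∨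
        ((j < M + 1 ∨ N + 1 < j) ∧ s = j) := by
      split_ifs at hs <;> omega
    split_ifs <;> omega

theorem lev_eq_of_dig {a b : ℝ} (ha : a ∈ Ico (0 : ℝ) 1) (hb : b ∈ Ico (0 : ℝ) 1) (M : ℕ)
    (h : ∀ j, 1 ≤ j → j ≤ M → dig j a = dig j b) : lev M a = lev M b := by
  induction M with
  | zero =>
    have h1 := lev_nonneg ha.1 0
    have h2 := lev_nonneg hb.1 0
    have h3 := lev_lt ha.2 0
    have h4 := lev_lt hb.2 0
    simp only [pow_zero] at h3 h4
    omega
  | succ M ih =>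
    have h1 := ih fun j hj hj' => h j hj (by omega)
    have h2 := h (M + 1) (by omega) le_rfl
    rw [lev_of_le (Nat.le_succ M), lev_of_le (Nat.le_succ M) b] at h1
    simp only [dig, show M + 1 - M = 1 by omega, Nat.succ_eq_add_one, pow_one] at h1 h2
    omega

/-- Both the addition of a multiple of `2^{-n}` and the removal of the integer part change the
dyadic index at level `j > n` by an even number. -/
theorem dig_fract_add {n j : ℕ} (h : n < j) (a : ℝ) (p : ℤ) :
    dig j (Int.fract (a + p / 2 ^ n)) = dig j a := by
  have e : Int.fract (a + p / 2 ^ n) = a + p / 2 ^ n + ((-⌊a + p / 2 ^ n⌋ : ℤ) : ℝ) / 2 ^ 0 := by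
    rw [Int.fract]; push_cast; ring
  have h2 : ∀ n, n < j → (2 : ℤ) ^ (j - n) = 2 * 2 ^ (j - n - 1) := fun n hn => by
    rw [← pow_succ']; congr 1; omega
  rw [e, dig, dig, lev_add_div _ _ (Nat.zero_le _), lev_add_div _ _ h.le, h2 0 (by omega),
    h2 n h, mul_left_comm p,
    mul_left_comm (-_)]
  omega

/-- Translation of the torus by a dyadic vector. -/
def gridShift (n : ℕ) (p q : ℤ) : T2 := mk2 ((p : ℝ) / 2 ^ n, (q : ℝ) / 2 ^ n)

theorem dig_crd_add_gridShift {n j : ℕ} (h : n < j) (c : ℕ) (x : T2) (p q : ℤ) :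
    dig j (crd c (x + gridShift n p q)) = dig j (crd c x) := by
  have key : ∀ (y : UnitAddCircle) (p : ℤ),
      dig j (rep (y + ((p / 2 ^ n : ℝ) : UnitAddCircle))) = dig j (rep y) := by
    intro y p
    conv_lhs => rw [← coe_rep y, ← AddCircle.coe_add, rep_coe]
    exact dig_fract_add h _ _
  unfold crd
  split_ifs
  · exact key x.1 p
  · exact key x.2 q

variable {L : Idx → ℕ}

/-! ### Distance in `L¹` -/

instance isProbabilityMeasure_T2 : IsProbabilityMeasure (volume : Measure T2) := by
  have : IsProbabilityMeasure (volume : Measure UnitAddCircle) := ⟨UnitAddCircle.measure_univ⟩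
  rw [Measure.volume_eq_prod]
  infer_instance

/-- The `L¹` distance of two functions on the torus. -/
def distL1 (f g : T2 → ℝ) : ℝ≥0∞ := eLpNorm (fun x => f x - g x) 1 volume

theorem distL1_self (f : T2 → ℝ) : distL1 f f = 0 := by simp [distL1]

theorem distL1_comm (f g : T2 → ℝ) : distL1 f g = distL1 g f := eLpNorm_sub_comm f g 1 volume

theorem distL1_triangle {f g h : T2 → ℝ} (hf : Measurable f) (hg : Measurable g)
    (hh : Measurable h) : distL1 f h ≤ distL1 f g + distL1 g h := by
  have e : (fun x => f x - h x) = (fun x => f x - g x) + fun x => g x - h x := by ext x; simp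
  rw [distL1, e]
  exact eLpNorm_add_le (hf.sub hg).aestronglyMeasurable (hg.sub hh).aestronglyMeasurable le_rfl

theorem distL1_comp {f g : T2 → ℝ} (hf : Measurable f) (hg : Measurable g) {Z : T2 → T2}
    (hZ : MeasurePreserving Z volume volume) :
    distL1 (fun x => f (Z x)) (fun x => g (Z x)) = distL1 f g :=
  eLpNorm_comp_measurePreserving (g := fun x => f x - g x) (hf.sub hg).aestronglyMeasurable hZ

/-- Area preserving maps that move points little are close to the identity in `L¹`. -/
theorem exists_distL1_comp_le {g : T2 → ℝ} (hg : Measurable g) (hg1 : MemLp g 1 volume)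
    {ε : ℝ≥0∞} (hε : ε ≠ 0) : ∃ δ : ℝ, 0 < δ ∧ ∀ Z : T2 → T2, MeasurePreserving Z volume volume →
      (∀ x, dist (Z x) x ≤ δ) → distL1 (fun x => g (Z x)) g ≤ ε := by
  obtain ⟨ε', h0, hε'⟩ : ∃ ε' : ℝ≥0, 0 < ε' ∧ (ε' : ℝ≥0∞) * 3 < ε := by
    have : ε / 3 ≠ 0 := ENNReal.div_ne_zero.2 ⟨hε, by norm_num⟩
    obtain ⟨ε', h1, h2⟩ := ENNReal.lt_iff_exists_nnreal_btwn.1 (pos_iff_ne_zero.2 this)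
    exact ⟨ε', by exact_mod_cast h1, (ENNReal.lt_div_iff_mul_lt (by norm_num) (by norm_num)).1 h2⟩
  -- Approximate `g` by a continuous `h`, which is uniformly continuous on the compact torus.
  -- Composition with `Z` is an isometry of `L¹`, so the approximation error enters twice and the
  -- modulus of continuity once.
  obtain ⟨h, hh, -⟩ := hg1.exists_boundedContinuous_eLpNorm_sub_le (by norm_num)
    (ε := ε') (by exact_mod_cast h0.ne')
  have huc : UniformContinuous h := CompactSpace.uniformContinuous_of_continuous h.continuous
  obtain ⟨δ, hδ, hδ'⟩ := Metric.uniformContinuous_iff_le.1 huc ε' (by exact_mod_cast h0)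
  refine ⟨δ, hδ, fun Z hZ hd => le_trans ?_ hε'.le⟩
  have hhm : Measurable h := h.continuous.measurable
  have hgh : distL1 g h ≤ ε' := hh
  have h1 : distL1 (fun x => g (Z x)) (fun x => h (Z x)) ≤ ε' := by
    rwa [distL1_comp hg hhm hZ]
  have h2 : distL1 (fun x => h (Z x)) h ≤ ε' := by
    refine (eLpNorm_le_of_ae_bound (C := ε') (Eventually.of_forall fun x => ?_)).trans ?_
    · rw [← dist_eq_norm]
      exact hδ' (hd x)
    · simp [measure_univ]
  have h3 : distL1 h g ≤ ε' := by rwa [distL1_comm]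
  have hgZ : Measurable fun x => g (Z x) := hg.comp hZ.measurable
  have hhZ : Measurable fun x => h (Z x) := hhm.comp hZ.measurable
  calc _ ≤ distL1 (fun x => g (Z x)) (fun x => h (Z x)) + distL1 (fun x => h (Z x)) g :=
        distL1_triangle hgZ hhZ hg
    _ ≤ distL1 (fun x => g (Z x)) (fun x => h (Z x)) +
        (distL1 (fun x => h (Z x)) h + distL1 h g) := by
        gcongr; exact distL1_triangle hhZ hhm hg
    _ ≤ ε' + (ε' + ε') := by gcongr
    _ = (ε' : ℝ≥0∞) * 3 := by ring

/-! ### Transported functions -/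

/-- The function `g` transported by the schedule of `S` up to time `t`. -/
def push (L : Idx → ℕ) (g : T2 → ℝ) (S : Finset Idx) (t : ℝ) (x : T2) : ℝ :=
  g ((flow (sched L S) t).symm x)

theorem measurable_push {g : T2 → ℝ} (hg : Measurable g) (S : Finset Idx) (t : ℝ) :
    Measurable (push L g S t) := hg.comp (flow (sched L S) t).symm.measurable

theorem measurable_uncurry_push {g : T2 → ℝ} (hg : Measurable g) (S : Finset Idx) :
    Measurable fun z : ℝ × T2 => push L g S z.1 z.2 := hg.comp (measurable_flow_symm _)

theorem measurePreserving_flow_symm (l : List Step) (t : ℝ) :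
    MeasurePreserving (flow l t).symm volume volume :=
  (measurePreserving_flow l t).symm (flow l t)

theorem memLp_push {g : T2 → ℝ} {p : ℝ≥0∞} (hg : MemLp g p volume) (S : Finset Idx) (t : ℝ) :
    MemLp (push L g S t) p volume :=
  hg.comp_measurePreserving (measurePreserving_flow_symm _ t)

theorem push_union (g : T2 → ℝ) {A B : Finset Idx} (h : ∀ P ∈ A, ∀ Q ∈ B, P.TimeLT Q) (t : ℝ)
    (x : T2) : push L g (A ∪ B) t x = push L g A t ((flow (sched L B) t).symm x) := by
  rw [push, sched_union h, flow_append]; rfl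

theorem dist_flow_symm_le (l : List Step) (t : ℝ) (x : T2) :
    dist ((flow l t).symm x) x ≤ (l.map fun s => s.b - s.a).sum := by
  have h := dist_flow_le l t ((flow l t).symm x)
  rwa [MeasurableEquiv.apply_symm_apply, dist_comm] at h

theorem flow_sched_of_le {S : Finset Idx} {t : ℝ} (h : ∀ P ∈ S, t ≤ P.start) :
    flow (sched L S) t = MeasurableEquiv.refl T2 := by
  refine flow_of_le fun s hs => ?_
  obtain ⟨P, hP, hs⟩ := mem_sched.1 hs
  exact (h P hP).trans (Idx.mem_steps hs).1

theorem flow_sched_of_ge {S : Finset Idx} {t : ℝ} (h : ∀ P ∈ S, P.start + P.dur ≤ t) :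
    flow (sched L S) t = final L S := by
  refine flow_of_ge (fun s hs => ?_) fun s hs => le_of_mem_sched hs
  obtain ⟨P, hP, hs⟩ := mem_sched.1 hs
  exact (Idx.mem_steps hs).2.trans (h P hP)

namespace Idx

/-- The indices `P ≤ K` with `m`-entry at most `m`. -/
def low (K : Idx) (m : ℕ) : Finset Idx := (upTo K).filter fun P => P.m ≤ m

theorem mem_low {K P : Idx} {m : ℕ} : P ∈ low K m ↔ P ≤ K ∧ P.m ≤ m := by
  rw [low, Finset.mem_filter, mem_upTo]

theorem tendsto_total_Ioi : Tendsto (fun K : Idx => total (Ioi K)) atTop (𝓝 0) := by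
  have h1 : Tendsto upTo atTop atTop := by
    refine tendsto_atTop_finset_of_monotone ?_ fun P => ⟨P, mem_upTo.2 le_rfl⟩
    intro K K' h P hP
    exact mem_upTo.2 ((mem_upTo.1 hP).trans h)
  have h2 : Tendsto (fun K => ∑ P ∈ upTo K, P.dur) atTop (𝓝 42) := hasSum_dur.comp h1
  have h3 : ∀ K, total (Ioi K) = 42 - ∑ P ∈ upTo K, P.dur := by
    intro K
    rw [eq_sub_iff_add_eq', ← total_finset, coe_upTo, ← total_univ, ← Iic_union_Ioi (a := K),
      total_union (Iic_disjoint_Ioi le_rfl)]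
  simp only [h3]
  simpa using h2.const_sub 42

end Idx

theorem push_low_eq_of_le (g : T2 → ℝ) {K : Idx} {m : ℕ} {t : ℝ} (ht : t ≤ Idx.cut (m + 1)) :
    push L g (Idx.upTo K) t = push L g (Idx.low K m) t := by
  have he : Idx.upTo K = Idx.low K m ∪ (Idx.upTo K).filter fun P => m < P.m := by
    ext P
    simp only [Idx.low, Finset.mem_union, Finset.mem_filter]
    have : P.m ≤ m ∨ m < P.m := le_or_gt _ _
    tauto
  ext x
  rw [he, push_union, flow_sched_of_le]
  · rfl
  · intro P hP
    exact ht.trans (Idx.cut_le_start (Finset.mem_filter.1 hP).2)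
  · intro P hP Q hQ
    rw [Idx.mem_low] at hP
    rw [Finset.mem_filter] at hQ
    exact Idx.timeLT_iff.2 (Or.inl (hP.2.trans_lt hQ.2))

theorem push_low_of_ge (g : T2 → ℝ) {K : Idx} {m : ℕ} {t : ℝ} (ht : Idx.cut (m + 1) ≤ t) :
    push L g (Idx.low K m) t = push L g (Idx.low K m) 42 := by
  ext x
  rw [push, push, flow_sched_of_ge, flow_sched_of_ge]
  · exact fun P _ => P.start_add_dur_le
  · exact fun P hP => (Idx.start_add_dur_le_cut
      (Nat.lt_succ_of_le (Idx.mem_low.1 hP).2)).trans ht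

/-- Uniform convergence in `L¹` of the transported functions, up to the completion of any given
block. -/
theorem exists_distL1_push_low_le {g : T2 → ℝ} (hg : Measurable g) (hg1 : MemLp g 1 volume)
    (m : ℕ) : ∀ {ε : ℝ≥0∞}, ε ≠ 0 → ∃ K₀ : Idx, ∀ K ≥ K₀, ∀ K' ≥ K₀, ∀ t,
      distL1 (push L g (Idx.low K' m) t) (push L g (Idx.low K m) t) ≤ ε := by
  induction m with
  | zero =>
    intro ε _
    refine ⟨Classical.arbitrary _, fun K _ K' _ t => ?_⟩
    have he : ∀ K, Idx.low K 0 = ∅ := fun K => by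
      ext P
      have := P.one_le_m
      simp only [Idx.mem_low, Finset.notMem_empty, iff_false]; omega
    rw [he, he, distL1_self]; exact zero_le
  | succ m ih =>
    intro ε hε
    have hε' : ε / 4 ≠ 0 := ENNReal.div_ne_zero.2 ⟨hε, by norm_num⟩
    obtain ⟨K₁, hK₁⟩ := ih hε'
    obtain ⟨δ, hδ, hE⟩ := exists_distL1_comp_le (measurable_push (L := L) hg (Idx.low K₁ m) 42)
      (memLp_push hg1 _ _) hε'
    obtain ⟨K₂, hK₂⟩ := eventually_atTop.1 (Idx.tendsto_total_Ioi.eventually (gt_mem_nhds hδ))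
    have key : ∀ K ≥ max K₁ K₂, ∀ K' ≥ K, ∀ t,
        distL1 (push L g (Idx.low K' (m + 1)) t) (push L g (Idx.low K (m + 1)) t) ≤ ε := by
      intro K hK K' hK' t
      have hK1 : K₁ ≤ K := (le_max_left _ _).trans hK
      -- `B` is the part of block `m + 1` already present for `K`, and `D` the part added by passing
      -- to `K'`. With equal `m`, a lexicographically larger index comes earlier in time, so all of
      -- `D` is inserted before `B`.
      set B := (Idx.upTo K).filter fun P => P.m = m + 1 with hB
      set D := (Idx.upTo K').filter fun P => P.m = m + 1 ∧ K < P with hD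
      have eK : Idx.low K (m + 1) = Idx.low K m ∪ B := by
        ext P
        simp only [Idx.mem_low, hB, Finset.mem_union, Finset.mem_filter, Idx.mem_upTo]
        have : P.m ≤ m + 1 ↔ P.m ≤ m ∨ P.m = m + 1 := by omega
        tauto
      have eK' : Idx.low K' (m + 1) = (Idx.low K' m ∪ D) ∪ B := by
        ext P
        simp only [Idx.mem_low, hB, hD, Finset.mem_union, Finset.mem_filter, Idx.mem_upTo]
        have h1 : P.m ≤ m + 1 ↔ P.m ≤ m ∨ P.m = m + 1 := by omega
        have h2 : P ≤ K ∨ K < P := le_or_gt _ _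
        have h3 : P ≤ K → P ≤ K' := fun h => h.trans hK'
        tauto
      have o1 : ∀ P ∈ Idx.low K m, ∀ Q ∈ B, P.TimeLT Q := by
        intro P hP Q hQ
        rw [Idx.mem_low] at hP; rw [hB, Finset.mem_filter] at hQ
        exact Idx.timeLT_iff.2 (Or.inl (by omega))
      have o2 : ∀ P ∈ Idx.low K' m, ∀ Q ∈ D, P.TimeLT Q := by
        intro P hP Q hQ
        rw [Idx.mem_low] at hP; rw [hD, Finset.mem_filter] at hQ
        exact Idx.timeLT_iff.2 (Or.inl (by omega))
      have o3 : ∀ P ∈ Idx.low K' m ∪ D, ∀ Q ∈ B, P.TimeLT Q := by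
        intro P hP Q hQ
        rw [hB, Finset.mem_filter, Idx.mem_upTo] at hQ
        rcases Finset.mem_union.1 hP with hP | hP
        · rw [Idx.mem_low] at hP
          exact Idx.timeLT_iff.2 (Or.inl (by omega))
        · rw [hD, Finset.mem_filter] at hP
          have hlt := Idx.lt_iff.1 (hQ.1.trans_lt hP.2.2)
          rw [Idx.timeLT_iff]
          omega
      set Z := (flow (sched L D) t).symm with hZ
      have hZm : MeasurePreserving Z volume volume := measurePreserving_flow_symm _ _
      set F := push L g (Idx.low K m) t with hF
      set F' := push L g (Idx.low K' m) t with hF'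
      set G := push L g (Idx.low K₁ m) 42 with hG
      have mF : Measurable F := measurable_push hg _ _
      have mF' : Measurable F' := measurable_push hg _ _
      have mG : Measurable G := measurable_push hg _ _
      have mFZ : Measurable fun x => F (Z x) := mF.comp hZm.measurable
      have mFZ' : Measurable fun x => F' (Z x) := mF'.comp hZm.measurable
      have mGZ : Measurable fun x => G (Z x) := mG.comp hZm.measurable
      have e1 : push L g (Idx.low K (m + 1)) t = fun x => F ((flow (sched L B) t).symm x) := by
        ext x; rw [eK, push_union g o1]
      have e2 : push L g (Idx.low K' (m + 1)) t =
          fun x => (fun y => F' (Z y)) ((flow (sched L B) t).symm x) := by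
        ext x; rw [eK', push_union g o3, push_union g o2]
      -- `B` acts last in both schedules and by the same measure-preserving map, so it drops out of
      -- the distance.
      rw [e1, e2, distL1_comp mFZ' mF (measurePreserving_flow_symm _ _)]
      have b1 : distL1 (fun x => F' (Z x)) (fun x => F (Z x)) ≤ ε / 4 := by
        rw [distL1_comp mF' mF hZm]
        exact hK₁ K hK1 K' (hK1.trans hK') t
      -- Up to the cut `D` has not begun. After it, `F` is the completed state of the first `m`
      -- blocks and is close to `G`. Since `G` was fixed before `δ`, independently of `K` and `t`,
      -- one `δ` serves all of them.
      have b2 : distL1 (fun x => F (Z x)) F ≤ ε / 4 + (ε / 4 + ε / 4) := by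
        rcases le_total t (Idx.cut (m + 1)) with ht | ht
        · have : Z = MeasurableEquiv.refl T2 := by
            rw [hZ, flow_sched_of_le]
            · rfl
            · intro P hP
              rw [hD, Finset.mem_filter] at hP
              exact ht.trans (Idx.cut_le_start hP.2.1.ge)
          have e : (fun x => F (Z x)) = F := by rw [this]; rfl
          rw [e, distL1_self]
          exact zero_le
        · have eF : F = push L g (Idx.low K m) 42 := push_low_of_ge g ht
          have c1 : distL1 F G ≤ ε / 4 := by rw [eF]; exact hK₁ K₁ le_rfl K hK1 42
          have c2 : distL1 (fun x => G (Z x)) G ≤ ε / 4 := by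
            refine hE Z hZm fun x => ?_
            refine (dist_flow_symm_le _ _ _).trans ?_
            rw [sum_sched, ← Idx.total_finset]
            refine (Idx.total_mono ?_).trans (hK₂ K ((le_max_right _ _).trans hK)).le
            intro P hP
            have hP' : P ∈ D := hP
            rw [hD, Finset.mem_filter] at hP'
            exact hP'.2.2
          calc distL1 (fun x => F (Z x)) F
              ≤ distL1 (fun x => F (Z x)) (fun x => G (Z x)) + distL1 (fun x => G (Z x)) F :=
                distL1_triangle mFZ mGZ mF
            _ ≤ distL1 (fun x => F (Z x)) (fun x => G (Z x)) +
                (distL1 (fun x => G (Z x)) G + distL1 G F) := by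
                gcongr; exact distL1_triangle mGZ mG mF
            _ ≤ ε / 4 + (ε / 4 + ε / 4) := by
                gcongr
                · rwa [distL1_comp mF mG hZm]
                · rwa [distL1_comm]
      calc distL1 (fun x => F' (Z x)) F
          ≤ distL1 (fun x => F' (Z x)) (fun x => F (Z x)) + distL1 (fun x => F (Z x)) F :=
            distL1_triangle mFZ' mFZ mF
        _ ≤ ε / 4 + (ε / 4 + (ε / 4 + ε / 4)) := by gcongr
        _ = ε / 4 * 4 := by ring
        _ = ε := ENNReal.div_mul_cancel (by norm_num) (by norm_num)
    refine ⟨max K₁ K₂, fun K hK K' hK' t => ?_⟩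
    rcases le_total K K' with h | h
    · exact key K hK K' h t
    · rw [distL1_comm]; exact key K' hK' K h t

/-- Transported functions are continuous in time with values in `L¹`. -/
theorem tendsto_distL1_push {g : T2 → ℝ} (hg : Measurable g) (hg1 : MemLp g 1 volume)
    (S : Finset Idx) (s : ℝ) :
    Tendsto (fun t => distL1 (push L g S t) (push L g S s)) (𝓝 s) (𝓝 0) := by
  rw [ENNReal.tendsto_nhds_zero]
  intro ε hε
  obtain ⟨δ, hδ, hE⟩ := exists_distL1_comp_le (measurable_push (L := L) hg S s)
    (memLp_push hg1 _ _) hε.ne'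
  set l := sched L S with hl
  have hlen : (0 : ℝ) < l.length + 1 := by positivity
  filter_upwards [Metric.ball_mem_nhds s (div_pos hδ hlen)] with t ht
  have e : push L g S t = fun x => push L g S s (flow l s ((flow l t).symm x)) := by
    ext x; simp [push, ← hl]
  rw [e]
  refine hE _ ((measurePreserving_flow l s).comp (measurePreserving_flow_symm l t)) fun x => ?_
  set y := (flow l t).symm x with hy
  have hx : x = flow l t y := by simp [hy]
  rw [hx]
  obtain ⟨γ, h1, h2, -⟩ := exists_curve_flow (chrono_sched (L := L) S) y
  rw [← h2, ← h2]
  refine (dist_mk2_le _ _).trans ?_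
  rw [← dist_eq_norm]
  refine (h1.dist_le_mul s t).trans ?_
  rw [Metric.mem_ball, dist_comm] at ht
  have := mul_le_mul_of_nonneg_left ht.le (show (0 : ℝ) ≤ l.length by positivity)
  refine this.trans ?_
  rw [mul_div_assoc', div_le_iff₀ hlen]
  nlinarith

variable {L : Idx → ℕ}

/-! ### Averaging -/

instance isAddLeftInvariant_T2 : (volume : Measure T2).IsAddLeftInvariant := by
  rw [Measure.volume_eq_prod]
  infer_instance

theorem abs_integral_mul_sub_le {F k k' : T2 → ℝ} {C : ℝ} (hF : Measurable F)
    (hC : ∀ x, |F x| ≤ C) (hk : Integrable k volume) (hk' : Integrable k' volume) :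
    |(∫ x, F x * k x) - ∫ x, F x * k' x| ≤ C * ∫ x, ‖k x - k' x‖ := by
  have hC' : ∀ᵐ x : T2, ‖F x‖ ≤ C := Eventually.of_forall hC
  rw [← integral_sub (hk.bdd_mul hF.aestronglyMeasurable hC')
    (hk'.bdd_mul hF.aestronglyMeasurable hC'), ← Real.norm_eq_abs, ← integral_const_mul]
  refine norm_integral_le_of_norm_le ((hk.sub hk').norm.const_mul C)
    (Eventually.of_forall fun x => ?_)
  rw [← mul_sub, norm_mul]
  exact mul_le_mul_of_nonneg_right (hC x) (norm_nonneg _)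

theorem exists_gridShift_near (n : ℕ) (s : T2) :
    ∃ p q : ℤ, ∀ x : T2, dist (x + gridShift n p q) (x + s) ≤ 1 / 2 ^ n := by
  refine ⟨lev n (rep s.1), lev n (rep s.2), fun x => ?_⟩
  rw [dist_add_left]
  have h := dist_mk2_le ((lev n (rep s.1) : ℝ) / 2 ^ n, (lev n (rep s.2) : ℝ) / 2 ^ n) (rep2 s)
  rw [mk2_rep2] at h
  refine h.trans ?_
  have key : ∀ a : ℝ, |(lev n a : ℝ) / 2 ^ n - a| ≤ 1 / 2 ^ n := by
    intro a
    have h := (lev_eq_iff (N := n) (a := a)).1 rfl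
    rw [add_div] at h
    rw [abs_le]
    constructor <;> linarith [h.1, h.2, show (0 : ℝ) < 1 / 2 ^ n by positivity]
  exact max_le (key _) (key _)

/-- Functions with small dyadic periods are nearly independent of continuous functions. -/
theorem abs_integral_mul_sub_integral_le {n : ℕ} {f h : T2 → ℝ} {B η : ℝ} (hf : Continuous f)
    (hη : ∀ x y, dist x y ≤ 1 / 2 ^ n → |f x - f y| ≤ η) (hh : Measurable h)
    (hB : ∀ x, |h x| ≤ B) (hper : ∀ p q : ℤ, ∀ᵐ x, h (x + gridShift n p q) = h x) :
    |(∫ x, f x * h x) - (∫ x, f x) * ∫ x, h x| ≤ η * B := by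
  obtain ⟨Cf, hCf⟩ := isCompact_univ.exists_bound_of_continuousOn hf.continuousOn
  have hB' : ∀ᵐ x : T2, ‖h x‖ ≤ B := Eventually.of_forall hB
  have hη0 : 0 ≤ η := (abs_nonneg _).trans (hη 0 0 (by simp))
  have i1 : ∀ s : T2, Integrable (fun x => f (x + s) * h x) volume := by
    intro s
    refine Integrable.mul_bdd (c := B) ?_ hh.aestronglyMeasurable hB'
    exact Integrable.of_bound (hf.comp (continuous_add_const s)).aestronglyMeasurable Cf
      (Eventually.of_forall fun x => hCf _ (mem_univ _))
  -- Any translation `s` is within `2^{-n}` of a grid translation. The latter can be moved onto `f`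
  -- without changing the integral, by the periodicity of `h`, and then replaced by `s` at the cost
  -- `η`.
  have h1 : ∀ s : T2, |(∫ x, f x * h x) - ∫ x, f (x + s) * h x| ≤ η * B := by
    intro s
    obtain ⟨p, q, hpq⟩ := exists_gridShift_near n s
    have e : ∫ x, f x * h x = ∫ x, f (x + gridShift n p q) * h x := by
      rw [← integral_add_right_eq_self (fun x => f x * h x) (gridShift n p q)]
      refine integral_congr_ae ?_
      filter_upwards [hper p q] with x hx
      rw [hx]
    rw [e, ← integral_sub (i1 _) (i1 s), ← Real.norm_eq_abs]
    refine (norm_integral_le_of_norm_le_const (C := η * B) (Eventually.of_forall fun x => ?_)).trans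
      (by simp)
    rw [← sub_mul, norm_mul]
    exact mul_le_mul (hη _ _ (hpq x)) (hB x) (norm_nonneg _) hη0
  have hF : Integrable (Function.uncurry fun (s x : T2) => f (x + s) * h x)
      (volume.prod volume) := by
    refine Integrable.of_bound (C := Cf * B) ?_ (Eventually.of_forall fun z => ?_)
    · exact (hf.comp (continuous_snd.add continuous_fst)).aestronglyMeasurable.mul
        (hh.comp measurable_snd).aestronglyMeasurable
    · rw [Function.uncurry, norm_mul]
      exact mul_le_mul (hCf _ (mem_univ _)) (hB _) (norm_nonneg _)
        ((norm_nonneg _).trans (hCf 0 (mem_univ _)))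
  -- Averaging over all translations replaces `f` by its mean, by Fubini and the invariance of the
  -- measure.
  have h2 : ∫ s, ∫ x, f (x + s) * h x = (∫ x, f x) * ∫ x, h x := by
    rw [integral_integral_swap hF]
    simp only [integral_mul_const]
    rw [← integral_const_mul]
    congr 1
    ext x
    rw [integral_add_left_eq_self f x]
  rw [← h2]
  have h3 : ∫ x, f x * h x = ∫ _ : T2, ∫ x, f x * h x := by simp
  rw [h3, ← integral_sub (g := fun s => ∫ x, f (x + s) * h x) (integrable_const _)
    hF.integral_prod_left, ← Real.norm_eq_abs]
  exact (norm_integral_le_of_norm_le_const (C := η * B) (Eventually.of_forall h1)).trans (by simp)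

/-! ### Mixing of observables that depend on finitely many digits -/

/-- Functions of the first `M` binary digits of both coordinates. -/
def IsLevel (M : ℕ) (q : T2 → ℝ) : Prop :=
  ∀ x y, (∀ c, (c = 1 ∨ c = 2) → lev M (crd c x) = lev M (crd c y)) → q x = q y

theorem low_top (M N : ℕ) : Idx.low (Idx.top N) M = blocks M (N + 1) := by
  ext P
  rw [Idx.mem_low, Idx.le_top_iff, mem_blocks, and_comm]

theorem integral_push_mul (g : T2 → ℝ) (S : Finset Idx) (t : ℝ) (q : T2 → ℝ) :
    ∫ x, push L g S t x * q x = ∫ x, g x * q (flow (sched L S) t x) := by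
  rw [← (measurePreserving_flow (sched L S) t).integral_comp
    (flow (sched L S) t).measurableEmbedding]
  simp [push]

/-- By `ae_dig_blocks` the first `M` digits of the image are the digits `N+2-M, …, N+1` of `x`. All
of them lie beyond position `N+1-M`, so they do not feel the grid translation. -/
theorem ae_isLevel_final_periodic (hL : ∀ P : Idx, P.k + 1 ≤ L P) {M N : ℕ} (hM : M ≤ N)
    {q : T2 → ℝ} (hq : IsLevel M q) (i j : ℤ) :
    ∀ᵐ x, q (final L (blocks M N) (x + gridShift (N + 1 - M) i j)) =
      q (final L (blocks M N) x) := by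
  have h := ae_dig_blocks hL M hM
  have h' := (measurePreserving_add_right (volume : Measure T2)
    (gridShift (N + 1 - M) i j)).quasiMeasurePreserving.ae h
  filter_upwards [h, h'] with x h1 h2
  refine hq _ _ fun c hc => lev_eq_of_dig (crd_mem _ _) (crd_mem _ _) M fun r hr hr' => ?_
  rw [h1 c hc, h2 c hc, if_neg (by omega), if_pos hr', dig_crd_add_gridShift (by omega)]

theorem exists_pow_le {δ : ℝ} (hδ : 0 < δ) : ∃ n₀ : ℕ, ∀ n ≥ n₀, (1 : ℝ) / 2 ^ n ≤ δ := by
  obtain ⟨n₀, h⟩ := exists_pow_lt_of_lt_one hδ (by norm_num : (1 / 2 : ℝ) < 1)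
  refine ⟨n₀, fun n hn => ?_⟩
  rw [← one_div_pow]
  exact (pow_le_pow_of_le_one (by norm_num) (by norm_num) hn).trans h.le

/-- The completed first `M` blocks of a large schedule mix at scale `2⁻ᴹ`. -/
theorem tendsto_integral_push_top (hL : ∀ P : Idx, P.k + 1 ≤ L P) {g q : T2 → ℝ}
    (hg : Integrable g volume) {M : ℕ} (hq : IsLevel M q) (hqm : Measurable q) {B : ℝ}
    (hB : ∀ x, |q x| ≤ B) :
    Tendsto (fun N => ∫ x, push L g (Idx.low (Idx.top N) M) 42 x * q x) atTop
      (𝓝 ((∫ x, g x) * ∫ x, q x)) := by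
  have hB0 : 0 ≤ B := (abs_nonneg _).trans (hB 0)
  rw [Metric.tendsto_atTop]
  intro ε hε
  set η := ε / (4 * (B + 1)) with hη
  have hη0 : 0 < η := by positivity
  obtain ⟨g', hg1, hg'⟩ := hg.exists_boundedContinuous_integral_sub_le hη0
  have huc : UniformContinuous g' := CompactSpace.uniformContinuous_of_continuous g'.continuous
  obtain ⟨δ, hδ, hδ'⟩ := Metric.uniformContinuous_iff_le.1 huc η hη0
  obtain ⟨n₀, hn₀⟩ := exists_pow_le hδ
  refine ⟨n₀ + M, fun N hN => ?_⟩
  rw [Real.dist_eq, low_top, integral_push_mul]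
  set h : T2 → ℝ := fun x => q (final L (blocks M (N + 1)) x) with hh
  have hhm : Measurable h := hqm.comp (final L _).measurable
  have hhB : ∀ x, |h x| ≤ B := fun x => hB _
  have eq : ∫ x, q x = ∫ x, h x :=
    ((measurePreserving_final (L := L) (blocks M (N + 1))).integral_comp
      (final L _).measurableEmbedding q).symm
  -- The index `top N` has first entry `N + 1`, so the blocks reach digit `N + 2` and the period is
  -- `2^{-(N+2-M)}`.
  have a1 := abs_integral_mul_sub_integral_le (n := N + 1 + 1 - M) g'.continuous
    (fun x y hxy => hδ' (hxy.trans (hn₀ _ (by omega)))) hhm hhB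
    (fun i j => ae_isLevel_final_periodic hL (by omega) hq i j)
  have a2 := abs_integral_mul_sub_le hhm hhB hg hg'
  simp only [mul_comm (h _)] at a2
  have a3 : |(∫ x, g x) - ∫ x, g' x| ≤ η := by
    have := abs_integral_mul_sub_le (F := fun _ => 1) (C := 1) measurable_const (by simp) hg hg'
    simp only [one_mul] at this
    exact this.trans hg1
  have a4 : |∫ x, h x| ≤ B := by
    rw [← Real.norm_eq_abs]
    exact (norm_integral_le_of_norm_le_const (C := B) (Eventually.of_forall hhB)).trans (by simp)
  have a5 : |(∫ x, g' x) * (∫ x, h x) - (∫ x, g x) * ∫ x, h x| ≤ η * B := by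
    rw [← sub_mul, abs_mul, abs_sub_comm]
    exact mul_le_mul a3 a4 (abs_nonneg _) hη0.le
  have a6 : |(∫ x, g x * h x) - ∫ x, g' x * h x| ≤ B * η :=
    a2.trans (mul_le_mul_of_nonneg_left hg1 hB0)
  change |(∫ x, g x * h x) - (∫ x, g x) * ∫ x, q x| < ε
  rw [eq]
  have hfin : 3 * (η * B) < ε := by
    rw [hη, div_mul_eq_mul_div, mul_div_assoc', div_lt_iff₀ (by positivity)]
    nlinarith
  have t1 := abs_sub_le (∫ x, g x * h x) (∫ x, g' x * h x) ((∫ x, g x) * ∫ x, h x)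
  have t2 := abs_sub_le (∫ x, g' x * h x) ((∫ x, g' x) * ∫ x, h x) ((∫ x, g x) * ∫ x, h x)
  linarith

theorem abs_integral_mul_sub_le_distL1 {F G q : T2 → ℝ} {B ε : ℝ} (hε : 0 ≤ ε)
    (hF : Integrable F volume) (hG : Integrable G volume) (hqm : Measurable q)
    (hB : ∀ x, |q x| ≤ B) (h : distL1 F G ≤ ENNReal.ofReal ε) :
    |(∫ x, F x * q x) - ∫ x, G x * q x| ≤ B * ε := by
  have hB0 : 0 ≤ B := (abs_nonneg _).trans (hB 0)
  have a := abs_integral_mul_sub_le hqm hB hF hG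
  simp only [mul_comm (q _)] at a
  refine a.trans (mul_le_mul_of_nonneg_left ?_ hB0)
  rw [distL1, eLpNorm_one_eq_lintegral_enorm] at h
  rw [integral_norm_eq_lintegral_enorm (f := fun x => F x - G x) (hF.sub hG).1]
  exact ENNReal.toReal_le_of_le_ofReal hε h

/-- The digits are known explicitly only for truncations of the form `top N`. A general `K` is
compared with such an index through the `L¹` Cauchy estimate for the first `M` blocks. -/
theorem exists_low_mixed (hL : ∀ P : Idx, P.k + 1 ≤ L P) {g q : T2 → ℝ} (hgm : Measurable g)
    (hg : Integrable g volume) {M : ℕ} (hq : IsLevel M q) (hqm : Measurable q) {B : ℝ}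
    (hB : ∀ x, |q x| ≤ B) {ε : ℝ} (hε : 0 < ε) : ∃ K₀ : Idx, ∀ K ≥ K₀,
      |(∫ x, push L g (Idx.low K M) 42 x * q x) - (∫ x, g x) * ∫ x, q x| ≤ ε := by
  have hB0 : 0 ≤ B := (abs_nonneg _).trans (hB 0)
  have hg1 : MemLp g 1 volume := memLp_one_iff_integrable.2 hg
  set η := ε / (2 * (B + 1)) with hη
  have hη0 : 0 < η := by positivity
  obtain ⟨K₀, hK₀⟩ := exists_distL1_push_low_le (L := L) hgm hg1 M
    (ENNReal.ofReal_pos.2 hη0).ne'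
  have hlim := tendsto_integral_push_top hL hg hq hqm hB
  obtain ⟨N, hN1, hN2⟩ := ((Metric.tendsto_nhds.1 hlim (ε / 2) (by positivity)).and
    (Idx.tendsto_top.eventually_ge_atTop K₀)).exists
  refine ⟨K₀, fun K hK => ?_⟩
  have hi : ∀ K, Integrable (push L g (Idx.low K M) 42) volume := fun K =>
    memLp_one_iff_integrable.1 (memLp_push hg1 _ _)
  have a := abs_integral_mul_sub_le_distL1 hη0.le (hi K) (hi (Idx.top N)) hqm hB
    (hK₀ _ hN2 K hK 42)
  rw [Real.dist_eq] at hN1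
  have hfin : B * η ≤ ε / 2 := by
    rw [hη, mul_div_assoc', div_le_iff₀ (by positivity)]
    nlinarith
  have t := abs_sub_le (∫ x, push L g (Idx.low K M) 42 x * q x)
    (∫ x, push L g (Idx.low (Idx.top N) M) 42 x * q x) ((∫ x, g x) * ∫ x, q x)
  linarith

/-- After the first `M` blocks the integral against functions of level `M` is constant. -/
theorem integral_push_isLevel (hL : ∀ P : Idx, P.k + 1 ≤ L P) (g : T2 → ℝ) {q : T2 → ℝ} {M : ℕ}
    (hq : IsLevel M q) (K : Idx) {t : ℝ} (ht : Idx.cut (M + 1) ≤ t) :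
    ∫ x, push L g (Idx.upTo K) t x * q x = ∫ x, push L g (Idx.low K M) 42 x * q x := by
  have he : Idx.upTo K = Idx.low K M ∪ (Idx.upTo K).filter fun P => M < P.m := by
    ext P
    simp only [Idx.low, Finset.mem_union, Finset.mem_filter]
    have : P.m ≤ M ∨ M < P.m := le_or_gt _ _
    tauto
  have ho : ∀ P ∈ Idx.low K M, ∀ Q ∈ (Idx.upTo K).filter fun P => M < P.m, P.TimeLT Q := by
    intro P hP Q hQ
    rw [Idx.mem_low] at hP
    rw [Finset.mem_filter] at hQ
    exact Idx.timeLT_iff.2 (Or.inl (hP.2.trans_lt hQ.2))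
  rw [← push_low_of_ge g ht, integral_push_mul, integral_push_mul, he, sched_union ho]
  congr 1
  ext x
  congr 1
  rw [flow_append]
  refine hq _ _ fun c _ => lev_flow_sched (fun P hP => ?_) hL c t _
  have := (Finset.mem_filter.1 hP).2
  exact this.trans_le P.m_le_k

/-- The lower left corner of the dyadic square of level `M` that contains a point. -/
def corner (M : ℕ) (x : T2) : T2 :=
  mk2 ((lev M (crd 1 x) : ℝ) / 2 ^ M, (lev M (crd 2 x) : ℝ) / 2 ^ M)

theorem measurable_corner (M : ℕ) : Measurable (corner M) := by
  have h : ∀ c, Measurable fun x => (lev M (crd c x) : ℝ) / 2 ^ M := fun c =>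
    ((measurable_of_countable (fun r : ℤ => (r : ℝ))).comp
      ((measurable_lev M).comp (measurable_crd c))).div_const _
  exact measurable_mk2.comp ((h 1).prodMk (h 2))

theorem dist_corner_le (M : ℕ) (x : T2) : dist (corner M x) x ≤ 1 / 2 ^ M := by
  have e : x = mk2 (crd 1 x, crd 2 x) := (mk2_rep2 x).symm
  have key : ∀ a : ℝ, |(lev M a : ℝ) / 2 ^ M - a| ≤ 1 / 2 ^ M := by
    intro a
    have h := (lev_eq_iff (N := M) (a := a)).1 rfl
    rw [add_div] at h
    rw [abs_le]
    constructor <;> linarith [h.1, h.2, show (0 : ℝ) < 1 / 2 ^ M by positivity]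
  have h := dist_mk2_le ((lev M (crd 1 x) : ℝ) / 2 ^ M, (lev M (crd 2 x) : ℝ) / 2 ^ M)
    (crd 1 x, crd 2 x)
  rw [← e] at h
  exact h.trans (max_le (key _) (key _))

/-- Weak convergence to the mean, uniformly in time near and after the completion of the mixing. -/
theorem exists_mixed (hL : ∀ P : Idx, P.k + 1 ≤ L P) {g k : T2 → ℝ} (hgm : Measurable g) {C : ℝ}
    (hC : ∀ x, |g x| ≤ C) (hk : Integrable k volume) {ε : ℝ} (hε : 0 < ε) :
    ∃ (M : ℕ) (K₀ : Idx), ∀ K ≥ K₀, ∀ t ≥ Idx.cut (M + 1),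
      |(∫ x, push L g (Idx.upTo K) t x * k x) - (∫ x, g x) * ∫ x, k x| ≤ ε := by
  have hC0 : 0 ≤ C := (abs_nonneg _).trans (hC 0)
  have hg : Integrable g volume :=
    Integrable.of_bound hgm.aestronglyMeasurable C (Eventually.of_forall hC)
  set η := ε / (5 * (C + 1)) with hη
  have hη0 : 0 < η := by positivity
  obtain ⟨k', hk1, hk'⟩ := hk.exists_boundedContinuous_integral_sub_le hη0
  have huc : UniformContinuous k' := CompactSpace.uniformContinuous_of_continuous k'.continuous
  obtain ⟨δ, hδ, hδ'⟩ := Metric.uniformContinuous_iff_le.1 huc η hη0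
  obtain ⟨M, hM⟩ := exists_pow_le hδ
  -- Sampling a continuous approximation of `k` at the corners of the dyadic squares gives a
  -- function of level `M` within `2 * η` of `k` in `L¹`. The same `M` then determines the time from
  -- which the estimate holds.
  set q : T2 → ℝ := fun x => k' (corner M x) with hq
  have hqm : Measurable q := k'.continuous.measurable.comp (measurable_corner M)
  have hqB : ∀ x, |q x| ≤ ‖k'‖ := fun x => k'.norm_coe_le_norm _
  have hql : IsLevel M q := by
    intro x y h
    simp only [hq, corner]
    rw [h 1 (Or.inl rfl), h 2 (Or.inr rfl)]
  have hqi : Integrable q volume :=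
    Integrable.of_bound hqm.aestronglyMeasurable ‖k'‖ (Eventually.of_forall hqB)
  have hkq : ∫ x, ‖k x - q x‖ ≤ 2 * η := by
    have h1 : ∫ x, ‖k x - q x‖ ≤ ∫ x, (‖k x - k' x‖ + η) := by
      refine integral_mono (hk.sub hqi).norm ((hk.sub hk').norm.add (integrable_const η))
        fun x => ?_
      have h2 : ‖k' x - q x‖ ≤ η := by
        rw [← dist_eq_norm, dist_comm]
        exact hδ' ((dist_corner_le M x).trans (hM M le_rfl))
      have h3 := norm_sub_le_norm_sub_add_norm_sub (k x) (k' x) (q x)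
      change ‖k x - q x‖ ≤ ‖k x - k' x‖ + η
      linarith
    rw [integral_add (f := fun x => ‖k x - k' x‖) (hk.sub hk').norm (integrable_const η)] at h1
    simp only [integral_const, probReal_univ, one_smul] at h1
    linarith
  obtain ⟨K₀, hK₀⟩ := exists_low_mixed hL hgm hg hql hqm hqB hη0
  refine ⟨M, K₀, fun K hK t ht => ?_⟩
  have a1 := abs_integral_mul_sub_le (measurable_push (L := L) hgm (Idx.upTo K) t)
    (fun x => hC _) hk hqi
  rw [integral_push_isLevel hL g hql K ht] at a1
  have a2 := hK₀ K hK
  have a3 : |(∫ x, q x) - ∫ x, k x| ≤ 2 * η := by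
    have := abs_integral_mul_sub_le (F := fun _ => 1) (C := 1) measurable_const (by simp) hk hqi
    simp only [one_mul] at this
    rw [abs_sub_comm]
    exact this.trans hkq
  have a4 : |∫ x, g x| ≤ C := by
    rw [← Real.norm_eq_abs]
    exact (norm_integral_le_of_norm_le_const (C := C) (Eventually.of_forall hC)).trans (by simp)
  have a5 : |(∫ x, g x) * (∫ x, q x) - (∫ x, g x) * ∫ x, k x| ≤ C * (2 * η) := by
    rw [← mul_sub, abs_mul]
    exact mul_le_mul a4 a3 (abs_nonneg _) hC0
  have a6 := a1.trans (mul_le_mul_of_nonneg_left hkq hC0)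
  have hfin : C * (2 * η) + (η + C * (2 * η)) ≤ ε := by
    have : η * (5 * (C + 1)) = ε := by rw [hη]; field_simp
    nlinarith
  have t1 := abs_sub_le (∫ x, push L g (Idx.upTo K) t x * k x)
    (∫ x, push L g (Idx.low K M) 42 x * q x) ((∫ x, g x) * ∫ x, k x)
  have t2 := abs_sub_le (∫ x, push L g (Idx.low K M) 42 x * q x) ((∫ x, g x) * ∫ x, q x)
    ((∫ x, g x) * ∫ x, k x)
  linarith

variable {L : Idx → ℕ}

/-! ### The limit of the transported functions -/

namespace Idx

theorem cut_mono : Monotone cut := fun _ _ h => total_mono fun _ hQ => lt_of_lt_of_le hQ h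

theorem cut_lt (m : ℕ) : cut m < 42 := by
  have h1 : cut m ≤ (top m).start := cut_le_start (Nat.le_succ m)
  have h2 := (top m).start_add_dur_le
  have h3 := (top m).dur_pos
  linarith

end Idx

/-- `F` is the limit of the functions `g` transported by longer and longer schedules: before time
`42` uniformly in `L¹`, and equal to the mean of `g` afterwards. -/
structure IsPushLimit (L : Idx → ℕ) (g : T2 → ℝ) (C : ℝ) (F : ℝ → T2 → ℝ) : Prop where
  measurable : Measurable (Function.uncurry F)
  bound : ∀ t x, |F t x| ≤ C
  mean : ∀ t, 42 ≤ t → ∀ x, F t x = ∫ y, g y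
  conv : ∀ m, ∀ ε : ℝ≥0∞, ε ≠ 0 → ∃ K₀ : Idx, ∀ K ≥ K₀, ∀ t ≤ Idx.cut (m + 1),
    distL1 (push L g (Idx.upTo K) t) (F t) ≤ ε

/-- Along a suitable sequence of indices the transported functions are Cauchy in `L¹` at a geometric
rate, hence converge almost everywhere. Taking the limsup makes the limit jointly measurable in time
and space and keeps the pointwise bound. Fatou's lemma then transfers the Cauchy estimate to all
`K`. -/
theorem exists_isPushLimit {g : T2 → ℝ} (hg : Measurable g) {C : ℝ} (hC : ∀ x, |g x| ≤ C) :
    ∃ F, IsPushLimit L g C F := by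
  classical
  have hgi : Integrable g volume :=
    Integrable.of_bound hg.aestronglyMeasurable C (Eventually.of_forall hC)
  have hg1 : MemLp g 1 volume := memLp_one_iff_integrable.2 hgi
  have hhalf : ∀ j : ℕ, ((1 / 2 : ℝ≥0∞)) ^ j ≠ 0 := fun j => pow_ne_zero _ (by simp)
  choose κ' hκ' using fun j : ℕ => exists_distL1_push_low_le (L := L) hg hg1 j (hhalf j)
  -- The partial suprema make the `j`-th index admissible for all earlier tolerances, and `Idx.top
  -- j` makes the sequence cofinal.
  set κ : ℕ → Idx := fun j => partialSups κ' j ⊔ Idx.top j with hκ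
  have hκtop : Tendsto κ atTop atTop := tendsto_atTop_mono (fun j => le_sup_right) Idx.tendsto_top
  have hκle : ∀ {i j}, i ≤ j → κ' i ≤ κ j := fun {i j} h =>
    (le_partialSups_of_le κ' h).trans le_sup_left
  set F : ℝ → T2 → ℝ := fun t x => if t < 42 then
    limsup (fun j => push L g (Idx.upTo (κ j)) t x) atTop else ∫ y, g y with hF
  have hb : ∀ j t x, |push L g (Idx.upTo (κ j)) t x| ≤ C := fun j t x => hC _
  have hmean : |∫ y, g y| ≤ C := by
    rw [← Real.norm_eq_abs]
    exact (norm_integral_le_of_norm_le_const (C := C) (Eventually.of_forall hC)).trans (by simp)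
  refine ⟨F, ?_, ?_, fun t ht x => if_neg (not_lt.2 ht), ?_⟩
  · refine Measurable.ite (measurableSet_lt measurable_fst measurable_const) ?_ measurable_const
    exact Measurable.limsup fun j => measurable_uncurry_push hg _
  · intro t x
    by_cases ht : t < 42
    · have e : F t x = limsup (fun j => push L g (Idx.upTo (κ j)) t x) atTop := if_pos ht
      have hle : IsBoundedUnder (· ≤ ·) atTop fun j => push L g (Idx.upTo (κ j)) t x :=
        isBoundedUnder_of ⟨C, fun j => (abs_le.1 (hb j t x)).2⟩
      have hge : IsBoundedUnder (· ≥ ·) atTop fun j => push L g (Idx.upTo (κ j)) t x :=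
        isBoundedUnder_of ⟨-C, fun j => (abs_le.1 (hb j t x)).1⟩
      rw [e, abs_le]
      constructor
      · exact le_limsup_of_frequently_le
          (Frequently.of_forall fun j => (abs_le.1 (hb j t x)).1) hle
      · exact limsup_le_of_le hge.isCoboundedUnder_le
          (Eventually.of_forall fun j => (abs_le.1 (hb j t x)).2)
    · have e : F t x = ∫ y, g y := if_neg ht
      rwa [e]
  · intro m ε hε
    obtain ⟨K₀, hK₀⟩ := exists_distL1_push_low_le (L := L) hg hg1 m hε
    refine ⟨K₀, fun K hK t ht => ?_⟩
    have ht42 : t < 42 := ht.trans_lt (Idx.cut_lt _)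
    -- The estimate with tolerance `2^{-(N+m)}` covers the first `N + m` blocks, hence every time up
    -- to the cut considered here. Shifting the sequence by `m` makes this hold from `N = 0` on.
    have hcau : ∀ N i j : ℕ, N ≤ i → N ≤ j →
        eLpNorm ((fun x => push L g (Idx.upTo (κ (i + m))) t x) -
          fun x => push L g (Idx.upTo (κ (j + m))) t x) 1 volume < 2 * (1 / 2 : ℝ≥0∞) ^ N := by
      intro N i j hi hj
      have htN : t ≤ Idx.cut (N + m + 1) := ht.trans (Idx.cut_mono (by omega))
      rw [push_low_eq_of_le g htN, push_low_eq_of_le g htN]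
      refine (hκ' (N + m) _ (hκle (by omega)) _ (hκle (by omega)) t).trans_lt ?_
      have h1 : (1 / 2 : ℝ≥0∞) ^ (N + m) ≤ (1 / 2) ^ N :=
        pow_le_pow_of_le_one (by simp) (by simp) (by omega)
      refine h1.trans_lt ?_
      rw [two_mul]
      exact ENNReal.lt_add_right (ENNReal.pow_ne_top (by simp)) (hhalf N)
    have hsum : ∑' N : ℕ, 2 * (1 / 2 : ℝ≥0∞) ^ N ≠ ⊤ := by
      rw [ENNReal.tsum_mul_left, ENNReal.tsum_geometric]
      exact ENNReal.mul_ne_top (by simp) (by simp)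
    have hae := Lp.ae_tendsto_of_cauchy_eLpNorm
      (fun i => (measurable_push (L := L) hg (Idx.upTo (κ (i + m))) t).aestronglyMeasurable)
      le_rfl hsum hcau
    have hlim : ∀ᵐ x, Tendsto (fun j => push L g (Idx.upTo (κ j)) t x) atTop (𝓝 (F t x)) := by
      filter_upwards [hae] with x ⟨l, hl⟩
      have hl' := (tendsto_add_atTop_iff_nat
        (f := fun j => push L g (Idx.upTo (κ j)) t x) m).1 hl
      have e : F t x = l := (if_pos ht42).trans hl'.limsup_eq
      rwa [e]
    have hfatou := Lp.eLpNorm_lim_le_liminf_eLpNorm (p := 1) (μ := (volume : Measure T2))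
      (f := fun j x => push L g (Idx.upTo K) t x - push L g (Idx.upTo (κ j)) t x)
      (fun j => ((measurable_push hg _ _).sub (measurable_push hg _ _)).aestronglyMeasurable)
      (fun x => push L g (Idx.upTo K) t x - F t x)
      (hlim.mono fun x hx => hx.const_sub _)
    refine hfatou.trans (liminf_le_of_frequently_le' (Eventually.frequently ?_))
    filter_upwards [hκtop.eventually_ge_atTop K₀] with j hj
    rw [push_low_eq_of_le g ht, push_low_eq_of_le g ht]
    exact hK₀ _ hj K hK t

/-! ### From `L¹` to other topologies -/

/-- Interpolation between `L¹` and `L^∞`. -/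
theorem eLpNorm_le_of_bound {α : Type*} [MeasurableSpace α] {μ : Measure α} {u : α → ℝ} {B : ℝ}
    (hB : ∀ x, |u x| ≤ B) {p : ℝ≥0∞} (hp : 1 ≤ p) (hp' : p ≠ ⊤) :
    eLpNorm u p μ ≤ (ENNReal.ofReal B ^ (p.toReal - 1) * eLpNorm u 1 μ) ^ (1 / p.toReal) := by
  have hr : 1 ≤ p.toReal := by
    rw [← ENNReal.toReal_one]; exact ENNReal.toReal_mono hp' hp
  have hp0 : p ≠ 0 := (one_pos.trans_le hp).ne'
  rw [eLpNorm_eq_lintegral_rpow_enorm_toReal hp0 hp', eLpNorm_one_eq_lintegral_enorm]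
  refine ENNReal.rpow_le_rpow ?_ (by positivity)
  rw [← lintegral_const_mul' _ _ (ENNReal.rpow_ne_top_of_nonneg (by linarith)
    ENNReal.ofReal_ne_top)]
  refine lintegral_mono fun x => ?_
  have h1 : ‖u x‖ₑ ≤ ENNReal.ofReal B := by
    rw [← ofReal_norm]
    exact ENNReal.ofReal_le_ofReal (hB x)
  calc ‖u x‖ₑ ^ p.toReal = ‖u x‖ₑ ^ (p.toReal - 1 + 1) := by rw [sub_add_cancel]
    _ = ‖u x‖ₑ ^ (p.toReal - 1) * ‖u x‖ₑ := by
        rw [ENNReal.rpow_add_of_nonneg _ _ (by linarith) zero_le_one, ENNReal.rpow_one]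
    _ ≤ _ := by gcongr

theorem tendsto_interpolation {ι : Type*} {l : Filter ι} {a : ι → ℝ≥0∞} (ha : Tendsto a l (𝓝 0))
    (B : ℝ) {p : ℝ≥0∞} (hp : 1 ≤ p) (hp' : p ≠ ⊤) :
    Tendsto (fun i => (ENNReal.ofReal B ^ (p.toReal - 1) * a i) ^ (1 / p.toReal)) l (𝓝 0) := by
  have hr : 1 ≤ p.toReal := by
    rw [← ENNReal.toReal_one]; exact ENNReal.toReal_mono hp' hp
  have h1 : Tendsto (fun i => ENNReal.ofReal B ^ (p.toReal - 1) * a i) l (𝓝 0) := by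
    have := ENNReal.Tendsto.const_mul (a := ENNReal.ofReal B ^ (p.toReal - 1)) ha
      (Or.inr (ENNReal.rpow_ne_top_of_nonneg (by linarith) ENNReal.ofReal_ne_top))
    rwa [mul_zero] at this
  have h2 := h1.ennrpow_const (1 / p.toReal)
  rwa [ENNReal.zero_rpow_of_pos (by positivity)] at h2

/-- For bounded functions, convergence in `L¹` implies weak-* convergence. -/
theorem tendsto_integral_mul_of_distL1 {ι : Type*} {l : Filter ι} {G : ι → T2 → ℝ} {H : T2 → ℝ}
    {C : ℝ} (hG : ∀ i, Measurable (G i)) (hGC : ∀ i x, |G i x| ≤ C) (hH : Measurable H)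
    (hHC : ∀ x, |H x| ≤ C) (h : Tendsto (fun i => distL1 (G i) H) l (𝓝 0)) {k : T2 → ℝ}
    (hk : Integrable k volume) :
    Tendsto (fun i => ∫ x, G i x * k x) l (𝓝 (∫ x, H x * k x)) := by
  have hC0 : 0 ≤ C := (abs_nonneg _).trans (hHC 0)
  rw [Metric.tendsto_nhds]
  intro ε hε
  set η := ε / (4 * (C + 1)) with hη
  have hη0 : 0 < η := by positivity
  obtain ⟨k', hk1, hk'⟩ := hk.exists_boundedContinuous_integral_sub_le hη0
  set δ := ε / (4 * (‖k'‖ + 1)) with hδ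
  have hδ0 : 0 < δ := by positivity
  have hi : ∀ {G : T2 → ℝ}, Measurable G → (∀ x, |G x| ≤ C) → Integrable G volume :=
    fun hm hb => Integrable.of_bound hm.aestronglyMeasurable C (Eventually.of_forall hb)
  filter_upwards [ENNReal.tendsto_nhds_zero.1 h _ (ENNReal.ofReal_pos.2 hδ0)] with i hi'
  have a1 := (abs_integral_mul_sub_le (hG i) (hGC i) hk hk').trans
    (mul_le_mul_of_nonneg_left hk1 hC0)
  have a2 := (abs_integral_mul_sub_le hH hHC hk hk').trans (mul_le_mul_of_nonneg_left hk1 hC0)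
  have a3 := abs_integral_mul_sub_le_distL1 hδ0.le (hi (hG i) (hGC i)) (hi hH hHC)
    k'.continuous.measurable (fun x => k'.norm_coe_le_norm x) hi'
  have e1 : η * (4 * (C + 1)) = ε := by rw [hη]; field_simp
  have e2 : δ * (4 * (‖k'‖ + 1)) = ε := by rw [hδ]; field_simp
  have t1 := abs_sub_le (∫ x, G i x * k x) (∫ x, G i x * k' x) (∫ x, H x * k x)
  have t2 := abs_sub_le (∫ x, G i x * k' x) (∫ x, H x * k' x) (∫ x, H x * k x)
  rw [abs_sub_comm] at a2
  rw [Real.dist_eq]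
  nlinarith [norm_nonneg k']

variable {L : Idx → ℕ}

/-! ### The finite mixing fields -/

theorem regularFlow_mixFin (L : Idx → ℕ) (K : Idx) :
    RegularFlow 50 (mixFin K L) (flow (sched L (Idx.upTo K))) :=
  (regularFlow_flow (chrono_sched _) fun _ hs => nonneg_of_mem_sched hs).congr_field
    (ae_mixFin_eq K 0 50)

theorem memLp_of_bounded {α : Type*} [MeasurableSpace α] {μ : Measure α} [IsFiniteMeasure μ]
    {u : α → ℝ} {C : ℝ} (hu : Measurable u) (hC : ∀ x, |u x| ≤ C) (p : ℝ≥0∞) : MemLp u p μ :=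
  MemLp.of_bound hu.aestronglyMeasurable C (Eventually.of_forall hC)

theorem ae_norm_mixFin_le (L : Idx → ℕ) :
    ∀ᵐ z ∂(stMeasure 0 50), ∀ K, ‖mixFin K L z.1 z.2‖ ≤ 1 :=
  ae_all_iff.2 fun K => (regularFlow_mixFin L K).bound

theorem ae_norm_mixInf_le (L : Idx → ℕ) : ∀ᵐ z ∂(stMeasure 0 50), ‖mixInf L z.1 z.2‖ ≤ 1 := by
  filter_upwards [ae_norm_mixFin_le L] with z hz
  obtain ⟨K, hK⟩ := (eventually_mixFin_eq (L := L) z.1).exists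
  rw [← hK]
  exact hz K

theorem aestronglyMeasurable_mixInf (L : Idx → ℕ) :
    AEStronglyMeasurable (Function.uncurry (mixInf L)) (stMeasure 0 50) := by
  refine aestronglyMeasurable_of_tendsto_ae atTop
    (f := fun N => Function.uncurry (mixFin (Idx.top N) L))
    (fun N => (regularFlow_mixFin L (Idx.top N)).aesm) (Eventually.of_forall fun z => ?_)
  refine tendsto_nhds_of_eventually_eq ?_
  filter_upwards [Idx.tendsto_top.eventually (eventually_mixFin_eq (L := L) z.1)] with N hN
  exact hN z.2

/-- Integrals along the finite fields converge to integrals along the infinite field. -/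
theorem tendsto_integral_material_sub {φ : ℝ → T2 → ℝ} (hφ : IsTest 50 φ)
    {w : Idx → ℝ × T2 → ℝ} {C : ℝ} (hw : ∀ K, Measurable (w K)) (hC : ∀ K z, |w K z| ≤ C) :
    Tendsto (fun K => ∫ z, w K z * (material φ z (mixFin K L z.1 z.2) -
      material φ z (mixInf L z.1 z.2)) ∂(stMeasure 0 50)) atTop (𝓝 0) := by
  obtain ⟨M, hM0, hM⟩ := hφ.exists_bound 0 50
  suffices h : Tendsto (fun K => ∫ z, w K z * (material φ z (mixFin K L z.1 z.2) -
      material φ z (mixInf L z.1 z.2)) ∂(stMeasure 0 50)) atTop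
      (𝓝 (∫ _ : ℝ × T2, (0 : ℝ) ∂(stMeasure 0 50))) by rwa [integral_zero] at h
  refine tendsto_integral_filter_of_dominated_convergence (fun _ => C * (2 * M))
    (Eventually.of_forall fun K => ?_) (Eventually.of_forall fun K => ?_) (integrable_const _)
    (Eventually.of_forall fun z => ?_)
  · exact (hw K).aestronglyMeasurable.mul
      ((hφ.aestronglyMeasurable_material (regularFlow_mixFin L K).aesm).sub
        (hφ.aestronglyMeasurable_material (aestronglyMeasurable_mixInf L)))
  · filter_upwards [ae_norm_mixFin_le L, ae_norm_mixInf_le L, ae_mem_Icc 0 50] with z h1 h2 h3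
    have hC0 : 0 ≤ C := (abs_nonneg _).trans (hC K z)
    rw [norm_mul]
    refine mul_le_mul (hC K z) ?_ (norm_nonneg _) hC0
    refine (norm_sub_le _ _).trans ?_
    have b1 := hM z h3 _ (h1 K)
    have b2 := hM z h3 _ h2
    simp only [Real.norm_eq_abs]
    linarith
  · refine tendsto_nhds_of_eventually_eq ?_
    filter_upwards [eventually_mixFin_eq (L := L) z.1] with K hK
    rw [hK, sub_self, mul_zero]

theorem integrable_material_mixInf {φ : ℝ → T2 → ℝ} (hφ : IsTest 50 φ) :
    Integrable (fun z => material φ z (mixInf L z.1 z.2)) (stMeasure 0 50) := by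
  obtain ⟨M, hM0, hM⟩ := hφ.exists_bound 0 50
  refine Integrable.of_bound (hφ.aestronglyMeasurable_material (aestronglyMeasurable_mixInf L))
    M ?_
  filter_upwards [ae_norm_mixInf_le L, ae_mem_Icc 0 50] with z h1 h2 using hM z h2 _ h1

theorem integrable_material_mixFin (K : Idx) {φ : ℝ → T2 → ℝ} (hφ : IsTest 50 φ) :
    Integrable (fun z => material φ z (mixFin K L z.1 z.2)) (stMeasure 0 50) := by
  obtain ⟨M, hM0, hM⟩ := hφ.exists_bound 0 50
  refine Integrable.of_bound (hφ.aestronglyMeasurable_material (regularFlow_mixFin L K).aesm)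
    M ?_
  filter_upwards [ae_norm_mixFin_le L, ae_mem_Icc 0 50] with z h1 h2 using hM z h2 _ (h1 K)

/-- Subtracting the material derivatives of a finite field and the infinite one cancels the time
derivative. As the finite field is divergence-free, the integral of the difference does not depend
on `K`, while it tends to zero. -/
theorem isDivFree_mixInf (L : Idx → ℕ) : IsDivFree 50 (mixInf L) where
  integrable := Integrable.of_bound (aestronglyMeasurable_mixInf L) 1 (ae_norm_mixInf_le L)
  div_zero φ hφ hδ := by
    have h1 := tendsto_integral_material_sub (L := L) hφ (w := fun _ _ => 1) (C := 1)
      (fun _ => measurable_const) (by simp)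
    have h2 : ∀ K, ∫ z, (1 : ℝ) * (material φ z (mixFin K L z.1 z.2) -
        material φ z (mixInf L z.1 z.2)) ∂(stMeasure 0 50) =
        -∫ z, ((mixInf L z.1 z.2).1 * dfst φ z.1 z.2 + (mixInf L z.1 z.2).2 * dsnd φ z.1 z.2)
          ∂(stMeasure 0 50) := by
      intro K
      have hK := ((regularFlow_mixFin L K).isDivFree (by norm_num)).div_zero φ hφ hδ
      obtain ⟨M, hM0, hM⟩ := hφ.exists_bound 0 50
      have i0 : Integrable (fun z => material φ z 0) (stMeasure 0 50) := by
        refine Integrable.of_bound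
          (hφ.aestronglyMeasurable_material aestronglyMeasurable_const) M ?_
        filter_upwards [ae_mem_Icc 0 50] with z h2 using hM z h2 _ (by simp)
      have iK := (integrable_material_mixFin (L := L) K hφ).sub i0
      have iI := (integrable_material_mixInf (L := L) hφ).sub i0
      have e : ∀ u : ℝ × T2 → ℝ × ℝ, (fun z => (u z).1 * dfst φ z.1 z.2 +
          (u z).2 * dsnd φ z.1 z.2) = fun z => material φ z (u z) - material φ z 0 := by
        intro u; ext z; simp [material]
      have eK := e fun z => mixFin K L z.1 z.2
      have eI := e fun z => mixInf L z.1 z.2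
      rw [eK] at hK
      rw [eI]
      have h3 := integral_sub iK iI
      have e3 : (fun z : ℝ × T2 => (1 : ℝ) * (material φ z (mixFin K L z.1 z.2) -
          material φ z (mixInf L z.1 z.2))) = fun z =>
          ((fun z => material φ z (mixFin K L z.1 z.2)) - fun z => material φ z 0) z -
          ((fun z => material φ z (mixInf L z.1 z.2)) - fun z => material φ z 0) z := by
        ext z; simp
      rw [e3, h3]
      have hK' : ∫ z, ((fun z => material φ z (mixFin K L z.1 z.2)) -
        fun z => material φ z 0) z ∂(stMeasure 0 50) = 0 := hK
      rw [hK', zero_sub]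
      rfl
    simp only [h2] at h1
    have := tendsto_nhds_unique tendsto_const_nhds h1
    linarith

/-! ### Properties of the limit and modes of convergence -/

namespace IsPushLimit

variable {g : T2 → ℝ} {C : ℝ} {F : ℝ → T2 → ℝ}

theorem measurable_apply (h : IsPushLimit L g C F) (t : ℝ) : Measurable (F t) :=
  h.measurable.comp measurable_prodMk_left

theorem tendsto_distL1 (h : IsPushLimit L g C F) {t : ℝ} (ht : t < 42) :
    Tendsto (fun K => distL1 (push L g (Idx.upTo K) t) (F t)) atTop (𝓝 0) := by
  rw [ENNReal.tendsto_nhds_zero]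
  intro ε hε
  obtain ⟨m, hm⟩ := Idx.exists_cut_gt ht
  obtain ⟨K₀, hK₀⟩ := h.conv m ε hε.ne'
  filter_upwards [eventually_ge_atTop K₀] with K hK
  exact hK₀ K hK t (hm.le.trans (Idx.cut_mono (Nat.le_succ m)))

/-- Near `s < 42` the limit is a uniform limit in `L¹` of continuous curves. Choosing a cut strictly
beyond `s` leaves room for a two-sided neighbourhood. -/
theorem tendsto_distL1_time (h : IsPushLimit L g C F) (hg : Measurable g) (hC : ∀ x, |g x| ≤ C)
    {s : ℝ} (hs : s < 42) : Tendsto (fun t => distL1 (F t) (F s)) (𝓝 s) (𝓝 0) := by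
  rw [ENNReal.tendsto_nhds_zero]
  intro ε hε
  have hε' : ε / 3 ≠ 0 := ENNReal.div_ne_zero.2 ⟨hε.ne', by norm_num⟩
  obtain ⟨m, hm⟩ := Idx.exists_cut_gt hs
  have hm' : s < Idx.cut (m + 1) := hm.trans_le (Idx.cut_mono (Nat.le_succ m))
  obtain ⟨K, hK⟩ := h.conv m _ hε'
  have hp := ENNReal.tendsto_nhds_zero.1 (tendsto_distL1_push (L := L) hg
    (memLp_of_bounded hg hC 1) (Idx.upTo K) s) _ (pos_iff_ne_zero.2 hε')
  filter_upwards [hp, Iio_mem_nhds hm'] with t h1 h2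
  have mF := h.measurable_apply
  have mP := measurable_push (L := L) hg (Idx.upTo K)
  calc distL1 (F t) (F s)
      ≤ distL1 (F t) (push L g (Idx.upTo K) t) + distL1 (push L g (Idx.upTo K) t) (F s) :=
        distL1_triangle (mF t) (mP t) (mF s)
    _ ≤ distL1 (F t) (push L g (Idx.upTo K) t) +
        (distL1 (push L g (Idx.upTo K) t) (push L g (Idx.upTo K) s) +
          distL1 (push L g (Idx.upTo K) s) (F s)) := by
        gcongr; exact distL1_triangle (mP t) (mP s) (mF s)
    _ ≤ ε / 3 + (ε / 3 + ε / 3) := by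
        gcongr
        · rw [distL1_comm]; exact hK K le_rfl t (le_of_lt h2)
        · exact hK K le_rfl s hm'.le
    _ = ε / 3 * 3 := by ring
    _ = ε := ENNReal.div_mul_cancel (by norm_num) (by norm_num)

/-- Before time 42 this follows from the strong convergence; from 42 on, where the limit is constant
in space, it is the mixing estimate `exists_mixed`. -/
theorem tendsto_integral (h : IsPushLimit L g C F) (hL : ∀ P : Idx, P.k + 1 ≤ L P)
    (hg : Measurable g) (hC : ∀ x, |g x| ≤ C) {k : T2 → ℝ} (hk : Integrable k volume) (t : ℝ) :
    Tendsto (fun K => ∫ x, push L g (Idx.upTo K) t x * k x) atTop (𝓝 (∫ x, F t x * k x)) := by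
  rcases lt_or_ge t 42 with ht | ht
  · exact tendsto_integral_mul_of_distL1 (fun K => measurable_push hg _ _) (fun K x => hC _)
      (h.measurable_apply t) (h.bound t) (h.tendsto_distL1 ht) hk
  · simp only [h.mean t ht, integral_const_mul]
    rw [Metric.tendsto_nhds]
    intro ε hε
    obtain ⟨M, K₀, hK₀⟩ := exists_mixed hL hg hC hk (half_pos hε)
    filter_upwards [eventually_ge_atTop K₀] with K hK
    rw [Real.dist_eq]
    have := hK₀ K hK t ((Idx.cut_le _).trans ht)
    linarith

theorem exists_near_mean (h : IsPushLimit L g C F) (hL : ∀ P : Idx, P.k + 1 ≤ L P)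
    (hg : Measurable g) (hC : ∀ x, |g x| ≤ C) {k : T2 → ℝ} (hk : Integrable k volume) {ε : ℝ}
    (hε : 0 < ε) : ∃ M : ℕ, ∀ t ≥ Idx.cut (M + 1),
      |(∫ x, F t x * k x) - (∫ x, g x) * ∫ x, k x| ≤ ε := by
  obtain ⟨M, K₀, hK₀⟩ := exists_mixed hL hg hC hk hε
  refine ⟨M, fun t ht => ?_⟩
  have h1 := ((h.tendsto_integral hL hg hC hk t).sub_const ((∫ x, g x) * ∫ x, k x)).abs
  exact le_of_tendsto h1 ((eventually_ge_atTop K₀).mono fun K hK => hK₀ K hK t ht)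

theorem continuous_integral (h : IsPushLimit L g C F) (hL : ∀ P : Idx, P.k + 1 ≤ L P)
    (hg : Measurable g) (hC : ∀ x, |g x| ≤ C) {k : T2 → ℝ} (hk : Integrable k volume) :
    Continuous fun t => ∫ x, F t x * k x := by
  rw [continuous_iff_continuousAt]
  intro s
  rcases lt_or_ge s 42 with hs | hs
  · exact tendsto_integral_mul_of_distL1 h.measurable_apply h.bound
      (h.measurable_apply s) (h.bound s) (h.tendsto_distL1_time hg hC hs) hk
  · rw [ContinuousAt]
    have e : ∫ x, F s x * k x = (∫ x, g x) * ∫ x, k x := by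
      simp only [h.mean s hs, integral_const_mul]
    rw [e, Metric.tendsto_nhds]
    intro ε hε
    -- For continuity at time 42 the estimate must already hold slightly earlier: it is valid from a
    -- cut that lies strictly before 42.
    obtain ⟨M, hM⟩ := h.exists_near_mean hL hg hC hk (half_pos hε)
    filter_upwards [Ioi_mem_nhds ((Idx.cut_lt (M + 1)).trans_le hs)] with t ht
    rw [Real.dist_eq]
    have := hM t (le_of_lt ht)
    linarith

/-- Weak-* convergence on space-time. -/
theorem tendsto_integral_stMeasure (h : IsPushLimit L g C F) (hL : ∀ P : Idx, P.k + 1 ≤ L P)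
    (hg : Measurable g) (hC : ∀ x, |g x| ≤ C) {a b : ℝ} {k : ℝ × T2 → ℝ}
    (hk : Integrable k (stMeasure a b)) :
    Tendsto (fun K => ∫ z, push L g (Idx.upTo K) z.1 z.2 * k z ∂(stMeasure a b)) atTop
      (𝓝 (∫ z, F z.1 z.2 * k z ∂(stMeasure a b))) := by
  have iP : ∀ K, Integrable (fun z : ℝ × T2 => push L g (Idx.upTo K) z.1 z.2 * k z)
      (stMeasure a b) := fun K =>
    hk.bdd_mul (c := C) (measurable_uncurry_push hg _).aestronglyMeasurable
      (Eventually.of_forall fun z => hC _)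
  have iF : Integrable (fun z : ℝ × T2 => F z.1 z.2 * k z) (stMeasure a b) :=
    hk.bdd_mul (c := C) h.measurable.aestronglyMeasurable
      (Eventually.of_forall fun z => h.bound _ _)
  have eP : ∀ K, ∫ z, push L g (Idx.upTo K) z.1 z.2 * k z ∂(stMeasure a b) =
      ∫ t in Icc a b, ∫ x, push L g (Idx.upTo K) t x * k (t, x) := fun K => integral_prod _ (iP K)
  have eF : ∫ z, F z.1 z.2 * k z ∂(stMeasure a b) =
      ∫ t in Icc a b, ∫ x, F t x * k (t, x) := integral_prod _ iF
  simp only [eP, eF]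
  refine tendsto_integral_filter_of_dominated_convergence (fun t => ∫ x, C * ‖k (t, x)‖)
    (Eventually.of_forall fun K => (iP K).integral_prod_left.aestronglyMeasurable)
    (Eventually.of_forall fun K => ?_) (hk.norm.const_mul C).integral_prod_left ?_
  · filter_upwards [hk.prod_right_ae] with t ht
    refine norm_integral_le_of_norm_le (ht.norm.const_mul C) (Eventually.of_forall fun x => ?_)
    rw [norm_mul]
    exact mul_le_mul_of_nonneg_right (hC _) (norm_nonneg _)
  · filter_upwards [hk.prod_right_ae] with t ht
    exact h.tendsto_integral hL hg hC ht t

/-- The `L¹` convergence is uniform in time only away from 42. Here convergence at each `t < 42`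
suffices, by dominated convergence with the constant bound `2C`. -/
theorem tendsto_eLpNorm_one (h : IsPushLimit L g C F) (hg : Measurable g)
    (hC : ∀ x, |g x| ≤ C) :
    Tendsto (fun K => eLpNorm (fun z : ℝ × T2 => push L g (Idx.upTo K) z.1 z.2 - F z.1 z.2) 1
      (stMeasure 0 42)) atTop (𝓝 0) := by
  have hm : ∀ K, Measurable fun z : ℝ × T2 => ‖push L g (Idx.upTo K) z.1 z.2 - F z.1 z.2‖ₑ :=
    fun K => ((measurable_uncurry_push hg _).sub h.measurable).enorm
  have e : ∀ K, eLpNorm (fun z : ℝ × T2 => push L g (Idx.upTo K) z.1 z.2 - F z.1 z.2) 1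
      (stMeasure 0 42) = ∫⁻ t in Icc (0 : ℝ) 42, distL1 (push L g (Idx.upTo K) t) (F t) := by
    intro K
    rw [eLpNorm_one_eq_lintegral_enorm, stMeasure, lintegral_prod _ (hm K).aemeasurable]
    simp only [distL1, eLpNorm_one_eq_lintegral_enorm]
  simp only [e]
  suffices h : Tendsto (fun K => ∫⁻ t in Icc (0 : ℝ) 42, distL1 (push L g (Idx.upTo K) t) (F t))
      atTop (𝓝 (∫⁻ _ in Icc (0 : ℝ) 42, (0 : ℝ≥0∞))) by rwa [lintegral_zero] at h
  refine tendsto_lintegral_filter_of_dominated_convergence (fun _ => ENNReal.ofReal (C + C))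
    (Eventually.of_forall fun K => ?_) (Eventually.of_forall fun K =>
      Eventually.of_forall fun t => ?_) ?_ ?_
  · simp only [distL1, eLpNorm_one_eq_lintegral_enorm]
    exact (hm K).lintegral_prod_right'
  · refine (eLpNorm_le_of_ae_bound (C := C + C) (Eventually.of_forall fun x => ?_)).trans
      (by simp)
    exact (norm_sub_le _ _).trans (add_le_add (hC _) (h.bound t x))
  · simp [ENNReal.mul_eq_top]
  · have hne : ∀ᵐ t ∂((volume : Measure ℝ).restrict (Icc (0 : ℝ) 42)), t ≠ 42 :=
      ae_restrict_of_ae (by simp [ae_iff])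
    filter_upwards [hne, ae_restrict_mem measurableSet_Icc] with t h1 h2
    exact h.tendsto_distL1 (lt_of_le_of_ne h2.2 h1)

theorem abs_push_sub_le (h : IsPushLimit L g C F) (hC : ∀ x, |g x| ≤ C) (S : Finset Idx) (t : ℝ)
    (x : T2) : |push L g S t x - F t x| ≤ C + C :=
  (abs_sub _ _).trans (add_le_add (hC _) (h.bound t x))

theorem tendsto_eLpNorm (h : IsPushLimit L g C F) (hg : Measurable g) (hC : ∀ x, |g x| ≤ C)
    {p : ℝ≥0∞} (hp : 1 ≤ p) (hp' : p ≠ ⊤) :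
    Tendsto (fun K => eLpNorm (fun z : ℝ × T2 => push L g (Idx.upTo K) z.1 z.2 - F z.1 z.2) p
      (stMeasure 0 42)) atTop (𝓝 0) := by
  have hb : ∀ (K : Idx) (z : ℝ × T2),
      |(fun z : ℝ × T2 => push L g (Idx.upTo K) z.1 z.2 - F z.1 z.2) z| ≤ C + C :=
    fun K z => h.abs_push_sub_le hC _ z.1 z.2
  exact tendsto_of_tendsto_of_tendsto_of_le_of_le tendsto_const_nhds
    (tendsto_interpolation (h.tendsto_eLpNorm_one hg hC) (C + C) hp hp') (fun _ => zero_le)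
    fun K => eLpNorm_le_of_bound (hb K) hp hp'

theorem tendsto_iSup_eLpNorm (h : IsPushLimit L g C F) (hC : ∀ x, |g x| ≤ C)
    {p : ℝ≥0∞} (hp : 1 ≤ p) (hp' : p ≠ ⊤) {ε : ℝ} (hε : 0 < ε) :
    Tendsto (fun K => ⨆ t ∈ Icc (0 : ℝ) (42 - ε),
      eLpNorm (fun x => push L g (Idx.upTo K) t x - F t x) p volume) atTop (𝓝 0) := by
  have h1 : Tendsto (fun K => ⨆ t ∈ Icc (0 : ℝ) (42 - ε),
      distL1 (push L g (Idx.upTo K) t) (F t)) atTop (𝓝 0) := by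
    rw [ENNReal.tendsto_nhds_zero]
    intro η hη
    obtain ⟨m, hm⟩ := Idx.exists_cut_gt (show 42 - ε < 42 by linarith)
    obtain ⟨K₀, hK₀⟩ := h.conv m η hη.ne'
    filter_upwards [eventually_ge_atTop K₀] with K hK
    exact iSup₂_le fun t ht => hK₀ K hK t
      (ht.2.trans (hm.le.trans (Idx.cut_mono (Nat.le_succ m))))
  refine tendsto_of_tendsto_of_tendsto_of_le_of_le tendsto_const_nhds
    (tendsto_interpolation h1 (C + C) hp hp') (fun _ => zero_le) fun K => ?_
  refine iSup₂_le fun t ht => ?_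
  refine (eLpNorm_le_of_bound (fun x => h.abs_push_sub_le hC _ t x) hp hp').trans ?_
  gcongr
  exact le_iSup₂ (f := fun t (_ : t ∈ Icc (0 : ℝ) (42 - ε)) =>
    distL1 (push L g (Idx.upTo K) t) (F t)) t ht

end IsPushLimit

/-- Bounded functions that are continuous in time with values in `L¹` are continuous with values
in `L^p`. -/
theorem memC0Lp_of_bounded {a b C : ℝ} {f : ℝ → T2 → ℝ} (hf : ∀ t, Measurable (f t))
    (hC : ∀ t x, |f t x| ≤ C)
    (h : ∀ s ∈ Icc a b, Tendsto (fun t => distL1 (f t) (f s)) (𝓝 s) (𝓝 0))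
    {p : ℝ≥0∞} (hp : 1 ≤ p) (hp' : p ≠ ⊤) : MemC0Lp a b p f := by
  refine ⟨fun t _ => memLp_of_bounded (hf t) (hC t) p, fun s hs => ?_⟩
  refine Tendsto.mono_left ?_ nhdsWithin_le_nhds
  exact tendsto_of_tendsto_of_tendsto_of_le_of_le tendsto_const_nhds
    (tendsto_interpolation (h s hs) (C + C) hp hp') (fun _ => zero_le)
    fun t => eLpNorm_le_of_bound
      (fun x => (abs_sub _ _).trans (add_le_add (hC t x) (hC s x))) hp hp'

theorem memC0Lp_push {g : T2 → ℝ} {C : ℝ} (hg : Measurable g) (hC : ∀ x, |g x| ≤ C)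
    (S : Finset Idx) (a b : ℝ) {p : ℝ≥0∞} (hp : 1 ≤ p) (hp' : p ≠ ⊤) :
    MemC0Lp a b p (push L g S) :=
  memC0Lp_of_bounded (measurable_push hg S) (fun _ _ => hC _)
    (fun s _ => tendsto_distL1_push hg (memLp_of_bounded hg hC 1) S s) hp hp'

/-- The weak formulation along a finite field splits into the same integral with the infinite field,
which passes to the limit by weak-* convergence against a fixed integrable function, and a remainder
with the difference of the fields, which vanishes by `tendsto_integral_material_sub`. -/
theorem IsPushLimit.isWeakSolution {g f₀ : T2 → ℝ} {C : ℝ} {F : ℝ → T2 → ℝ}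
    (h : IsPushLimit L g C F) (hL : ∀ P : Idx, P.k + 1 ≤ L P) (hg : Measurable g)
    (hC : ∀ x, |g x| ≤ C) (hf₀ : f₀ =ᵐ[volume] g) : IsWeakSolution 50 (mixInf L) f₀ F where
  field := isDivFree_mixInf L
  data := (memLp_one_iff_integrable.1 (memLp_of_bounded hg hC 1)).congr hf₀.symm
  integrable := memLp_one_iff_integrable.1
    (memLp_of_bounded h.measurable (fun z => h.bound z.1 z.2) 1)
  flux := by
    refine Integrable.of_bound (C := C * 1)
      (h.measurable.aestronglyMeasurable.smul (aestronglyMeasurable_mixInf L)) ?_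
    filter_upwards [ae_norm_mixInf_le L] with z hz
    rw [norm_smul]
    exact mul_le_mul (h.bound _ _) hz (norm_nonneg _) ((abs_nonneg _).trans (h.bound 0 0))
  weak φ hφ := by
    have hK : ∀ K, ∫ z, push L g (Idx.upTo K) z.1 z.2 * material φ z (mixFin K L z.1 z.2)
        ∂(stMeasure 0 50) = -∫ x, f₀ x * φ 0 x := fun K =>
      ((regularFlow_mixFin L K).isWeakSolution (by norm_num) hg hC hf₀).weak φ hφ
    have h1 := h.tendsto_integral_stMeasure hL hg hC (integrable_material_mixInf (L := L) hφ)
    have h2 := tendsto_integral_material_sub (L := L) hφ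
      (w := fun K z => push L g (Idx.upTo K) z.1 z.2) (C := C)
      (fun K => measurable_uncurry_push hg _) (fun K z => hC _)
    have h3 := h1.add h2
    have e : ∀ K, ∫ z, push L g (Idx.upTo K) z.1 z.2 * material φ z (mixInf L z.1 z.2)
        ∂(stMeasure 0 50) + ∫ z, push L g (Idx.upTo K) z.1 z.2 *
          (material φ z (mixFin K L z.1 z.2) - material φ z (mixInf L z.1 z.2))
        ∂(stMeasure 0 50) = -∫ x, f₀ x * φ 0 x := by
      intro K
      have hb : ∀ᵐ z ∂(stMeasure 0 50), ‖push L g (Idx.upTo K) z.1 z.2‖ ≤ C :=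
        Eventually.of_forall fun z => hC _
      have hmP : AEStronglyMeasurable (fun z : ℝ × T2 => push L g (Idx.upTo K) z.1 z.2)
          (stMeasure 0 50) := (measurable_uncurry_push hg _).aestronglyMeasurable
      have i1 := (integrable_material_mixInf (L := L) hφ).bdd_mul hmP hb
      have i2 := (integrable_material_mixFin (L := L) K hφ).bdd_mul hmP hb
      simp only [mul_sub]
      rw [integral_sub i2 i1, hK]
      ring
    simp only [e, add_zero] at h3
    exact tendsto_nhds_unique h3 tendsto_const_nhds

/-- An essentially bounded function has a bounded measurable representative. -/
theorem exists_bounded_representative {f₀ : T2 → ℝ} (hf₀ : MemLp f₀ ⊤ volume) :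
    ∃ (g : T2 → ℝ) (C : ℝ), Measurable g ∧ (∀ x, |g x| ≤ C) ∧ f₀ =ᵐ[volume] g := by
  set C : ℝ := (eLpNorm f₀ ⊤ volume).toReal
  have hC : 0 ≤ C := ENNReal.toReal_nonneg
  refine ⟨fun x => max (-C) (min C (hf₀.1.mk f₀ x)), C,
    measurable_const.max (measurable_const.min hf₀.1.stronglyMeasurable_mk.measurable),
    fun x => abs_le.2 ⟨le_max_left _ _, max_le (by linarith) (min_le_left _ _)⟩, ?_⟩
  filter_upwards [hf₀.1.ae_eq_mk, ae_le_eLpNormEssSup (f := f₀) (μ := volume)] with x h1 h2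
  have h3 : |f₀ x| ≤ C := by
    rw [← eLpNorm_exponent_top] at h2
    have := ENNReal.toReal_mono hf₀.2.ne h2
    rwa [toReal_enorm, Real.norm_eq_abs] at this
  rw [← h1, min_eq_right (abs_le.1 h3).2, max_eq_right (abs_le.1 h3).1]

end Mixing

end

/-! ### The main theorem -/

theorem proposition5p3 (f₀ : Mixing.T2 → ℝ) (hf₀ : MemLp f₀ ∞ volume)
    (L : Mixing.Idx → ℕ) (hL : ∀ P : Mixing.Idx, P.k + 1 ≤ L P) :
    ∃ (f : Mixing.Idx → ℝ → Mixing.T2 → ℝ) (fInf : ℝ → Mixing.T2 → ℝ),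
      -- well-posedness along each finite field
      (∀ K : Mixing.Idx,
        Mixing.IsWeakSolution 50 (Mixing.mixFin K L) f₀ (f K) ∧
        (∀ g : ℝ → Mixing.T2 → ℝ, Mixing.IsWeakSolution 50 (Mixing.mixFin K L) f₀ g →
          Function.uncurry g =ᵐ[Mixing.stMeasure 0 50] Function.uncurry (f K)) ∧
        Mixing.MemC0Lp 0 50 1 (f K) ∧
        MemLp (Function.uncurry (f K)) ∞ (Mixing.stMeasure 0 50) ∧
        Mixing.IsLagrangianSolution 50 (Mixing.mixFin K L) f₀ (f K) ∧
        Mixing.IsRenormalised 50 (Mixing.mixFin K L) f₀ (f K)) ∧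
      -- weak-* convergence in `L^∞([0,50]; L^∞)`
      MemLp (Function.uncurry fInf) ∞ (Mixing.stMeasure 0 50) ∧
      (∀ g : ℝ × Mixing.T2 → ℝ, Integrable g (Mixing.stMeasure 0 50) →
        Tendsto (fun K : Mixing.Idx => ∫ z, f K z.1 z.2 * g z ∂(Mixing.stMeasure 0 50)) atTop
          (𝓝 (∫ z, fInf z.1 z.2 * g z ∂(Mixing.stMeasure 0 50)))) ∧
      -- strong convergence in `L^p([0,42]; L^p)` and in `C⁰([0,42-ε]; L^p)`
      (∀ p : ℝ≥0∞, 1 ≤ p → p ≠ ⊤ →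
        Tendsto (fun K : Mixing.Idx =>
          eLpNorm (fun z : ℝ × Mixing.T2 => f K z.1 z.2 - fInf z.1 z.2) p
            (Mixing.stMeasure 0 42)) atTop (𝓝 0) ∧
        ∀ ε : ℝ, 0 < ε →
          (∀ K : Mixing.Idx, Mixing.MemC0Lp 0 (42 - ε) p (f K)) ∧
          Mixing.MemC0Lp 0 (42 - ε) p fInf ∧
          Tendsto (fun K : Mixing.Idx =>
            ⨆ t ∈ Icc (0 : ℝ) (42 - ε), eLpNorm (fun x => f K t x - fInf t x) p volume)
            atTop (𝓝 0)) ∧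
      -- the limit is a weak solution along the infinite field, and is perfectly mixed
      Mixing.MemC0WeakStar 50 fInf ∧
      Mixing.IsWeakSolution 50 (Mixing.mixInf L) f₀ fInf ∧
      ∀ t ∈ Icc (42 : ℝ) 50, fInf t =ᵐ[volume] fun _ => ∫ y, f₀ y := by
  -- An everywhere bounded measurable representative makes all transported functions measurable and
  -- bounded at every point, so bounds need no exceptional sets depending on time.
  obtain ⟨g, C, hg, hC, hfg⟩ := Mixing.exists_bounded_representative hf₀
  obtain ⟨F, hF⟩ := Mixing.exists_isPushLimit (L := L) hg hC
  have hFm : ∀ p, MemLp (Function.uncurry F) p (Mixing.stMeasure 0 50) :=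
    Mixing.memLp_of_bounded hF.measurable fun z => hF.bound z.1 z.2
  refine ⟨fun K => Mixing.push L g (Mixing.Idx.upTo K), F, fun K => ?_, hFm _,
    fun k hk => hF.tendsto_integral_stMeasure hL hg hC hk, fun p hp hp' =>
      ⟨hF.tendsto_eLpNorm hg hC hp hp', fun ε hε =>
        ⟨fun K => Mixing.memC0Lp_push hg hC _ _ _ hp hp',
          Mixing.memC0Lp_of_bounded hF.measurable_apply hF.bound
            (fun s hs => hF.tendsto_distL1_time hg hC (by linarith [hs.2])) hp hp',
          hF.tendsto_iSup_eLpNorm hC hp hp' hε⟩⟩,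
    ⟨fun t _ => Mixing.memLp_of_bounded (hF.measurable_apply t) (hF.bound t) _,
      fun k hk => (hF.continuous_integral hL hg hC hk).continuousOn⟩,
    hF.isWeakSolution hL hg hC hfg, fun t ht => Eventually.of_forall fun x => ?_⟩
  · have hR := Mixing.regularFlow_mixFin L K
    have hw := hR.isWeakSolution (by norm_num) hg hC hfg
    exact ⟨hw, fun k hk => Mixing.IsWeakSolution.unique (Mixing.chrono_sched _)
        (fun s hs => Mixing.nonneg_of_mem_sched hs)
        (fun s hs => (Mixing.le_of_mem_sched hs).trans (by norm_num))
        (Mixing.ae_mixFin_eq K 0 50) hw hk,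
      Mixing.memC0Lp_push hg hC _ _ _ le_rfl ENNReal.one_ne_top,
      Mixing.memLp_of_bounded (Mixing.measurable_uncurry_push hg _) (fun _ => hC _) _,
      hR.isLagrangianSolution hg hC hfg, hR.isRenormalised (by norm_num) hg hC hfg⟩
  · simp only [hF.mean t ht.1 x, integral_congr_ae hfg]
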